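/- Let $b>0$ and consider the angle $|\arg z|\le \pi b$ (if $b>1$, it lies on the universal covering of $\mathbb C\setminus\{0\}$, i.e. the Riemann surface of $\log z$). Powers $z^{s}=e^{s\log z}$ are defined by the branch of $\log$ that is real on the positive half-axis $\arg z=0$, and $dx\,dy$ is the planar area measure, $z=x+iy$. A *wedge-shaped region* in an angle is a connected open bounded subset $\Omega$ of the open angle whose boundary consists of a simple arc $\Gamma$ joining the two sides of the angle ($\Gamma$ is continuous, meets the sides only at its endpoints, and is a regular $C^1$ curve away from the endpoints) and of the segments of the two sides between the origin and the endpoints of $\Gamma$. Below, $\Phi$ is a harmonic function in $\Omega$, continuous on $\overline\Omega\setminus\{0\}$ and $C^1$ up to $\Gamma$ without its endpoints, with $$\Phi(z)=-\mathrm{Re}\,(z^{-1/(2b)})+o(|z|^{-1/(2b)}),\qquad z\to 0,\ z\in\Omega ,$$ and such that $\Gamma$ moves homothetically under the normal derivative of $\Phi$: there is a constant $c\in\mathbb R$ such that, at every point $z$ of $\Gamma$ other than its endpoints, $\partial\Phi/\partial n=c\,\langle z,n\rangle$, where $n$ is the outward unit normal. *Killing problem.* $\Omega$ is a wedge-shaped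 region in the angle $-\pi b\le\arg z\le\pi b$, symmetric with respect to $z\mapsto\bar z$, for which there is such a $\Phi$ vanishing on $\Gamma$ and on both sides of the angle. *Killing-reflecting problem.* $\Omega$ is a wedge-shaped region in the angle $0\le\arg z\le\pi b$, for which there is such a $\Phi$ vanishing on $\Gamma$ and on the side $\arg z=\pi b$, and which is $C^1$ up to the open segment of the side $\arg z=0$ between the origin and the endpoint of $\Gamma$ and satisfies $\partial\Phi/\partial n=0$ there. Then: (i) If $\Omega$ solves the killing problem, then for every integer $n\ge 1$ the function $z^{(2n+1)/(2b)}$ is integrable on $\Omega$ and $$\int_\Omega z^{\frac{2n+1}{2b}}\,dx\,dy=0 .$$ (ii) If $\Omega$ solves the killing problem, then its upper half $\{z\in\Omega:\arg z>0\}$ solves the killing-reflecting problem. (iii) If $\Omega$ solves the killing-reflecting problem (in particular, if it is the upper half of a solution of the killing problem), then for every integer $n\ge1$ the function $\mathrm{Re}\,(z^{(2n+1)/(2b)})$ is integrable on $\Omega$ and $$\int_\Omega \mathrm{Re}\Big(z^{\frac{2n+1}{2b}}\Big)\,dx\,dy=0 .$$ -/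

import Mathlib

open Set Filter Topology MeasureTheory Asymptotics

namespace HeleShaw

/-! Regions in an angle of arbitrary opening live on the universal covering of the punctured plane.
This Riemann surface is `ℂ` with the global coordinate `w = log z`: a point `w` lies over
`z = exp w`, `w.im` is its argument and `exp w.re` its distance to the origin; the origin itself
corresponds to `w.re → -∞`. For openings of at most `2 * π` this is the same as the plane region
with its branch of the logarithm. -/

/-- The planar coordinate `z` of a point of the surface. -/
noncomputable def coord (w : ℂ) : ℂ := Complex.exp w

/-- The branch of `z ^ s` on the surface that is real on the ray `arg z = 0`. -/
noncomputable def power (s : ℝ) (w : ℂ) : ℂ := Complex.exp (s * w)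

/-- The planar area measure `dx dy`, `z = x + i y`, pulled back to the surface:
`dx dy = |exp w|² dA(w)`. -/
noncomputable def area : Measure ℂ :=
  volume.withDensity (fun w => ENNReal.ofReal (‖coord w‖ ^ 2))

/-- Where `coord` is injective, integrals against `area` are planar Lebesgue integrals. -/
theorem setIntegral_coord_image (Ω : Set ℂ) (hΩ : MeasurableSet Ω) (hinj : InjOn coord Ω)
    (f : ℂ → ℂ) : ∫ z in coord '' Ω, f z = ∫ w in Ω, f (coord w) ∂area := by
  have hd : ∀ w ∈ Ω, HasFDerivWithinAt coord
      ((ContinuousLinearMap.toSpanSingleton ℂ (Complex.exp w)).restrictScalars ℝ) Ω w := fun w _ =>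
    ((Complex.hasDerivAt_exp w).hasFDerivAt.restrictScalars ℝ).hasFDerivWithinAt
  rw [integral_image_eq_integral_abs_det_fderiv_smul volume hΩ hd hinj, area,
    setIntegral_withDensity_eq_setIntegral_toReal_smul _ _ _ hΩ]
  · refine setIntegral_congr_fun hΩ fun w _ => ?_
    have h : ((ContinuousLinearMap.toSpanSingleton ℂ (Complex.exp w)).restrictScalars ℝ).det
        = ‖coord w‖ ^ 2 := by
      simp [ContinuousLinearMap.det, LinearMap.det_restrictScalars, coord,
        Algebra.norm_complex_apply, Complex.normSq_eq_norm_sq]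
    simp only [h]
    rw [ENNReal.toReal_ofReal (by positivity), abs_of_nonneg (by positivity)]
  · unfold coord
    fun_prop
  · exact Eventually.of_forall fun _ => ENNReal.ofReal_lt_top

/-- `γ`, parametrized by `[0, 1]`, is a simple arc inside the angle `α ≤ arg z ≤ β` going from the
side `arg z = α` to the side `arg z = β`; it is continuous, continuously differentiable with
nonvanishing velocity away from its endpoints, and meets the sides only at its endpoints. -/
structure IsCrossArc (α β : ℝ) (γ : ℝ → ℂ) : Prop where
  continuousOn : ContinuousOn γ (Icc 0 1)
  injOn : InjOn γ (Icc 0 1)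
  contDiffOn : ContDiffOn ℝ 1 γ (Ioo 0 1)
  deriv_ne_zero : ∀ t ∈ Ioo (0 : ℝ) 1, deriv γ t ≠ 0
  start_mem : (γ 0).im = α
  end_mem : (γ 1).im = β
  inside : ∀ t ∈ Ioo (0 : ℝ) 1, α < (γ t).im ∧ (γ t).im < β

/-- `Ω` is the bounded region in the angle `α < arg z < β` bounded by the arc `γ` and by the
segments of the two sides that join the origin to the endpoints of `γ`. -/
structure IsWedgeRegion (α β : ℝ) (Ω : Set ℂ) (γ : ℝ → ℂ) : Prop where
  arc : IsCrossArc α β γ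
  isOpen : IsOpen Ω
  isConnected : IsConnected Ω
  inside : ∀ w ∈ Ω, α < w.im ∧ w.im < β
  bounded : ∃ M : ℝ, ∀ w ∈ Ω, ‖coord w‖ ≤ M
  frontier_eq : frontier Ω =
    γ '' Icc 0 1 ∪ {w | w.im = α ∧ w.re ≤ (γ 0).re} ∪ {w | w.im = β ∧ w.re ≤ (γ 1).re}

/-- `Φ`, given on `Ω`, is continuously differentiable up to the boundary point `p`, and there its
derivative in the direction of the vector `v` of the `z`-plane is `d`.
(Since `dz = exp w dw`, the vector `v` is `v / exp p` in the coordinate `w`.) -/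
def HasBoundaryDeriv (Φ : ℂ → ℝ) (Ω : Set ℂ) (p v : ℂ) (d : ℝ) : Prop :=
  ∃ L : ℂ →L[ℝ] ℝ, Tendsto (fderiv ℝ Φ) (𝓝[Ω] p) (𝓝 L) ∧ L (v / coord p) = d

/-- The unit normal of the planar curve `z = coord (γ t)`, on its right-hand side. For an arc
going counterclockwise about the origin from one side of an angle to the other, this is the
outward normal of the region between the origin and the arc. -/
noncomputable def unitNormal (γ : ℝ → ℂ) (t : ℝ) : ℂ :=
  -Complex.I * (deriv (fun τ => coord (γ τ)) t / (‖deriv (fun τ => coord (γ τ)) t‖ : ℂ))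

/-- Moving the arc `γ` with normal velocity `∂Φ/∂n` is infinitesimally a homothety about the origin:
`∂Φ/∂n` equals the normal component of the velocity field `c z`, for some constant `c`. -/
def MovesHomothetically (Φ : ℂ → ℝ) (Ω : Set ℂ) (γ : ℝ → ℂ) : Prop :=
  ∃ c : ℝ, ∀ t ∈ Ioo (0 : ℝ) 1,
    HasBoundaryDeriv Φ Ω (γ t) (unitNormal γ t) (c * inner ℝ (coord (γ t)) (unitNormal γ t))

/-- `Φ` behaves like `-Re (z ^ (-s))` near the origin of `Ω`, with error `o(|z| ^ (-s))`. -/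
def BehavesNearOrigin (s : ℝ) (Φ : ℂ → ℝ) (Ω : Set ℂ) : Prop :=
  (fun w => Φ w - -(power (-s) w).re) =o[comap Complex.re atBot ⊓ 𝓟 Ω] (fun w => ‖power (-s) w‖)

/-- The problem with killing condition on both sides of the angle `|arg z| ≤ π b`. -/
def SolvesKilling (b : ℝ) (Ω : Set ℂ) : Prop :=
  ∃ (γ : ℝ → ℂ) (Φ : ℂ → ℝ),
    IsWedgeRegion (-(Real.pi * b)) (Real.pi * b) Ω γ ∧
    (∀ w ∈ Ω, (starRingEnd ℂ) w ∈ Ω) ∧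
    InnerProductSpace.HarmonicOnNhd Φ Ω ∧
    ContinuousOn Φ (closure Ω) ∧
    (∀ w ∈ frontier Ω, Φ w = 0) ∧
    BehavesNearOrigin (1 / (2 * b)) Φ Ω ∧
    MovesHomothetically Φ Ω γ

/-- The problem in the angle `0 ≤ arg z ≤ π b` with killing condition on the side `arg z = π b`
and reflecting (Neumann) condition on the side `arg z = 0`, the positive half-axis. -/
def SolvesKillingReflecting (b : ℝ) (Ω : Set ℂ) : Prop :=
  ∃ (γ : ℝ → ℂ) (Φ : ℂ → ℝ),
    IsWedgeRegion 0 (Real.pi * b) Ω γ ∧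
    InnerProductSpace.HarmonicOnNhd Φ Ω ∧
    ContinuousOn Φ (closure Ω) ∧
    (∀ t ∈ Icc (0 : ℝ) 1, Φ (γ t) = 0) ∧
    (∀ w ∈ frontier Ω, w.im = Real.pi * b → Φ w = 0) ∧
    (∀ x : ℝ, x < (γ 0).re → HasBoundaryDeriv Φ Ω (x : ℂ) Complex.I 0) ∧
    BehavesNearOrigin (1 / (2 * b)) Φ Ω ∧
    MovesHomothetically Φ Ω γ

/-- The part of `Ω` in the angle `arg z > 0`. -/
def upperHalf (Ω : Set ℂ) : Set ℂ := {w ∈ Ω | 0 < w.im}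

end HeleShaw

/-! In the coordinate `w = x + iy = log z` the wedge becomes a region in a strip, unbounded to the
left. Harmonicity is unchanged, area becomes `e^{2x} dx dy`, and the homothety condition says that
the outward normal derivative of `Φ` on the arc is `c e^{2x} n_x`. For a test function `ψ` consider
the field `Φ ∇ψ - ψ ∇Φ + c e^{2x} ψ ∂_x`. It has no flux through the arc, where `Φ = 0`, nor through
the reflecting side if `ψ_y = 0` there, nor (formally) through the killing side if `ψ = 0` there.
Its divergence is `Φ Δψ + c e^{2x} (2ψ + ψ_x)`, whose integral therefore vanishes: this is the weak
form `IsReflectingSolution.integral_testDensity`.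

Now take `ψ = Re z^m` with `m = (2n+1)/(2b)`, cut off near the origin. It is harmonic, even in `y`,
and vanishes for `y = πb`; moreover `2ψ + ψ_x = (m+2) ψ` where the cutoff equals one. The cutoff
produces a term of size `e^{(m-s)x}`, `s = 1/(2b)`, since `Φ` grows like `e^{-sx}`. For `n ≥ 1` it
disappears in the limit, leaving `c (m+2) ∫ e^{2x} Re z^m = 0`. For `n = 0` it tends to a nonzero
constant, which excludes `c = 0` (`IsReflectingSolution.const_ne_zero`). This gives (iii).

The boundary has little regularity, so the divergence theorem is proved by hand. Near a regular
boundary point the field is multiplied by a cutoff that vanishes where a defining function `v` is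
small compared with `δ`. The cutoff has gradient `O(1/δ)` on a set of area `O(δ)`, and the flux
density tends to zero there (`ZeroFluxAt.exists_local`). At the corner and on the killing side no
derivatives of `Φ` are controlled. There `ψ` itself is cut off, and the error tends to zero because
`Φ` does, helped on the killing side by the vanishing of `ψ`.

For the killing problem, conjugation reverses the arc, which therefore crosses the real axis exactly
once, and the upper half is a wedge region. The potential need not be symmetric, but its even part
satisfies the same conditions and has zero normal derivative on the axis. This proves (ii). Then (i)
follows from (iii), because the integral of `z^m` over the symmetric region is twice the integral of
`Re z^m` over the upper half. -/

namespace HeleShaw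

/-! ### Partial derivatives and divergences with compact support -/

/-- The partial derivative `∂f/∂x`. -/
noncomputable def dx (f : ℂ → ℝ) (w : ℂ) : ℝ := fderiv ℝ f w 1

/-- The partial derivative `∂f/∂y`. -/
noncomputable def dy (f : ℂ → ℝ) (w : ℂ) : ℝ := fderiv ℝ f w Complex.I

theorem dx_mul {f g : ℂ → ℝ} {w : ℂ} (hf : DifferentiableAt ℝ f w) (hg : DifferentiableAt ℝ g w) :
    dx (fun z => f z * g z) w = dx f w * g w + f w * dx g w := by
  simp only [dx, fderiv_fun_mul hf hg, _root_.add_apply, _root_.smul_apply,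
    smul_eq_mul]
  ring

theorem dy_mul {f g : ℂ → ℝ} {w : ℂ} (hf : DifferentiableAt ℝ f w) (hg : DifferentiableAt ℝ g w) :
    dy (fun z => f z * g z) w = dy f w * g w + f w * dy g w := by
  simp only [dy, fderiv_fun_mul hf hg, _root_.add_apply, _root_.smul_apply,
    smul_eq_mul]
  ring

theorem dx_add {f g : ℂ → ℝ} {w : ℂ} (hf : DifferentiableAt ℝ f w) (hg : DifferentiableAt ℝ g w) :
    dx (fun z => f z + g z) w = dx f w + dx g w := by
  simp only [dx, fderiv_fun_add hf hg, _root_.add_apply]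

theorem dx_sub {f g : ℂ → ℝ} {w : ℂ} (hf : DifferentiableAt ℝ f w) (hg : DifferentiableAt ℝ g w) :
    dx (fun z => f z - g z) w = dx f w - dx g w := by
  simp only [dx, fderiv_fun_sub hf hg, _root_.sub_apply]

theorem dx_const_mul {f : ℂ → ℝ} {w : ℂ} (hf : DifferentiableAt ℝ f w) (c : ℝ) :
    dx (fun z => c * f z) w = c * dx f w := by
  simp only [dx, fderiv_const_mul hf c, _root_.smul_apply, smul_eq_mul]

theorem dy_add {f g : ℂ → ℝ} {w : ℂ} (hf : DifferentiableAt ℝ f w) (hg : DifferentiableAt ℝ g w) :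
    dy (fun z => f z + g z) w = dy f w + dy g w := by
  simp only [dy, fderiv_fun_add hf hg, _root_.add_apply]

theorem dy_sub {f g : ℂ → ℝ} {w : ℂ} (hf : DifferentiableAt ℝ f w) (hg : DifferentiableAt ℝ g w) :
    dy (fun z => f z - g z) w = dy f w - dy g w := by
  simp only [dy, fderiv_fun_sub hf hg, _root_.sub_apply]

theorem tendsto_clm_apply {l : Filter ℂ} {T : ℂ → ℂ →L[ℝ] ℝ} {L : ℂ →L[ℝ] ℝ}
    (h : Tendsto T l (𝓝 L)) (v : ℂ) : Tendsto (fun w => T w v) l (𝓝 (L v)) :=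
  ((ContinuousLinearMap.apply ℝ ℝ v).continuous.tendsto L).comp h

/-- Integration by parts against the constant function one. -/
theorem integral_fderiv_apply_eq_zero {H : ℂ → ℝ} (hH : ContDiff ℝ 1 H) (hc : HasCompactSupport H)
    (v : ℂ) : ∫ w, fderiv ℝ H w v = 0 := by
  have hc' : HasCompactSupport (fun w => fderiv ℝ H w v) := hc.fderiv_apply (𝕜 := ℝ) v
  have hcont : Continuous (fun w => fderiv ℝ H w v) :=
    (hH.continuous_fderiv (by norm_num)).clm_apply continuous_const
  have h := integral_mul_fderiv_eq_neg_fderiv_mul_of_integrable (μ := (volume : Measure ℂ))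
    (f := fun _ : ℂ => (1 : ℝ)) (g := H) (v := v) (by simp)
    (by simpa using hcont.integrable_of_hasCompactSupport hc')
    (by simpa using hH.continuous.integrable_of_hasCompactSupport hc)
    (fun x _ => differentiableAt_const _) (fun x _ => hH.differentiable (by norm_num) x)
  simpa using h

/-- The function already vanishes on `W \ S`, and `S` is compact inside `W`, so extension by zero
creates no jump at the boundary of `W`. -/
theorem contDiff_indicator_of_compact {W S : Set ℂ} (hW : IsOpen W) (hS : IsCompact S)
    (hSW : S ⊆ W) {f : ℂ → ℝ} (hf : ContDiffOn ℝ 1 f W) (h0 : ∀ w ∈ W, w ∉ S → f w = 0) :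
    ContDiff ℝ 1 (W.indicator f) ∧ HasCompactSupport (W.indicator f) := by
  have hz : ∀ w ∉ S, W.indicator f w = 0 := fun w hw => by
    by_cases h : w ∈ W
    · simp [h, h0 w h hw]
    · simp [h]
  refine ⟨contDiff_iff_contDiffAt.2 fun w => ?_, HasCompactSupport.intro hS hz⟩
  by_cases hw : w ∈ S
  · refine ((hf w (hSW hw)).contDiffAt (hW.mem_nhds (hSW hw))).congr_of_eventuallyEq ?_
    filter_upwards [hW.mem_nhds (hSW hw)] with z hz
    simp [hz]
  · refine (contDiffAt_const (c := (0 : ℝ))).congr_of_eventuallyEq ?_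
    filter_upwards [hS.isClosed.isOpen_compl.mem_nhds hw] with z hz'
    exact hz z hz'

theorem setIntegral_div_eq_zero_of_compact {W S : Set ℂ} (hW : IsOpen W) (hS : IsCompact S)
    (hSW : S ⊆ W) {F G : ℂ → ℝ} (hF : ContDiffOn ℝ 1 F W) (hG : ContDiffOn ℝ 1 G W)
    (hF0 : ∀ w ∈ W, w ∉ S → F w = 0) (hG0 : ∀ w ∈ W, w ∉ S → G w = 0) :
    ∫ w in W, (dx F w + dy G w) = 0 := by
  obtain ⟨h1, h2⟩ := contDiff_indicator_of_compact hW hS hSW hF hF0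
  obtain ⟨h3, h4⟩ := contDiff_indicator_of_compact hW hS hSW hG hG0
  have key : ∀ f : ℂ → ℝ, ContDiffOn ℝ 1 f W → (∀ w ∈ W, w ∉ S → f w = 0) → ∀ v : ℂ,
      (fun w => fderiv ℝ (W.indicator f) w v) = W.indicator (fun w => fderiv ℝ f w v) := by
    intro f hf hf0 v
    ext w
    by_cases hw : w ∈ W
    · have : W.indicator f =ᶠ[𝓝 w] f := by
        filter_upwards [hW.mem_nhds hw] with z hz
        simp [hz]
      simp [hw, this.fderiv_eq]
    · have : W.indicator f =ᶠ[𝓝 w] fun _ => (0 : ℝ) := by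
        filter_upwards [hS.isClosed.isOpen_compl.mem_nhds (fun h => hw (hSW h))] with z hz
        by_cases h : z ∈ W
        · simp [h, hf0 z h hz]
        · simp [h]
      simp [hw, this.fderiv_eq]
  have i1 := integral_fderiv_apply_eq_zero h1 h2 1
  have i2 := integral_fderiv_apply_eq_zero h3 h4 Complex.I
  have j1 : Integrable (fun w => fderiv ℝ (W.indicator F) w 1) :=
    ((h1.continuous_fderiv (by norm_num)).clm_apply continuous_const).integrable_of_hasCompactSupport
      (h2.fderiv_apply (𝕜 := ℝ) 1)
  have j2 : Integrable (fun w => fderiv ℝ (W.indicator G) w Complex.I) :=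
    ((h3.continuous_fderiv (by norm_num)).clm_apply continuous_const).integrable_of_hasCompactSupport
      (h4.fderiv_apply (𝕜 := ℝ) Complex.I)
  rw [← integral_indicator hW.measurableSet]
  have : W.indicator (fun w => dx F w + dy G w) =
      fun w => fderiv ℝ (W.indicator F) w 1 + fderiv ℝ (W.indicator G) w Complex.I := by
    have e1 := key F hF hF0 1
    have e2 := key G hG hG0 Complex.I
    ext w
    rw [congrFun e1 w, congrFun e2 w]
    by_cases hw : w ∈ W <;> simp [hw, dx, dy]
  rw [this, integral_add j1 j2, i1, i2, add_zero]

/-! ### A divergence theorem for fields without boundary flux -/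

/-- Near `p`, the boundary of `Ω` is the zero set of a `C¹` function with thin sublevel sets, and the
vector field `(F, G)` is bounded and has no normal flux through it. -/
def ZeroFluxAt (Ω : Set ℂ) (F G : ℂ → ℝ) (p : ℂ) : Prop :=
  ∃ r > 0, ∃ v : ℂ → ℝ, ∃ C : ℝ, ContDiffOn ℝ 1 v (Metric.ball p r) ∧
    (∀ w ∈ Metric.ball p r, w ∈ Ω → v w ≠ 0) ∧
    (∀ w ∈ Metric.ball p r, w ∈ frontier Ω → v w = 0) ∧
    (∀ δ > 0, volume.real (Metric.ball p r ∩ {w | |v w| < δ}) ≤ C * δ) ∧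
    (∀ w ∈ Metric.ball p r, w ∈ Ω → |F w| ≤ C ∧ |G w| ≤ C) ∧
    (∀ q ∈ Metric.ball p r, q ∈ frontier Ω →
      Tendsto (fun w => F w * dx v w + G w * dy v w) (𝓝[Ω] q) (𝓝 0))

/-- A smooth function on `ℝ` vanishing near `0` with value one outside of `(-1, 1)`. -/
noncomputable def notch (u : ℝ) : ℝ := Real.smoothTransition (2 * u ^ 2 - 1)

theorem contDiff_two_notch : ContDiff ℝ 2 notch := by
  have := Real.smoothTransition.contDiff (n := 2)
  unfold notch
  exact this.comp (by fun_prop)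

theorem contDiff_notch : ContDiff ℝ 1 notch := contDiff_two_notch.of_le (by norm_num)

theorem notch_of_one_le {u : ℝ} (hu : 1 ≤ |u|) : notch u = 1 := by
  have : 1 ≤ u ^ 2 := by rw [← sq_abs]; nlinarith
  exact Real.smoothTransition.one_of_one_le (by linarith)

theorem notch_of_sq_le {u : ℝ} (hu : u ^ 2 ≤ 1 / 2) : notch u = 0 :=
  Real.smoothTransition.zero_of_nonpos (by linarith)

theorem abs_notch_le (u : ℝ) : |notch u| ≤ 1 :=
  abs_le.2 ⟨le_trans (by norm_num) (Real.smoothTransition.nonneg (2 * u ^ 2 - 1)),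
    Real.smoothTransition.le_one _⟩

theorem deriv_notch_of_one_lt {u : ℝ} (hu : 1 < |u|) : deriv notch u = 0 := by
  have : notch =ᶠ[𝓝 u] fun _ => 1 := by
    filter_upwards [continuous_abs.continuousAt.eventually (lt_mem_nhds hu)] with z hz
    exact notch_of_one_le hz.le
  simp [this.deriv_eq]

theorem deriv_notch_of_sq_lt {u : ℝ} (hu : u ^ 2 < 1 / 2) : deriv notch u = 0 := by
  have : notch =ᶠ[𝓝 u] fun _ => 0 := by
    filter_upwards [(continuous_pow 2).continuousAt.eventually (gt_mem_nhds hu)] with z hz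
    exact notch_of_sq_le (le_of_lt hz)
  simp [this.deriv_eq]

theorem exists_abs_deriv_notch_le : ∃ C > 0, ∀ u, |deriv notch u| ≤ C := by
  obtain ⟨C, hC⟩ := isCompact_Icc.exists_bound_of_continuousOn (s := Icc (-1 : ℝ) 1)
    (contDiff_notch.continuous_deriv le_rfl).continuousOn
  refine ⟨|C| + 1, by positivity, fun u => ?_⟩
  by_cases hu : 1 < |u|
  · rw [deriv_notch_of_one_lt hu]; simp; positivity
  · have := hC u (abs_le.1 (not_lt.1 hu))
    rw [Real.norm_eq_abs] at this
    linarith [le_abs_self C]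

theorem abs_setIntegral_le_of_support {W A : Set ℂ} (hW : MeasurableSet W) (hA : MeasurableSet A)
    {f : ℂ → ℝ} {B V : ℝ} (hB : 0 ≤ B) (hfin : volume A ≠ ⊤) (hV : volume.real A ≤ V)
    (h0 : ∀ w ∈ W, w ∉ A → f w = 0) (hb : ∀ w ∈ W, w ∈ A → |f w| ≤ B) :
    |∫ w in W, f w| ≤ B * V := by
  have hV' : 0 ≤ volume.real A := measureReal_nonneg
  rw [← integral_indicator hW]
  calc |∫ w, W.indicator f w| ≤ ∫ w, A.indicator (fun _ => B) w := by
        rw [← Real.norm_eq_abs]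
        refine norm_integral_le_of_norm_le ?_ (Eventually.of_forall fun w => ?_)
        · exact (integrable_indicator_iff hA).2 (integrableOn_const hfin)
        · by_cases hw : w ∈ W <;> by_cases hw' : w ∈ A
          · simpa [hw, hw'] using hb w hw hw'
          · simp [hw, hw', h0 w hw hw']
          · simpa [hw, hw'] using hB
          · simp [hw, hw']
    _ = volume.real A * B := by rw [integral_indicator hA, setIntegral_const, smul_eq_mul]
    _ ≤ B * V := by rw [mul_comm]; exact mul_le_mul_of_nonneg_left hV hB

theorem contDiffOn_dx {W : Set ℂ} (hW : IsOpen W) {f : ℂ → ℝ} {m n : WithTop ℕ∞}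
    (hf : ContDiffOn ℝ n f W) (hmn : m + 1 ≤ n) : ContDiffOn ℝ m (dx f) W :=
  (hf.fderiv_of_isOpen hW hmn).clm_apply contDiffOn_const

theorem contDiffOn_dy {W : Set ℂ} (hW : IsOpen W) {f : ℂ → ℝ} {m n : WithTop ℕ∞}
    (hf : ContDiffOn ℝ n f W) (hmn : m + 1 ≤ n) : ContDiffOn ℝ m (dy f) W :=
  (hf.fderiv_of_isOpen hW hmn).clm_apply contDiffOn_const

theorem continuousOn_dx {W : Set ℂ} (hW : IsOpen W) {f : ℂ → ℝ} (hf : ContDiffOn ℝ 1 f W) :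
    ContinuousOn (dx f) W :=
  (contDiffOn_dx (m := 0) hW hf (by norm_num)).continuousOn

theorem continuousOn_dy {W : Set ℂ} (hW : IsOpen W) {f : ℂ → ℝ} (hf : ContDiffOn ℝ 1 f W) :
    ContinuousOn (dy f) W :=
  (contDiffOn_dy (m := 0) hW hf (by norm_num)).continuousOn

theorem integrableOn_of_compact_support {W S : Set ℂ} (hW : MeasurableSet W) (hS : IsCompact S)
    (hSW : S ⊆ W) {f : ℂ → ℝ} (hf : ContinuousOn f W) (h0 : ∀ w ∈ W, w ∉ S → f w = 0) :
    IntegrableOn f W :=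
  ((hf.mono hSW).integrableOn_compact hS).of_forall_sdiff_eq_zero hW fun w hw => h0 w hw.1 hw.2

/-- The field `g k (F, G)` with `k = notch (v / δ)` has compact support in `W`, so its divergence
integrates to zero; the identity is the product rule, with the term containing `∇k` moved to the
right. The strict inequality in `h0` makes the derivative of `k` vanish along with `k`. -/
theorem setIntegral_notch_mul {W S : Set ℂ} (hW : IsOpen W) (hS : IsCompact S) (hSW : S ⊆ W)
    {F G g v : ℂ → ℝ} (hF : ContDiffOn ℝ 1 F W) (hG : ContDiffOn ℝ 1 G W)
    (hg : ContDiffOn ℝ 1 g W) (hv : ContDiffOn ℝ 1 v W) {δ : ℝ}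
    (h0 : ∀ w ∈ W, w ∉ S → (g w = 0 ∧ dx g w = 0 ∧ dy g w = 0) ∨ (v w / δ) ^ 2 < 1 / 2) :
    ∫ w in W, notch (v w / δ) * (g w * (dx F w + dy G w) + dx g w * F w + dy g w * G w) =
      -∫ w in W, g w * (deriv notch (v w / δ) / δ) * (F w * dx v w + G w * dy v w) := by
  have hvδ : ContDiffOn ℝ 1 (fun w => v w / δ) W := hv.div_const δ
  have hk : ContDiffOn ℝ 1 (fun w => notch (v w / δ)) W := contDiff_notch.comp_contDiffOn hvδ
  have hgk := hg.mul hk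
  have hz : ∀ w ∈ W, w ∉ S → g w * notch (v w / δ) = 0 := fun w hw hwS => by
    rcases h0 w hw hwS with h | h
    · simp [h.1]
    · simp [notch_of_sq_le h.le]
  have key := setIntegral_div_eq_zero_of_compact hW hS hSW (hgk.mul hF) (hgk.mul hG)
    (fun w hw hwS => by simp [hz w hw hwS]) (fun w hw hwS => by simp [hz w hw hwS])
  have i1 : IntegrableOn (fun w => notch (v w / δ) *
      (g w * (dx F w + dy G w) + dx g w * F w + dy g w * G w)) W := by
    refine integrableOn_of_compact_support hW.measurableSet hS hSW ?_ ?_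
    · have := continuousOn_dx hW hF
      have := continuousOn_dy hW hG
      have := continuousOn_dx hW hg
      have := continuousOn_dy hW hg
      have := hF.continuousOn
      have := hG.continuousOn
      have := hg.continuousOn
      have := hk.continuousOn
      fun_prop
    · intro w hw hwS
      rcases h0 w hw hwS with h | h
      · simp [h.1, h.2.1, h.2.2]
      · simp [notch_of_sq_le h.le]
  have i2 : IntegrableOn (fun w => g w * (deriv notch (v w / δ) / δ) *
      (F w * dx v w + G w * dy v w)) W := by
    refine integrableOn_of_compact_support hW.measurableSet hS hSW ?_ ?_
    · have := continuousOn_dx hW hv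
      have := continuousOn_dy hW hv
      have := hF.continuousOn
      have := hG.continuousOn
      have := hg.continuousOn
      have : ContinuousOn (fun w => deriv notch (v w / δ)) W :=
        (contDiff_notch.continuous_deriv le_rfl).comp_continuousOn hvδ.continuousOn
      fun_prop
    · intro w hw hwS
      rcases h0 w hw hwS with h | h
      · simp [h.1]
      · simp [deriv_notch_of_sq_lt h]
  rw [eq_neg_iff_add_eq_zero, ← integral_add i1 i2, ← key]
  refine setIntegral_congr_fun hW.measurableSet fun w hw => ?_
  have dF := (hF.contDiffAt (hW.mem_nhds hw)).differentiableAt (by norm_num)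
  have dG := (hG.contDiffAt (hW.mem_nhds hw)).differentiableAt (by norm_num)
  have dg := (hg.contDiffAt (hW.mem_nhds hw)).differentiableAt (by norm_num)
  have dv := (hv.contDiffAt (hW.mem_nhds hw)).differentiableAt (by norm_num)
  have dk := (hk.contDiffAt (hW.mem_nhds hw)).differentiableAt (by norm_num)
  have hfd : HasFDerivAt (fun w => notch (v w / δ)) (deriv notch (v w / δ) • (δ⁻¹ • fderiv ℝ v w)) w := by
    have h1 : HasFDerivAt (fun w => v w / δ) (δ⁻¹ • fderiv ℝ v w) w := by
      simpa [div_eq_inv_mul] using dv.hasFDerivAt.const_mul δ⁻¹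
    exact (contDiff_notch.differentiable (by norm_num) _).hasDerivAt.comp_hasFDerivAt w h1
  have e1 : dx (fun w => notch (v w / δ)) w = deriv notch (v w / δ) / δ * dx v w := by
    simp [dx, hfd.fderiv]; ring
  have e2 : dy (fun w => notch (v w / δ)) w = deriv notch (v w / δ) / δ * dy v w := by
    simp [dy, hfd.fderiv]; ring
  have dgk : DifferentiableAt ℝ (fun w => g w * notch (v w / δ)) w := dg.mul dk
  rw [dx_mul dgk dF, dy_mul dgk dG, dx_mul dg dk, dy_mul dg dk, e1, e2]
  ring

theorem fderiv_eq_zero_of_notMem_tsupport {g : ℂ → ℝ} {w : ℂ} (hw : w ∉ tsupport g) :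
    g w = 0 ∧ dx g w = 0 ∧ dy g w = 0 := by
  have : fderiv ℝ g w = 0 := fderiv_of_notMem_tsupport (𝕜 := ℝ) hw
  exact ⟨image_eq_zero_of_notMem_tsupport hw, by simp [dx, this], by simp [dy, this]⟩

/-- Pointwise limits on the zero set of `v` become uniform by compactness: the closure of the set of
points of `K ∩ Ω` where `|Q| ≥ η` avoids the zeros of `v`, so `|v|` has a positive minimum on it. -/
theorem exists_forall_abs_lt_of_tendsto {Ω K : Set ℂ} (hK : IsCompact K)
    {v Q : ℂ → ℝ} (hv : ContinuousOn v K)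
    (hQ : ∀ q ∈ K, v q = 0 → Tendsto Q (𝓝[Ω] q) (𝓝 0)) {η : ℝ} (hη : 0 < η) :
    ∃ δ₀ > 0, ∀ w ∈ K, w ∈ Ω → |v w| < δ₀ → |Q w| < η := by
  set A := {w ∈ K | w ∈ Ω ∧ η ≤ |Q w|} with hA
  have hAK : closure A ⊆ K := closure_minimal (fun w hw => hw.1) hK.isClosed
  have hAc : IsCompact (closure A) := hK.of_isClosed_subset isClosed_closure hAK
  have hne : ∀ q ∈ closure A, v q ≠ 0 := by
    intro q hq hv0
    have h1 : ∀ᶠ w in 𝓝[Ω] q, |Q w| < η := by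
      have := (hQ q (hAK hq) hv0).abs
      rw [abs_zero] at this
      exact this.eventually (gt_mem_nhds hη)
    rw [eventually_nhdsWithin_iff] at h1
    obtain ⟨w, hw1, hw2⟩ := (mem_closure_iff_frequently.1 hq).and_eventually h1 |>.exists
    exact absurd (hw2 hw1.2.1) (not_lt.2 hw1.2.2)
  rcases (closure A).eq_empty_or_nonempty with he | hnon
  · refine ⟨1, one_pos, fun w hw hwΩ _ => ?_⟩
    by_contra h
    have : w ∈ closure A := subset_closure ⟨hw, hwΩ, not_lt.1 h⟩
    simp [he] at this
  · obtain ⟨q, hq, hmin⟩ := hAc.exists_isMinOn hnon ((hv.mono hAK).abs)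
    refine ⟨|v q|, abs_pos.2 (hne q hq), fun w hw hwΩ hlt => ?_⟩
    by_contra h
    exact absurd (hmin (subset_closure ⟨hw, hwΩ, not_lt.1 h⟩ : w ∈ closure A)) (not_le.2 hlt)

/-- Multiply by `notch (v / δ)` and let `δ → 0`. The left side of `setIntegral_notch_mul` converges
by domination, since `v ≠ 0` in `Ω`. On the right the gradient of the notch is `O(1/δ)`, it lives on
a set of area `O(δ)`, and it is multiplied by the flux density `F v_x + G v_y`, which is uniformly
small where `v` is small. -/
theorem ZeroFluxAt.exists_local {Ω : Set ℂ} (hΩ : IsOpen Ω) {F G : ℂ → ℝ}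
    (hF : ContDiffOn ℝ 1 F Ω) (hG : ContDiffOn ℝ 1 G Ω) {D : ℝ}
    (hD : ∀ w ∈ Ω, |dx F w + dy G w| ≤ D) {p : ℂ} (hp : ZeroFluxAt Ω F G p) :
    ∃ r > 0, (∃ C, ∀ w ∈ Metric.ball p r, w ∈ Ω → |F w| ≤ C ∧ |G w| ≤ C) ∧
      ∀ g : ℂ → ℝ, ContDiff ℝ 1 g → tsupport g ⊆ Metric.ball p r →
        ∫ w in Ω, (g w * (dx F w + dy G w) + dx g w * F w + dy g w * G w) = 0 := by
  obtain ⟨r, hr, v, C, hv, hv1, hv2, hvol, hbd, hflux⟩ := hp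
  refine ⟨r, hr, ⟨C, hbd⟩, fun g hg hgs => ?_⟩
  have hK : IsCompact (tsupport g) :=
    (isCompact_closedBall p r).of_isClosed_subset (isClosed_tsupport g)
      (hgs.trans Metric.ball_subset_closedBall)
  have hgc : HasCompactSupport g := hK
  set W := Ω ∩ Metric.ball p r with hWdef
  have hW : IsOpen W := hΩ.inter Metric.isOpen_ball
  set P : ℂ → ℝ := fun w => g w * (dx F w + dy G w) + dx g w * F w + dy g w * G w with hP
  have hP0 : ∀ w, w ∉ tsupport g → P w = 0 := fun w hw => by
    obtain ⟨h1, h2, h3⟩ := fderiv_eq_zero_of_notMem_tsupport hw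
    simp [hP, h1, h2, h3]
  have hWeq : ∫ w in Ω, P w = ∫ w in W, P w := by
    refine setIntegral_eq_of_subset_of_forall_sdiff_eq_zero hΩ.measurableSet inter_subset_left ?_
    intro w hw
    exact hP0 w fun h => hw.2 ⟨hw.1, hgs h⟩
  rw [hWeq]
  obtain ⟨Cg, hCg⟩ := hg.continuous.bounded_above_of_compact_support hgc
  have hCg0 : 0 ≤ Cg := (norm_nonneg _).trans (hCg 0)
  obtain ⟨Ct, hCt0, hCt⟩ := exists_abs_deriv_notch_le
  have hgd := hg.continuous_fderiv (by norm_num)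
  obtain ⟨Cd, hCd⟩ := hgd.bounded_above_of_compact_support (hgc.fderiv (𝕜 := ℝ))
  have hCd0 : 0 ≤ Cd := (norm_nonneg _).trans (hCd 0)
  have hdxg : ∀ w, |dx g w| ≤ Cd := fun w => by
    have := (fderiv ℝ g w).le_of_opNorm_le (hCd w) 1
    simpa [dx] using this
  have hdyg : ∀ w, |dy g w| ≤ Cd := fun w => by
    have := (fderiv ℝ g w).le_of_opNorm_le (hCd w) Complex.I
    simpa [dy] using this
  have hFW := hF.mono (inter_subset_left : W ⊆ Ω)
  have hGW := hG.mono (inter_subset_left : W ⊆ Ω)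
  have hvW := hv.mono (inter_subset_right : W ⊆ Metric.ball p r)
  have hfinW : volume W ≠ ⊤ :=
    ((measure_mono inter_subset_right).trans_lt measure_ball_lt_top).ne
  have hPcont : ContinuousOn P W := by
    have := continuousOn_dx hW hFW
    have := continuousOn_dy hW hGW
    have := continuousOn_dx hW (hg.contDiffOn (s := W))
    have := continuousOn_dy hW (hg.contDiffOn (s := W))
    have := hFW.continuousOn
    have := hGW.continuousOn
    have := hg.continuous
    fun_prop
  have hPb : ∀ w ∈ W, ‖P w‖ ≤ Cg * D + Cd * C + Cd * C := by
    intro w hw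
    have h1 := hbd w hw.2 hw.1
    refine (norm_add_le _ _).trans (add_le_add ((norm_add_le _ _).trans (add_le_add ?_ ?_)) ?_)
    · rw [norm_mul]; exact mul_le_mul (hCg w) (hD w hw.1) (norm_nonneg _) hCg0
    · rw [norm_mul]; exact mul_le_mul (hdxg w) h1.1 (norm_nonneg _) hCd0
    · rw [norm_mul]; exact mul_le_mul (hdyg w) h1.2 (norm_nonneg _) hCd0
  set δ : ℕ → ℝ := fun n => 1 / ((n : ℝ) + 1) with hδ
  have hδpos : ∀ n, 0 < δ n := fun n => by positivity
  have hδlim : Tendsto δ atTop (𝓝 0) := tendsto_one_div_add_atTop_nhds_zero_nat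
  have hnotch_cont : ∀ n, ContinuousOn (fun w => notch (v w / δ n)) W := fun n =>
    contDiff_notch.continuous.comp_continuousOn (hvW.continuousOn.div_const _)
  have hlim1 : Tendsto (fun n => ∫ w in W, notch (v w / δ n) * P w) atTop (𝓝 (∫ w in W, P w)) := by
    refine tendsto_integral_of_dominated_convergence (fun _ => Cg * D + Cd * C + Cd * C)
      (fun n => ((hnotch_cont n).mul hPcont).aestronglyMeasurable hW.measurableSet)
      (integrableOn_const hfinW) (fun n => ?_) ?_
    · filter_upwards [ae_restrict_mem hW.measurableSet] with w hw
      rw [norm_mul]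
      calc _ ≤ 1 * ‖P w‖ := mul_le_mul_of_nonneg_right (abs_notch_le _) (norm_nonneg _)
        _ ≤ _ := by rw [one_mul]; exact hPb w hw
    · filter_upwards [ae_restrict_mem hW.measurableSet] with w hw
      refine tendsto_const_nhds.congr' ?_
      filter_upwards [hδlim.eventually (gt_mem_nhds (abs_pos.2 (hv1 w hw.2 hw.1)))] with n hn
      rw [notch_of_one_le, one_mul]
      rw [abs_div, abs_of_pos (hδpos n), one_le_div (hδpos n)]
      exact hn.le
  have hlim2 : Tendsto (fun n => ∫ w in W, notch (v w / δ n) * P w) atTop (𝓝 0) := by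
    rw [Metric.tendsto_atTop']
    intro ε hε
    set M : ℝ := Cg * Ct * |C| + 1 with hM
    have hMpos : 0 < M := by positivity
    have hfluxK : ∀ q ∈ tsupport g, v q = 0 →
        Tendsto (fun w => F w * dx v w + G w * dy v w) (𝓝[Ω] q) (𝓝 0) := by
      intro q hq hvq
      by_cases hqc : q ∈ closure Ω
      · refine hflux q (hgs hq) ?_
        rw [hΩ.frontier_eq]
        exact ⟨hqc, fun hqΩ => hv1 q (hgs hq) hqΩ hvq⟩
      · rw [notMem_closure_iff_nhdsWithin_eq_bot.1 hqc]
        exact tendsto_bot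
    obtain ⟨δ₀, hδ₀, hsmall⟩ := exists_forall_abs_lt_of_tendsto hK (hv.continuousOn.mono hgs)
      hfluxK (η := ε / M) (by positivity)
    obtain ⟨N, hN⟩ := (hδlim.eventually (gt_mem_nhds hδ₀)).exists_forall_of_atTop
    refine ⟨N, fun n hn => ?_⟩
    have hδn := hN n hn.le
    -- The notch vanishes off `S`, and `S` stays away from the frontier, where `v = 0`; hence `S` is
    -- compact in `W`.
    set S := (tsupport g ∩ closure Ω) ∩ {w | 1 / 2 ≤ (v w / δ n) ^ 2} with hS
    have hKc : IsCompact (tsupport g ∩ closure Ω) := hK.inter_right isClosed_closure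
    have hSc : IsCompact S := by
      refine hKc.of_isClosed_subset ?_ inter_subset_left
      exact ContinuousOn.preimage_isClosed_of_isClosed
        (((hv.continuousOn.mono (inter_subset_left.trans hgs)).div_const _).pow 2) hKc.isClosed
        isClosed_Ici
    have hSW : S ⊆ W := by
      rintro w ⟨⟨h1, h2⟩, h3⟩
      refine ⟨?_, hgs h1⟩
      by_contra h
      have := hv2 w (hgs h1) (by rw [hΩ.frontier_eq]; exact ⟨h2, h⟩)
      simp only [mem_ofPred_eq, this, zero_div] at h3
      norm_num at h3
    have key := setIntegral_notch_mul hW hSc hSW hFW hGW hg.contDiffOn hvW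
      (fun w hw hwS => by
        by_cases h : w ∈ tsupport g
        · right
          by_contra h'
          exact hwS ⟨⟨h, subset_closure hw.1⟩, not_lt.1 h'⟩
        · exact Or.inl (fderiv_eq_zero_of_notMem_tsupport h))
    rw [Real.dist_eq, sub_zero]
    simp only [hP]
    rw [key, abs_neg]
    have hmeas : MeasurableSet (W ∩ {w | |v w| < δ n}) := by
      refine (hvW.continuousOn.abs.isOpen_inter_preimage hW (isOpen_Iio (a := δ n))).measurableSet
    have hV := hvol (δ n) (hδpos n)
    have hle : |∫ w in W, g w * (deriv notch (v w / δ n) / δ n) *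
        (F w * dx v w + G w * dy v w)| ≤ (Cg * (Ct / δ n) * (ε / M)) * (|C| * δ n) := by
      refine abs_setIntegral_le_of_support hW.measurableSet hmeas
        (mul_nonneg (mul_nonneg hCg0 (div_nonneg hCt0.le (hδpos n).le)) (by positivity))
        ((measure_mono inter_subset_left).trans_lt hfinW.lt_top).ne ?_ ?_ ?_
      · refine (measureReal_mono ?_ ?_).trans (hV.trans
          (mul_le_mul_of_nonneg_right (le_abs_self C) (hδpos n).le))
        · exact fun w hw => ⟨hw.1.2, hw.2⟩
        · exact ((measure_mono inter_subset_left).trans_lt measure_ball_lt_top).ne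
      · intro w hw hwA
        have hge : δ n ≤ |v w| := not_lt.1 fun h => hwA ⟨hw, h⟩
        -- For `|v| = δ` the notch is at its maximum, so its derivative vanishes there as well.
        rcases hge.eq_or_lt with h | h
        · have h1 : notch =ᶠ[𝓝 (v w / δ n)] notch := EventuallyEq.rfl
          have : deriv notch (v w / δ n) = 0 := by
            have hmax : IsLocalMax notch (v w / δ n) := by
              refine Eventually.of_forall fun z => ?_
              rw [notch_of_one_le (u := v w / δ n)
                (by rw [abs_div, abs_of_pos (hδpos n), one_le_div (hδpos n)]; exact hge)]
              exact (le_abs_self _).trans (abs_notch_le z)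
            exact hmax.deriv_eq_zero
          simp [this]
        · have : deriv notch (v w / δ n) = 0 := deriv_notch_of_one_lt
            (by rw [abs_div, abs_of_pos (hδpos n), one_lt_div (hδpos n)]; exact h)
          simp [this]
      · intro w hw hwA
        rw [abs_mul, abs_mul]
        by_cases h : w ∈ tsupport g
        · refine mul_le_mul (mul_le_mul (hCg w) ?_ (abs_nonneg _) hCg0)
            (hsmall w h hw.1 (hwA.2.trans hδn)).le (abs_nonneg _)
            (mul_nonneg hCg0 (div_nonneg hCt0.le (hδpos n).le))
          rw [abs_div, abs_of_pos (hδpos n)]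
          exact div_le_div_of_nonneg_right (hCt _) (hδpos n).le
        · rw [image_eq_zero_of_notMem_tsupport h]
          simp only [abs_zero, zero_mul]
          exact mul_nonneg (mul_nonneg hCg0 (div_nonneg hCt0.le (hδpos n).le)) (by positivity)
    refine hle.trans_lt ?_
    -- The powers of `δ` cancel; only the smallness of the flux remains.
    have : (Cg * (Ct / δ n) * (ε / M)) * (|C| * δ n) = ε * ((Cg * Ct * |C|) / M) := by
      have := (hδpos n).ne'
      field_simp
    rw [this]
    have h2 : (Cg * Ct * |C|) / M < 1 := by
      rw [div_lt_one hMpos]; linarith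
    nlinarith
  exact tendsto_nhds_unique hlim1 hlim2

/-- The divergence theorem for a vector field without flux through the boundary. -/
theorem setIntegral_div_eq_zero {Ω K : Set ℂ} (hΩ : IsOpen Ω) (hK : IsCompact K) {F G : ℂ → ℝ}
    (hF : ContDiffOn ℝ 1 F Ω) (hG : ContDiffOn ℝ 1 G Ω)
    (hF0 : ∀ w ∈ Ω, w ∉ K → F w = 0) (hG0 : ∀ w ∈ Ω, w ∉ K → G w = 0) {D : ℝ}
    (hD : ∀ w ∈ Ω, |dx F w + dy G w| ≤ D) (hflux : ∀ p ∈ K, ZeroFluxAt Ω F G p) :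
    IntegrableOn (fun w => dx F w + dy G w) Ω ∧ ∫ w in Ω, (dx F w + dy G w) = 0 := by
  -- `J g` is the divergence of `g (F, G)`.
  set J : (ℂ → ℝ) → ℂ → ℝ := fun g w =>
    g w * (dx F w + dy G w) + dx g w * F w + dy g w * G w with hJ
  have hloc : ∀ p ∈ K, ∃ r > 0, ∃ f : ℂ → ℝ, ContDiff ℝ 1 f ∧ (∀ w ∈ Metric.ball p r, f w = 1) ∧
      (∃ C, ∀ w ∈ Metric.ball p r, w ∈ Ω → |F w| ≤ C ∧ |G w| ≤ C) ∧
      ∀ g : ℂ → ℝ, ContDiff ℝ 1 g → ∫ w in Ω, J (fun w => f w * g w) w = 0 := by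
    intro p hp
    obtain ⟨r, hr, ⟨C, hC⟩, h⟩ := (hflux p hp).exists_local hΩ hF hG hD
    let f : ContDiffBump p := ⟨r / 3, r / 2, by positivity, by linarith⟩
    refine ⟨r / 3, by positivity, f, f.contDiff, fun w hw =>
      f.one_of_mem_closedBall (Metric.ball_subset_closedBall hw),
      ⟨C, fun w hw => hC w (Metric.ball_subset_ball (by linarith) hw)⟩, fun g hg => ?_⟩
    refine h _ (f.contDiff.mul hg) ((tsupport_mul_subset_left).trans ?_)
    rw [f.tsupport_eq]
    exact Metric.closedBall_subset_ball (by show r / 2 < r; linarith)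
  choose! r hr f hf hf1 hC hfz using hloc
  obtain ⟨t, htK, htc⟩ := hK.elim_nhds_subcover (fun p => Metric.ball p (r p))
    fun p hp => Metric.ball_mem_nhds p (hr p hp)
  choose! C hC using hC
  have hbound : ∀ w ∈ Ω, |F w| ≤ ∑ p ∈ t, |C p| ∧ |G w| ≤ ∑ p ∈ t, |C p| := by
    intro w hw
    by_cases hwK : w ∈ K
    · obtain ⟨p, hp, hwp⟩ := mem_iUnion₂.1 (htc hwK)
      have h1 := hC p (htK p hp) w hwp hw
      have h2 : |C p| ≤ ∑ p ∈ t, |C p| :=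
        Finset.single_le_sum (f := fun p => |C p|) (fun _ _ => abs_nonneg _) hp
      exact ⟨h1.1.trans ((le_abs_self _).trans h2), h1.2.trans ((le_abs_self _).trans h2)⟩
    · rw [hF0 w hw hwK, hG0 w hw hwK, abs_zero]
      exact ⟨Finset.sum_nonneg fun _ _ => abs_nonneg _, Finset.sum_nonneg fun _ _ => abs_nonneg _⟩
  set B := ∑ p ∈ t, |C p| with hB
  have hKo : IsOpen (Ω \ K) := hΩ.sdiff hK.isClosed
  have hdiv0 : ∀ w ∈ Ω, w ∉ K → dx F w + dy G w = 0 := by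
    intro w hw hwK
    have h1 : F =ᶠ[𝓝 w] fun _ => 0 := by
      filter_upwards [hKo.mem_nhds ⟨hw, hwK⟩] with z hz using hF0 z hz.1 hz.2
    have h2 : G =ᶠ[𝓝 w] fun _ => 0 := by
      filter_upwards [hKo.mem_nhds ⟨hw, hwK⟩] with z hz using hG0 z hz.1 hz.2
    simp [dx, dy, h1.fderiv_eq, h2.fderiv_eq]
  have hint : ∀ g : ℂ → ℝ, ContDiff ℝ 1 g → IntegrableOn (J g) Ω := by
    intro g hg
    have hcont : ContinuousOn (J g) Ω := by
      have := continuousOn_dx hΩ hF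
      have := continuousOn_dy hΩ hG
      have := continuousOn_dx hΩ (hg.contDiffOn (s := Ω))
      have := continuousOn_dy hΩ (hg.contDiffOn (s := Ω))
      have := hF.continuousOn
      have := hG.continuousOn
      have := hg.continuous
      fun_prop
    have hmeas : MeasurableSet (Ω ∩ K) := hΩ.measurableSet.inter hK.measurableSet
    obtain ⟨C0, hC0⟩ := hK.exists_bound_of_continuousOn hg.continuous.continuousOn
    obtain ⟨C1, hC1⟩ := hK.exists_bound_of_continuousOn
      (continuousOn_dx isOpen_univ hg.contDiffOn |>.mono (subset_univ K))
    obtain ⟨C2, hC2⟩ := hK.exists_bound_of_continuousOn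
      (continuousOn_dy isOpen_univ hg.contDiffOn |>.mono (subset_univ K))
    have hfin : volume (Ω ∩ K) ≠ ⊤ :=
      ((measure_mono inter_subset_right).trans_lt hK.measure_lt_top).ne
    have h1 : IntegrableOn (J g) (Ω ∩ K) := by
      refine IntegrableOn.of_bound hfin.lt_top
        ((hcont.mono inter_subset_left).aestronglyMeasurable hmeas) (C0 * D + C1 * B + C2 * B) ?_
      filter_upwards [ae_restrict_mem hmeas] with w hw
      refine (norm_add_le _ _).trans (add_le_add ((norm_add_le _ _).trans (add_le_add ?_ ?_)) ?_)
      · rw [norm_mul]; exact mul_le_mul (hC0 w hw.2) (hD w hw.1) (norm_nonneg _)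
          ((norm_nonneg _).trans (hC0 w hw.2))
      · rw [norm_mul]; exact mul_le_mul (hC1 w hw.2) (hbound w hw.1).1 (norm_nonneg _)
          ((norm_nonneg _).trans (hC1 w hw.2))
      · rw [norm_mul]; exact mul_le_mul (hC2 w hw.2) (hbound w hw.1).2 (norm_nonneg _)
          ((norm_nonneg _).trans (hC2 w hw.2))
    refine h1.of_forall_sdiff_eq_zero hΩ.measurableSet fun w hw => ?_
    have hwK : w ∉ K := fun h => hw.2 ⟨hw.1, h⟩
    simp [hJ, hF0 w hw.1 hwK, hG0 w hw.1 hwK, hdiv0 w hw.1 hwK]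
  have hJ1 : J (fun _ => 1) = fun w => dx F w + dy G w := by
    ext w; simp [hJ, dx, dy]
  -- A partition of unity in product form: replacing `g` by `g (1 - f p)` changes the integral of `J
  -- g` by that of `J (f p * g)`, which is zero by the local result. After all factors are inserted,
  -- the product vanishes near `K`.
  have hind : ∀ t' : Finset ℂ, (∀ p ∈ t', p ∈ K) → ContDiff ℝ 1 (fun w => ∏ p ∈ t', (1 - f p w)) ∧
      ∫ w in Ω, J (fun w => ∏ p ∈ t', (1 - f p w)) w = ∫ w in Ω, J (fun _ => 1) w := by
    intro t'
    induction t' using Finset.induction_on with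
    | empty => intro _; simp [contDiff_const]
    | insert p t' hpt ih =>
      intro hsub
      obtain ⟨hg, he⟩ := ih fun q hq => hsub q (Finset.mem_insert_of_mem hq)
      have hpK := hsub p (Finset.mem_insert_self p t')
      set g := fun w => ∏ p ∈ t', (1 - f p w) with hgdef
      have hfg : ContDiff ℝ 1 (fun w => f p w * g w) := (hf p hpK).mul hg
      have e : (fun w => ∏ q ∈ insert p t', (1 - f q w)) = fun w => g w - f p w * g w := by
        ext w; rw [Finset.prod_insert hpt]; ring
      rw [e]
      refine ⟨hg.sub hfg, ?_⟩
      have e2 : J (fun w => g w - f p w * g w) = fun w => J g w - J (fun w => f p w * g w) w := by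
        ext w
        have h1 := hg.differentiable (by norm_num) w
        have h2 := hfg.differentiable (by norm_num) w
        simp only [hJ, dx, dy, fderiv_fun_sub h1 h2, _root_.sub_apply]
        ring
      rw [e2, integral_sub (hint g hg) (hint _ hfg), hfz p hpK g hg, sub_zero, he]
  obtain ⟨hg, he⟩ := hind t htK
  have h1 := hint (fun _ => 1) contDiff_const
  rw [hJ1] at h1 he
  refine ⟨h1, ?_⟩
  rw [← he]
  refine setIntegral_eq_zero_of_forall_eq_zero fun w hw => ?_
  by_cases hwK : w ∈ K
  · have hz : (fun w => ∏ p ∈ t, (1 - f p w)) =ᶠ[𝓝 w] fun _ => 0 := by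
      obtain ⟨p, hp, hwp⟩ := mem_iUnion₂.1 (htc hwK)
      filter_upwards [Metric.isOpen_ball.mem_nhds hwp] with z hz
      exact Finset.prod_eq_zero hp (by rw [hf1 p (htK p hp) z hz, sub_self])
    have := hz.fderiv_eq (𝕜 := ℝ)
    simp only [hJ, dx, dy, this]
    rw [hz.eq_of_nhds]
    simp
  · simp [hJ, hF0 w hw hwK, hG0 w hw hwK, hdiv0 w hw hwK]

/-! ### Zero flux off the boundary and along regular curves -/

/-- A small ball is either inside `Ω` or disjoint from it, so nothing has to be cut off and `v = 1`
serves. -/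
theorem zeroFluxAt_of_mem {Ω : Set ℂ} (hΩ : IsOpen Ω) {F G : ℂ → ℝ} (hF : ContDiffOn ℝ 1 F Ω)
    (hG : ContDiffOn ℝ 1 G Ω) {p : ℂ} (hp : p ∉ frontier Ω) : ZeroFluxAt Ω F G p := by
  -- The sublevel set is empty for `δ ≤ 1`; for `δ > 1` the area of the ball is at most `δ` times
  -- itself.
  have hvol : ∀ r : ℝ, ∀ δ > 0, volume.real (Metric.ball p r ∩ {_w : ℂ | |(1 : ℝ)| < δ}) ≤
      volume.real (Metric.ball p r) * δ := by
    intro r δ hδ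
    by_cases h : 1 < δ
    · refine (measureReal_mono inter_subset_left measure_ball_lt_top.ne).trans ?_
      exact le_mul_of_one_le_right measureReal_nonneg h.le
    · have : {_w : ℂ | |(1 : ℝ)| < δ} = ∅ := by ext; simp [not_lt.1 h]
      rw [this]
      simp only [inter_empty, measureReal_empty]
      exact mul_nonneg measureReal_nonneg hδ.le
  obtain ⟨r, hr, hr1, hr2⟩ : ∃ r > 0, Metric.closedBall p r ∩ frontier Ω = ∅ ∧
      (Metric.closedBall p r ⊆ Ω ∨ Metric.closedBall p r ∩ Ω = ∅) := by
    by_cases hpΩ : p ∈ Ω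
    · obtain ⟨r, hr, h⟩ := Metric.nhds_basis_closedBall.mem_iff.1 (hΩ.mem_nhds hpΩ)
      refine ⟨r, hr, ?_, Or.inl h⟩
      ext w
      simp only [mem_inter_iff, mem_empty_iff_false, iff_false, not_and, hΩ.frontier_eq]
      exact fun hw h' => h'.2 (h hw)
    · have hpc : p ∉ closure Ω := fun h => hp (by rw [hΩ.frontier_eq]; exact ⟨h, hpΩ⟩)
      obtain ⟨r, hr, h⟩ := Metric.nhds_basis_closedBall.mem_iff.1
        (isClosed_closure.isOpen_compl.mem_nhds hpc)
      refine ⟨r, hr, ?_, Or.inr ?_⟩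
      · ext w
        simp only [mem_inter_iff, mem_empty_iff_false, iff_false, not_and]
        exact fun hw h' => h hw h'.1
      · ext w
        simp only [mem_inter_iff, mem_empty_iff_false, iff_false, not_and]
        exact fun hw h' => h hw (subset_closure h')
  have hno : ∀ w ∈ Metric.ball p r, w ∉ frontier Ω := fun w hw h => by
    have : w ∈ Metric.closedBall p r ∩ frontier Ω := ⟨Metric.ball_subset_closedBall hw, h⟩
    simp [hr1] at this
  obtain ⟨C, hC⟩ : ∃ C, ∀ w ∈ Metric.ball p r, w ∈ Ω → |F w| ≤ C ∧ |G w| ≤ C := by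
    rcases hr2 with h | h
    · obtain ⟨C1, hC1⟩ := (isCompact_closedBall p r).exists_bound_of_continuousOn
        (hF.continuousOn.mono h)
      obtain ⟨C2, hC2⟩ := (isCompact_closedBall p r).exists_bound_of_continuousOn
        (hG.continuousOn.mono h)
      exact ⟨max C1 C2, fun w hw _ =>
        ⟨(hC1 w (Metric.ball_subset_closedBall hw)).trans (le_max_left _ _),
          (hC2 w (Metric.ball_subset_closedBall hw)).trans (le_max_right _ _)⟩⟩
    · refine ⟨0, fun w hw hwΩ => ?_⟩
      have : w ∈ Metric.closedBall p r ∩ Ω := ⟨Metric.ball_subset_closedBall hw, hwΩ⟩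
      simp [h] at this
  refine ⟨r, hr, fun _ => 1, max C (volume.real (Metric.ball p r)), contDiffOn_const,
    fun _ _ _ => one_ne_zero, fun w hw h => absurd h (hno w hw),
    fun δ hδ => (hvol r δ hδ).trans (mul_le_mul_of_nonneg_right (le_max_right _ _) hδ.le),
    fun w hw hwΩ => ⟨(hC w hw hwΩ).1.trans (le_max_left _ _), (hC w hw hwΩ).2.trans (le_max_left _ _)⟩,
    fun q hq h => absurd h (hno q hq)⟩

/-- The real and imaginary parts of `w` in the frame rotated by the unit complex number `a`. -/
noncomputable def frame (a : Circle) : ℂ ≃ᵐ ℝ × ℝ :=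
  (rotation a⁻¹).toHomeomorph.toMeasurableEquiv.trans Complex.measurableEquivRealProd

theorem frame_apply (a : Circle) (w : ℂ) :
    frame a w = (((a⁻¹ : Circle) * w : ℂ).re, ((a⁻¹ : Circle) * w : ℂ).im) := rfl

theorem measurePreserving_frame (a : Circle) : MeasurePreserving (frame a) :=
  Complex.volume_preserving_equiv_real_prod.comp
    (LinearIsometryEquiv.measurePreserving (rotation a⁻¹))

/-- Fubini in the rotated frame: over a base interval of length `2 ρ`, each slice lies in an
interval of length `2 δ`. -/
theorem volume_graph_neighborhood_le (a : Circle) {E : Set ℂ} (hE : MeasurableSet E) (φ : ℝ → ℝ)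
    {c ρ δ : ℝ} (hδ : 0 < δ)
    (h1 : ∀ w ∈ E, |(frame a w).1 - c| < ρ) (h2 : ∀ w ∈ E, |(frame a w).2 - φ (frame a w).1| < δ) :
    volume E ≤ ENNReal.ofReal (4 * ρ * δ) := by
  have hpre : volume E = (volume : Measure (ℝ × ℝ)) ((frame a).symm ⁻¹' E) :=
    (((measurePreserving_frame a).symm _).measure_preimage hE.nullMeasurableSet).symm
  rw [hpre, Measure.volume_eq_prod, Measure.prod_apply ((frame a).symm.measurable hE)]
  calc _ ≤ ∫⁻ x, (Metric.ball c ρ).indicator (fun _ => ENNReal.ofReal (2 * δ)) x := by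
        refine lintegral_mono fun x => ?_
        by_cases hx : x ∈ Metric.ball c ρ
        · rw [indicator_of_mem hx]
          calc _ ≤ volume (Metric.ball (φ x) δ) := by
                refine measure_mono fun y hy => ?_
                have := h2 _ hy
                simpa [Real.dist_eq] using this
            _ = _ := Real.volume_ball _ _
        · rw [indicator_of_notMem hx]
          refine le_of_eq (measure_mono_null (t := ∅) (fun y hy => hx ?_) measure_empty)
          have := h1 _ hy
          simpa [Real.dist_eq] using this
    _ = _ := by
        rw [lintegral_indicator Metric.isOpen_ball.measurableSet, setLIntegral_const,
          Real.volume_ball, ← ENNReal.ofReal_mul (by positivity)]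
        congr 1; ring

theorem exists_local_inverse {f : ℝ → ℝ} {t₀ : ℝ} (hf : ContDiffAt ℝ 1 f t₀)
    (h0 : deriv f t₀ ≠ 0) : ∃ s : ℝ → ℝ, ContDiffAt ℝ 1 s (f t₀) ∧ s (f t₀) = t₀ ∧
      (∀ᶠ u in 𝓝 (f t₀), f (s u) = u) ∧ ∀ᶠ t in 𝓝 t₀, s (f t) = t := by
  have hd : HasFDerivAt f
      ((ContinuousLinearEquiv.unitsEquivAut ℝ (Units.mk0 _ h0) : ℝ ≃L[ℝ] ℝ) : ℝ →L[ℝ] ℝ) t₀ :=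
    (hf.differentiableAt (by norm_num)).hasDerivAt.hasFDerivAt_equiv h0
  have hs := hf.hasStrictFDerivAt' hd (by norm_num)
  refine ⟨hf.localInverse hd (by norm_num), hf.to_localInverse hd (by norm_num), ?_, ?_, ?_⟩
  · exact hf.localInverse_apply_image hd (by norm_num)
  · exact hs.eventually_right_inverse
  · exact hs.eventually_left_inverse

theorem fderiv_apply_eq (f : ℂ → ℝ) (w u : ℂ) : fderiv ℝ f w u = u.re * dx f w + u.im * dy f w := by
  have : u = u.re • (1 : ℂ) + u.im • Complex.I := by simp
  conv_lhs => rw [this]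
  simp only [map_add, map_smul, dx, dy, smul_eq_mul]

/-- In the frame whose first axis is the tangent at `t₀`, the curve is locally the graph of a `C¹`
function `φ`, and `v` is the height above this graph. The hypothesis `hloc` ensures that no other
part of the frontier comes near. The limit `(A, B)` of the field is parallel to the tangent, which
the differential of `v` annihilates. -/
theorem zeroFluxAt_of_curve {Ω : Set ℂ} (hΩ : IsOpen Ω) {F G : ℂ → ℝ} {γ : ℝ → ℂ} {a b t₀ : ℝ}
    (hγ : ContDiffOn ℝ 1 γ (Ioo a b)) (hγ0 : ∀ t ∈ Ioo a b, deriv γ t ≠ 0) (ht₀ : t₀ ∈ Ioo a b)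
    (hfr : ∀ t ∈ Ioo a b, γ t ∈ frontier Ω)
    (hloc : ∀ δ > 0, ∀ᶠ w in 𝓝 (γ t₀), w ∈ frontier Ω → ∃ t, |t - t₀| < δ ∧ γ t = w)
    (hlim : ∀ t ∈ Ioo a b, ∃ A B, Tendsto F (𝓝[Ω] γ t) (𝓝 A) ∧ Tendsto G (𝓝[Ω] γ t) (𝓝 B) ∧
      (deriv γ t).re * B - (deriv γ t).im * A = 0) :
    ZeroFluxAt Ω F G (γ t₀) := by
  have hIoo : Ioo a b ∈ 𝓝 t₀ := Ioo_mem_nhds ht₀.1 ht₀.2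
  have hdγ : ∀ t ∈ Ioo a b, HasDerivAt γ (deriv γ t) t := fun t ht =>
    ((hγ.contDiffAt (Ioo_mem_nhds ht.1 ht.2)).differentiableAt (by norm_num)).hasDerivAt
  set d := deriv γ t₀ with hd
  have hd0 : d ≠ 0 := hγ0 t₀ ht₀
  obtain ⟨α, hα⟩ : ∃ α : Circle, (α : ℂ) = d / ‖d‖ :=
    ⟨⟨d / ‖d‖, mem_sphere_zero_iff_norm.2 (by simp [hd0])⟩, rfl⟩
  have hαd : ((α⁻¹ : Circle) : ℂ) * d = ‖d‖ := by
    have hn : (‖d‖ : ℂ) ≠ 0 := by simpa using hd0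
    rw [Circle.coe_inv, hα]
    field_simp
  set l1 : ℂ → ℝ := fun w => (((α⁻¹ : Circle) : ℂ) * w).re with hl1
  set l2 : ℂ → ℝ := fun w => (((α⁻¹ : Circle) : ℂ) * w).im with hl2
  have hl1c : ContDiff ℝ 1 l1 :=
    Complex.reCLM.contDiff.comp (contDiff_const.mul contDiff_id)
  have hl2c : ContDiff ℝ 1 l2 :=
    Complex.imCLM.contDiff.comp (contDiff_const.mul contDiff_id)
  have hl_inj : ∀ w z, l1 w = l1 z → l2 w = l2 z → w = z := fun w z h1 h2 => by
    have : ((α⁻¹ : Circle) : ℂ) * w = ((α⁻¹ : Circle) : ℂ) * z := Complex.ext h1 h2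
    exact mul_left_cancel₀ (Circle.coe_ne_zero _) this
  have hγt₀ : ContDiffAt ℝ 1 γ t₀ := hγ.contDiffAt hIoo
  have hf : ContDiffAt ℝ 1 (fun t => l1 (γ t)) t₀ := hl1c.contDiffAt.comp t₀ hγt₀
  have hf' : deriv (fun t => l1 (γ t)) t₀ ≠ 0 := by
    have h1 : HasDerivAt (fun t => ((α⁻¹ : Circle) : ℂ) * γ t) (((α⁻¹ : Circle) : ℂ) * d) t₀ :=
      (hdγ t₀ ht₀).const_mul _
    have h2 : HasDerivAt (fun t => l1 (γ t)) ((((α⁻¹ : Circle) : ℂ) * d).re) t₀ :=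
      Complex.reCLM.hasFDerivAt.comp_hasDerivAt t₀ h1
    rw [h2.deriv, hαd, Complex.ofReal_re]
    exact norm_ne_zero_iff.2 hd0
  obtain ⟨s, hs, hs0, hs1, hs2⟩ := exists_local_inverse hf hf'
  set φ : ℝ → ℝ := fun u => l2 (γ (s u)) with hφ
  have hφc : ContDiffAt ℝ 1 φ (l1 (γ t₀)) := by
    refine hl2c.contDiffAt.comp _ (ContDiffAt.comp _ ?_ hs)
    rw [hs0]; exact hγt₀
  set v : ℂ → ℝ := fun w => l2 w - φ (l1 w) with hv
  have hvc : ContDiffAt ℝ 1 v (γ t₀) :=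
    hl2c.contDiffAt.sub (hφc.comp (γ t₀) hl1c.contDiffAt)
  obtain ⟨δ₁, hδ₁, hδs⟩ := Metric.eventually_nhds_iff.1 (hs2.and (eventually_mem_set.2 hIoo))
  have hvγ : ∀ t, |t - t₀| < δ₁ → v (γ t) = 0 := fun t ht => by
    have := (hδs (y := t) (by rwa [Real.dist_eq])).1
    simp [hv, hφ, this]
  obtain ⟨A, B, hA, hB, -⟩ := hlim t₀ ht₀
  have N1 : ∀ᶠ w in 𝓝 (γ t₀), ContDiffAt ℝ 1 v w := hvc.eventually (by simp)
  have hl1t : Tendsto l1 (𝓝 (γ t₀)) (𝓝 (l1 (γ t₀))) := hl1c.continuous.continuousAt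
  have N2 : ∀ᶠ w in 𝓝 (γ t₀), l1 (γ (s (l1 w))) = l1 w ∧ s (l1 w) ∈ Ioo a b := by
    refine (hl1t.eventually hs1).and (hl1t.eventually (p := fun u => s u ∈ Ioo a b) ?_)
    have : Tendsto s (𝓝 (l1 (γ t₀))) (𝓝 t₀) := by
      have := hs.continuousAt.tendsto
      rwa [hs0] at this
    exact this.eventually hIoo
  have N4 : ∀ᶠ w in 𝓝 (γ t₀), w ∈ Ω → |F w| < |A| + 1 ∧ |G w| < |B| + 1 := by
    rw [← eventually_nhdsWithin_iff]
    exact (hA.abs.eventually (gt_mem_nhds (lt_add_one _))).and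
      (hB.abs.eventually (gt_mem_nhds (lt_add_one _)))
  obtain ⟨r, hr, hball⟩ := Metric.eventually_nhds_iff_ball.1
    (N1.and (N2.and ((hloc δ₁ hδ₁).and N4)))
  have hvon : ContDiffOn ℝ 1 v (Metric.ball (γ t₀) r) := fun w hw =>
    (hball w hw).1.contDiffWithinAt
  have hnotin : ∀ t ∈ Ioo a b, γ t ∉ Ω := fun t ht h => by
    have := hfr t ht
    rw [hΩ.frontier_eq] at this
    exact this.2 h
  refine ⟨r, hr, v, max (4 * r) (max (|A| + 1) (|B| + 1)), hvon, ?_, ?_, ?_, ?_, ?_⟩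
  · intro w hw hwΩ hvw
    obtain ⟨-, ⟨h1, h2⟩, -⟩ := hball w hw
    have : w = γ (s (l1 w)) := hl_inj _ _ h1.symm (sub_eq_zero.1 hvw)
    exact hnotin _ h2 (this ▸ hwΩ)
  · intro w hw hwf
    obtain ⟨t, ht, rfl⟩ := (hball w hw).2.2.1 hwf
    exact hvγ t ht
  · intro δ hδ
    have hmeas : MeasurableSet (Metric.ball (γ t₀) r ∩ {w | |v w| < δ}) :=
      (hvon.continuousOn.abs.isOpen_inter_preimage Metric.isOpen_ball (isOpen_Iio (a := δ))).measurableSet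
    refine (ENNReal.toReal_le_of_le_ofReal (by positivity)
      (volume_graph_neighborhood_le α hmeas φ (c := l1 (γ t₀)) hδ ?_ ?_)).trans
      (mul_le_mul_of_nonneg_right (le_max_left _ _) hδ.le)
    · intro w hw
      have : (frame α w).1 - l1 (γ t₀) = (((α⁻¹ : Circle) : ℂ) * (w - γ t₀)).re := by
        rw [mul_sub, Complex.sub_re]; rfl
      rw [this]
      refine (Complex.abs_re_le_norm _).trans_lt ?_
      rw [norm_mul, Circle.norm_coe, one_mul, ← dist_eq_norm]
      exact hw.1
    · exact fun w hw => hw.2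
  · intro w hw hwΩ
    have := (hball w hw).2.2.2 hwΩ
    exact ⟨this.1.le.trans ((le_max_left _ _).trans (le_max_right _ _)),
      this.2.le.trans ((le_max_right _ _).trans (le_max_right _ _))⟩
  · intro q hq hqf
    obtain ⟨t, ht, rfl⟩ := (hball q hq).2.2.1 hqf
    have htI := (hδs (y := t) (by rwa [Real.dist_eq])).2
    obtain ⟨A, B, hA, hB, hAB⟩ := hlim t htI
    have hcx : Tendsto (dx v) (𝓝[Ω] γ t) (𝓝 (dx v (γ t))) :=
      ((continuousOn_dx Metric.isOpen_ball hvon).continuousAt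
        (Metric.isOpen_ball.mem_nhds hq)).tendsto.mono_left nhdsWithin_le_nhds
    have hcy : Tendsto (dy v) (𝓝[Ω] γ t) (𝓝 (dy v (γ t))) :=
      ((continuousOn_dy Metric.isOpen_ball hvon).continuousAt
        (Metric.isOpen_ball.mem_nhds hq)).tendsto.mono_left nhdsWithin_le_nhds
    have hzero : (deriv γ t).re * dx v (γ t) + (deriv γ t).im * dy v (γ t) = 0 := by
      rw [← fderiv_apply_eq]
      have h1 : HasDerivAt (fun τ => v (γ τ)) (fderiv ℝ v (γ t) (deriv γ t)) t :=
        ((hball _ hq).1.differentiableAt (by norm_num)).hasFDerivAt.comp_hasDerivAt t (hdγ t htI)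
      have h2 : (fun τ => v (γ τ)) =ᶠ[𝓝 t] fun _ => 0 := by
        have : ∀ᶠ τ in 𝓝 t, |τ - t₀| < δ₁ :=
          (continuous_abs.comp (continuous_id.sub continuous_const)).continuousAt.eventually
            (gt_mem_nhds ht)
        filter_upwards [this] with τ hτ using hvγ τ hτ
      rw [← h1.deriv, h2.deriv_eq, deriv_const]
    -- Both coordinates of the tangent, multiplied by this quantity, give zero, and the tangent is
    -- not zero.
    have hfin : A * dx v (γ t) + B * dy v (γ t) = 0 := by
      have e1 : (deriv γ t).re * (A * dx v (γ t) + B * dy v (γ t)) = 0 := by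
        linear_combination A * hzero + dy v (γ t) * hAB
      have e2 : (deriv γ t).im * (A * dx v (γ t) + B * dy v (γ t)) = 0 := by
        linear_combination B * hzero - dx v (γ t) * hAB
      by_contra hne
      refine hγ0 t htI (Complex.ext ?_ ?_)
      · simpa [hne] using e1
      · simpa [hne] using e2
    rw [← hfin]
    exact (hA.mul hcx).add (hB.mul hcy)

/-! ### The killing-reflecting problem in the logarithmic coordinate -/

/-- The Laplacian in the coordinate `w = x + i y`. -/
noncomputable def lap (f : ℂ → ℝ) (w : ℂ) : ℝ := dx (dx f) w + dy (dy f) w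

theorem lap_eq_zero_of_harmonicAt {Φ : ℂ → ℝ} {w : ℂ} (h : InnerProductSpace.HarmonicAt Φ w) :
    lap Φ w = 0 := by
  have h2 : Laplacian.laplacian Φ w = 0 := h.2.eq_of_nhds
  have hd : DifferentiableAt ℝ (fderiv ℝ Φ) w :=
    (h.1.fderiv_right (m := 1) (by norm_num)).differentiableAt (by norm_num)
  rw [InnerProductSpace.laplacian_eq_iteratedFDeriv_complexPlane] at h2
  simp only [iteratedFDeriv_two_apply, Matrix.cons_val_zero, Matrix.cons_val_one] at h2
  rw [← h2, lap]
  congr 1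
  · have := fderiv_clm_apply hd (differentiableAt_const (1 : ℂ))
    change fderiv ℝ (fun y => fderiv ℝ Φ y 1) w 1 = _
    rw [this]
    simp
  · have := fderiv_clm_apply hd (differentiableAt_const Complex.I)
    change fderiv ℝ (fun y => fderiv ℝ Φ y Complex.I) w Complex.I = _
    rw [this]
    simp

/-- The killing-reflecting problem with its data. -/
structure IsReflectingSolution (b : ℝ) (Ω : Set ℂ) (γ : ℝ → ℂ) (Φ : ℂ → ℝ) (c : ℝ) : Prop where
  wedge : IsWedgeRegion 0 (Real.pi * b) Ω γ
  harmonic : InnerProductSpace.HarmonicOnNhd Φ Ω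
  continuousOn : ContinuousOn Φ (closure Ω)
  zero_arc : ∀ t ∈ Icc (0 : ℝ) 1, Φ (γ t) = 0
  zero_top : ∀ w ∈ frontier Ω, w.im = Real.pi * b → Φ w = 0
  neumann : ∀ x : ℝ, x < (γ 0).re → HasBoundaryDeriv Φ Ω (x : ℂ) Complex.I 0
  origin : BehavesNearOrigin (1 / (2 * b)) Φ Ω
  homothetic : ∀ t ∈ Ioo (0 : ℝ) 1,
    HasBoundaryDeriv Φ Ω (γ t) (unitNormal γ t) (c * inner ℝ (coord (γ t)) (unitNormal γ t))

theorem SolvesKillingReflecting.exists_data {b : ℝ} {Ω : Set ℂ}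
    (h : SolvesKillingReflecting b Ω) : ∃ γ Φ c, IsReflectingSolution b Ω γ Φ c := by
  obtain ⟨γ, Φ, h1, h2, h3, h4, h5, h6, h7, c, h8⟩ := h
  exact ⟨γ, Φ, c, h1, h2, h3, h4, h5, h6, h7, h8⟩

theorem IsWedgeRegion.closure_subset {α β : ℝ} {Ω : Set ℂ} {γ : ℝ → ℂ}
    (h : IsWedgeRegion α β Ω γ) : ∃ X : ℝ, ∀ w ∈ closure Ω, w.re ≤ X ∧ α ≤ w.im ∧ w.im ≤ β := by
  obtain ⟨M, hM⟩ := h.bounded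
  refine ⟨Real.log (max M 1), fun w hw => ?_⟩
  have hcl : IsClosed {w : ℂ | w.re ≤ Real.log (max M 1) ∧ α ≤ w.im ∧ w.im ≤ β} := by
    refine (isClosed_le Complex.continuous_re continuous_const).inter
      ((isClosed_le continuous_const Complex.continuous_im).inter
        (isClosed_le Complex.continuous_im continuous_const))
  have hsub : Ω ⊆ {w : ℂ | w.re ≤ Real.log (max M 1) ∧ α ≤ w.im ∧ w.im ≤ β} := by
    refine fun z hz => ⟨?_, (h.inside z hz).1.le, (h.inside z hz).2.le⟩
    have := hM z hz
    rw [coord, Complex.norm_exp] at this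
    rw [Real.le_log_iff_exp_le (by positivity)]
    exact this.trans (le_max_left _ _)
  exact closure_minimal hsub hcl hw

theorem IsWedgeRegion.isCompact_closure_inter {α β : ℝ} {Ω : Set ℂ} {γ : ℝ → ℂ}
    (h : IsWedgeRegion α β Ω γ) {S : Set ℂ} (hS : IsClosed S) {R : ℝ} (hR : ∀ w ∈ S, -R ≤ w.re) :
    IsCompact (closure Ω ∩ S) := by
  obtain ⟨X, hX⟩ := h.closure_subset
  have hc : IsCompact (Icc (-R) X ×ℂ Icc α β) := isCompact_Icc.reProdIm isCompact_Icc
  refine hc.of_isClosed_subset (isClosed_closure.inter hS) fun w hw => ?_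
  have := hX w hw.1
  exact ⟨⟨hR w hw.2, this.1⟩, this.2⟩

/-- The part of the arc with parameter at distance at least `δ` from `t₀` is compact and, by
injectivity, misses `γ t₀`; the two sides lie at other heights. -/
theorem eventually_exists_of_mem_frontier {α β : ℝ} {Ω : Set ℂ} {γ : ℝ → ℂ}
    (h : IsWedgeRegion α β Ω γ) {t₀ : ℝ} (ht₀ : t₀ ∈ Ioo (0 : ℝ) 1) {δ : ℝ} (hδ : 0 < δ) :
    ∀ᶠ w in 𝓝 (γ t₀), w ∈ frontier Ω → ∃ t ∈ Icc (0 : ℝ) 1, |t - t₀| < δ ∧ γ t = w := by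
  have hC : IsCompact (γ '' (Icc 0 1 ∩ {t | δ ≤ |t - t₀|})) := by
    refine IsCompact.image_of_continuousOn ?_ (h.arc.continuousOn.mono inter_subset_left)
    exact isCompact_Icc.inter_right
      (isClosed_le continuous_const (continuous_abs.comp (continuous_id.sub continuous_const)))
  have hnot : γ t₀ ∉ γ '' (Icc 0 1 ∩ {t | δ ≤ |t - t₀|}) := by
    rintro ⟨t, ⟨ht, htδ⟩, he⟩
    have := h.arc.injOn ht (Ioo_subset_Icc_self ht₀) he
    rw [this] at htδ
    simp only [mem_ofPred_eq, sub_self, abs_zero] at htδ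
    linarith
  have hi := h.arc.inside t₀ ht₀
  filter_upwards [hC.isClosed.isOpen_compl.mem_nhds hnot,
    Complex.continuous_im.continuousAt.eventually (lt_mem_nhds hi.1),
    Complex.continuous_im.continuousAt.eventually (gt_mem_nhds hi.2)] with w hw h1 h2 hf
  rw [h.frontier_eq] at hf
  rcases hf with (⟨t, ht, rfl⟩ | hf) | hf
  · refine ⟨t, ht, ?_, rfl⟩
    by_contra h'
    exact hw ⟨t, ⟨ht, not_lt.1 h'⟩, rfl⟩
  · exact absurd hf.1 h1.ne'
  · exact absurd hf.1 h2.ne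

/-- Conformality of `exp`: the normal divided by `exp (γ t)` is a positive multiple of `-i γ'`, and
the inner product of `z` with the normal is the same multiple of `|exp (γ t)|² Im γ'`. The resulting
condition is linear in `γ'`, free of normalizations. -/
theorem boundaryDeriv_apply_normal_iff {γ : ℝ → ℂ} {t c : ℝ} (hγ : DifferentiableAt ℝ γ t)
    (hγ0 : deriv γ t ≠ 0) (L : ℂ →L[ℝ] ℝ) :
    L (unitNormal γ t / coord (γ t)) = c * inner ℝ (coord (γ t)) (unitNormal γ t) ↔
      L (Complex.I * deriv γ t) = -(c * Real.exp (2 * (γ t).re) * (deriv γ t).im) := by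
  have hd : deriv (fun τ => coord (γ τ)) t = Complex.exp (γ t) * deriv γ t :=
    ((Complex.hasDerivAt_exp (γ t)).comp_of_eq t hγ.hasDerivAt rfl).deriv
  set e := Complex.exp (γ t) with he
  have he0 : e ≠ 0 := Complex.exp_ne_zero _
  set N : ℝ := ‖e * deriv γ t‖ with hN
  have hN0 : N ≠ 0 := norm_ne_zero_iff.2 (mul_ne_zero he0 hγ0)
  have hN0' : (N : ℂ) ≠ 0 := by exact_mod_cast hN0
  have hu : unitNormal γ t = -Complex.I * (e * deriv γ t / (N : ℂ)) := by
    rw [unitNormal, hd]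
  have h1 : unitNormal γ t / coord (γ t) = (-(1 / N) : ℝ) • (Complex.I * deriv γ t) := by
    rw [hu, coord, ← he, Complex.real_smul]
    push_cast
    field_simp
  have hnorm : Complex.normSq e = Real.exp (2 * (γ t).re) := by
    rw [Complex.normSq_eq_norm_sq, he, Complex.norm_exp, ← Real.exp_nat_mul]; norm_num
  have h2 : inner ℝ (coord (γ t)) (unitNormal γ t) =
      (1 / N) * (Real.exp (2 * (γ t).re) * (deriv γ t).im) := by
    rw [hu, coord, ← he, Complex.inner]
    have : (starRingEnd ℂ) e * (-Complex.I * (e * deriv γ t / (N : ℂ))) =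
        ((1 / N * Complex.normSq e : ℝ) : ℂ) * (-Complex.I * deriv γ t) := by
      push_cast
      rw [Complex.normSq_eq_conj_mul_self]
      ring
    first
      | rw [this]
      | rw [mul_comm, this]
    rw [Complex.re_ofReal_mul, hnorm]
    simp
    try ring
  rw [h1, h2, map_smul, smul_eq_mul]
  constructor
  · intro hL
    field_simp at hL
    linarith
  · intro hL
    rw [hL]
    ring

/-! ### The weak form away from the corner and the killing side -/

/-- The area density `|exp w|²`. -/
noncomputable def density (w : ℂ) : ℝ := Real.exp (2 * w.re)

theorem contDiff_density {n : WithTop ℕ∞} : ContDiff ℝ n density :=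
  Real.contDiff_exp.comp (contDiff_const.mul Complex.reCLM.contDiff)

theorem hasFDerivAt_comp_re {f : ℝ → ℝ} {f' : ℝ} {w : ℂ} (h : HasDerivAt f f' w.re) :
    HasFDerivAt (fun z : ℂ => f z.re) (f' • Complex.reCLM) w :=
  h.comp_hasFDerivAt w Complex.reCLM.hasFDerivAt

theorem dx_comp_re {f : ℝ → ℝ} {f' : ℝ} {w : ℂ} (h : HasDerivAt f f' w.re) :
    dx (fun z : ℂ => f z.re) w = f' := by simp [dx, (hasFDerivAt_comp_re h).fderiv]

theorem dy_comp_re {f : ℝ → ℝ} {f' : ℝ} {w : ℂ} (h : HasDerivAt f f' w.re) :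
    dy (fun z : ℂ => f z.re) w = 0 := by simp [dy, (hasFDerivAt_comp_re h).fderiv]

theorem hasFDerivAt_comp_im {f : ℝ → ℝ} {f' : ℝ} {w : ℂ} (h : HasDerivAt f f' w.im) :
    HasFDerivAt (fun z : ℂ => f z.im) (f' • Complex.imCLM) w :=
  h.comp_hasFDerivAt w Complex.imCLM.hasFDerivAt

theorem dx_comp_im {f : ℝ → ℝ} {f' : ℝ} {w : ℂ} (h : HasDerivAt f f' w.im) :
    dx (fun z : ℂ => f z.im) w = 0 := by simp [dx, (hasFDerivAt_comp_im h).fderiv]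

theorem dy_comp_im {f : ℝ → ℝ} {f' : ℝ} {w : ℂ} (h : HasDerivAt f f' w.im) :
    dy (fun z : ℂ => f z.im) w = f' := by simp [dy, (hasFDerivAt_comp_im h).fderiv]

theorem dx_density (w : ℂ) : dx density w = 2 * density w := by
  have : HasDerivAt (fun x : ℝ => Real.exp (2 * x)) (Real.exp (2 * w.re) * (2 * 1)) w.re :=
    ((hasDerivAt_id w.re).const_mul 2).exp
  rw [show density = fun z : ℂ => (fun x : ℝ => Real.exp (2 * x)) z.re from rfl, dx_comp_re this]
  ring

/-- The density in the weak form of the free boundary problem, tested with `ψ`. -/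
noncomputable def testDensity (Φ : ℂ → ℝ) (c : ℝ) (ψ : ℂ → ℝ) (w : ℂ) : ℝ :=
  Φ w * lap ψ w + c * (density w * (2 * ψ w + dx ψ w))

theorem continuous_dx {ψ : ℂ → ℝ} (hψ : ContDiff ℝ 1 ψ) : Continuous (dx ψ) :=
  continuousOn_univ.1 (continuousOn_dx isOpen_univ hψ.contDiffOn)

theorem continuous_dy {ψ : ℂ → ℝ} (hψ : ContDiff ℝ 1 ψ) : Continuous (dy ψ) :=
  continuousOn_univ.1 (continuousOn_dy isOpen_univ hψ.contDiffOn)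

theorem contDiff_dx {ψ : ℂ → ℝ} (hψ : ContDiff ℝ 2 ψ) : ContDiff ℝ 1 (dx ψ) :=
  contDiffOn_univ.1 (contDiffOn_dx isOpen_univ hψ.contDiffOn (by norm_num))

theorem contDiff_dy {ψ : ℂ → ℝ} (hψ : ContDiff ℝ 2 ψ) : ContDiff ℝ 1 (dy ψ) :=
  contDiffOn_univ.1 (contDiffOn_dy isOpen_univ hψ.contDiffOn (by norm_num))

theorem continuous_lap {ψ : ℂ → ℝ} (hψ : ContDiff ℝ 2 ψ) : Continuous (lap ψ) :=
  (continuous_dx (contDiff_dx hψ)).add (continuous_dy (contDiff_dy hψ))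

theorem continuousOn_testDensity {Φ : ℂ → ℝ} {c : ℝ} {ψ : ℂ → ℝ} {S : Set ℂ}
    (hΦ : ContinuousOn Φ S) (hψ : ContDiff ℝ 2 ψ) : ContinuousOn (testDensity Φ c ψ) S := by
  have := continuous_lap hψ
  have := continuous_dx (hψ.of_le (by norm_num))
  have := hψ.continuous
  have : Continuous density := (contDiff_density (n := 0)).continuous
  unfold testDensity
  fun_prop

theorem eventuallyEq_zero_of_notMem_tsupport {ψ : ℂ → ℝ} {w : ℂ} (hw : w ∉ tsupport ψ) :
    ψ =ᶠ[𝓝 w] fun _ => 0 := notMem_tsupport_iff_eventuallyEq.1 hw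

theorem dx_eventuallyEq_zero {ψ : ℂ → ℝ} {w : ℂ} (h : ψ =ᶠ[𝓝 w] fun _ => 0) :
    dx ψ =ᶠ[𝓝 w] fun _ => 0 := by
  filter_upwards [eventually_eventually_nhds.2 h] with z hz
  simp [dx, EventuallyEq.fderiv_eq (𝕜 := ℝ) hz]

theorem dy_eventuallyEq_zero {ψ : ℂ → ℝ} {w : ℂ} (h : ψ =ᶠ[𝓝 w] fun _ => 0) :
    dy ψ =ᶠ[𝓝 w] fun _ => 0 := by
  filter_upwards [eventually_eventually_nhds.2 h] with z hz
  simp [dy, EventuallyEq.fderiv_eq (𝕜 := ℝ) hz]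

theorem testDensity_eq_zero {Φ : ℂ → ℝ} {c : ℝ} {ψ : ℂ → ℝ} {w : ℂ} (hw : w ∉ tsupport ψ) :
    testDensity Φ c ψ w = 0 := by
  have h := eventuallyEq_zero_of_notMem_tsupport hw
  have h1 := dx_eventuallyEq_zero h
  have h2 := dy_eventuallyEq_zero h
  simp [testDensity, lap, h.eq_of_nhds, h1.eq_of_nhds, (dx_eventuallyEq_zero h1).eq_of_nhds,
    (dy_eventuallyEq_zero h2).eq_of_nhds]

namespace IsReflectingSolution

variable {b : ℝ} {Ω : Set ℂ} {γ : ℝ → ℂ} {Φ : ℂ → ℝ} {c : ℝ}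

theorem arc_mem_frontier (h : IsReflectingSolution b Ω γ Φ c) {t : ℝ} (ht : t ∈ Icc (0 : ℝ) 1) :
    γ t ∈ frontier Ω := by
  rw [h.wedge.frontier_eq]
  exact Or.inl (Or.inl ⟨t, ht, rfl⟩)

/-- Since `Φ` vanishes on the arc, the field tends to `ψ` times `(c e^{2x} - Φ_x, -Φ_y)`, with the
boundary limits of the derivatives of `Φ`. By `boundaryDeriv_apply_normal_iff` the homothety
condition says exactly that this vector is tangent to the arc. -/
theorem zeroFluxAt_arc (h : IsReflectingSolution b Ω γ Φ c) {ψ : ℂ → ℝ} (hψ : ContDiff ℝ 2 ψ)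
    {t₀ : ℝ} (ht₀ : t₀ ∈ Ioo (0 : ℝ) 1) :
    ZeroFluxAt Ω (fun w => Φ w * dx ψ w - ψ w * dx Φ w + c * (density w * ψ w))
      (fun w => Φ w * dy ψ w - ψ w * dy Φ w) (γ t₀) := by
  refine zeroFluxAt_of_curve h.wedge.isOpen h.wedge.arc.contDiffOn h.wedge.arc.deriv_ne_zero ht₀
    (fun t ht => h.arc_mem_frontier (Ioo_subset_Icc_self ht)) (fun δ hδ => ?_) fun t ht => ?_
  · filter_upwards [eventually_exists_of_mem_frontier h.wedge ht₀ hδ] with w hw hf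
    obtain ⟨t, -, h1, h2⟩ := hw hf
    exact ⟨t, h1, h2⟩
  · obtain ⟨L, hL, hLn⟩ := h.homothetic t ht
    have hdiff : DifferentiableAt ℝ γ t :=
      (h.wedge.arc.contDiffOn.contDiffAt (Ioo_mem_nhds ht.1 ht.2)).differentiableAt (by norm_num)
    have hn := (boundaryDeriv_apply_normal_iff hdiff (h.wedge.arc.deriv_ne_zero t ht) L).1 hLn
    have hmem := h.arc_mem_frontier (Ioo_subset_Icc_self ht)
    have hΦ : Tendsto Φ (𝓝[Ω] γ t) (𝓝 0) := by
      have := (h.continuousOn (γ t) (frontier_subset_closure hmem)).tendsto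
      rw [h.zero_arc t (Ioo_subset_Icc_self ht)] at this
      exact this.mono_left (nhdsWithin_mono _ subset_closure)
    have hc : ∀ {f : ℂ → ℝ}, Continuous f → Tendsto f (𝓝[Ω] γ t) (𝓝 (f (γ t))) := fun hf =>
      hf.continuousAt.tendsto.mono_left nhdsWithin_le_nhds
    have hx : Tendsto (dx Φ) (𝓝[Ω] γ t) (𝓝 (L 1)) := tendsto_clm_apply hL _
    have hy : Tendsto (dy Φ) (𝓝[Ω] γ t) (𝓝 (L Complex.I)) := tendsto_clm_apply hL _
    have hψx := hc (continuous_dx (hψ.of_le (by norm_num)))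
    have hψy := hc (continuous_dy (hψ.of_le (by norm_num)))
    have hψ0 := hc hψ.continuous
    have hd := hc ((contDiff_density (n := 0)).continuous)
    refine ⟨_, _, ((hΦ.mul hψx).sub (hψ0.mul hx)).add ((hd.mul hψ0).const_mul c),
      (hΦ.mul hψy).sub (hψ0.mul hy), ?_⟩
    have e : L (Complex.I * deriv γ t) = -(deriv γ t).im * L 1 + (deriv γ t).re * L Complex.I := by
      have : Complex.I * deriv γ t =
          (-(deriv γ t).im) • (1 : ℂ) + (deriv γ t).re • Complex.I := by
        apply Complex.ext <;> simp
      rw [this, map_add, map_smul, map_smul, smul_eq_mul, smul_eq_mul]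
    rw [e] at hn
    rw [density]
    linear_combination (-ψ (γ t)) * hn

/-- The point `x₀` lies off the compact arc and strictly below the killing side. -/
theorem eventually_of_mem_axis (h : IsReflectingSolution b Ω γ Φ c) (hb : 0 < b) {x₀ : ℝ}
    (hx₀ : x₀ < (γ 0).re) : ∀ᶠ w in 𝓝 (x₀ : ℂ), w ∈ frontier Ω → w.im = 0 ∧ w.re ≤ (γ 0).re := by
  have hC : IsCompact (γ '' Icc 0 1) := isCompact_Icc.image_of_continuousOn h.wedge.arc.continuousOn
  have hnot : (x₀ : ℂ) ∉ γ '' Icc 0 1 := by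
    rintro ⟨t, ht, he⟩
    rcases ht.1.eq_or_lt with rfl | h0
    · rw [he] at hx₀; simp at hx₀
    · rcases ht.2.eq_or_lt with rfl | h1
      · have := h.wedge.arc.end_mem
        rw [he] at this
        simp only [Complex.ofReal_im] at this
        have := Real.pi_pos
        nlinarith
      · have := (h.wedge.arc.inside t ⟨h0, h1⟩).1
        rw [he] at this
        simp at this
  have hpos : (x₀ : ℂ).im < Real.pi * b := by
    have := Real.pi_pos
    simp only [Complex.ofReal_im]; positivity
  filter_upwards [hC.isClosed.isOpen_compl.mem_nhds hnot,
    Complex.continuous_im.continuousAt.eventually (gt_mem_nhds hpos)] with w hw h2 hf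
  rw [h.wedge.frontier_eq] at hf
  rcases hf with (hf | hf) | hf
  · exact absurd hf hw
  · exact hf
  · exact absurd hf.1 h2.ne

/-- Only the second component crosses the horizontal axis, and both of its terms tend to zero, by
`hneu` and by the reflecting condition. -/
theorem zeroFluxAt_axis (h : IsReflectingSolution b Ω γ Φ c) (hb : 0 < b) {ψ : ℂ → ℝ}
    (hψ : ContDiff ℝ 2 ψ) (hneu : ∀ x : ℝ, dy ψ x = 0) {x₀ : ℝ} (hx₀ : x₀ < (γ 0).re) :
    ZeroFluxAt Ω (fun w => Φ w * dx ψ w - ψ w * dx Φ w + c * (density w * ψ w))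
      (fun w => Φ w * dy ψ w - ψ w * dy Φ w) x₀ := by
  have hder : ∀ t : ℝ, HasDerivAt (fun t : ℝ => (t : ℂ)) 1 t := fun t => Complex.ofRealCLM.hasDerivAt
  have hfr : ∀ t : ℝ, t ≤ (γ 0).re → (t : ℂ) ∈ frontier Ω := fun t ht => by
    rw [h.wedge.frontier_eq]
    exact Or.inl (Or.inr ⟨by simp, by simpa using ht⟩)
  refine zeroFluxAt_of_curve (γ := fun t : ℝ => (t : ℂ)) (a := x₀ - 1) (b := (γ 0).re) h.wedge.isOpen
    Complex.ofRealCLM.contDiff.contDiffOn (fun t _ => by simp [(hder t).deriv])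
    ⟨by linarith, hx₀⟩ (fun t ht => hfr t ht.2.le) (fun δ hδ => ?_) fun t ht => ?_
  · have hre : ∀ᶠ w : ℂ in 𝓝 (x₀ : ℂ), |w.re - x₀| < δ := by
      have : ContinuousAt (fun w : ℂ => |w.re - x₀|) (x₀ : ℂ) := by fun_prop
      exact this.eventually (gt_mem_nhds (by simpa using hδ))
    filter_upwards [h.eventually_of_mem_axis hb hx₀, hre] with w hw h1 hf
    exact ⟨w.re, h1, Complex.ext (by simp) (by simp [(hw hf).1])⟩
  · obtain ⟨L, hL, hLn⟩ := h.neumann t ht.2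
    have hLI : L Complex.I = 0 := by
      have : Complex.I / coord t = (Real.exp (-t)) • Complex.I := by
        rw [coord, Complex.real_smul, Complex.ofReal_exp, Complex.ofReal_neg, Complex.exp_neg]
        ring
      rw [this, map_smul, smul_eq_mul] at hLn
      exact (mul_eq_zero.1 hLn).resolve_left (Real.exp_pos _).ne'
    have hmem := hfr t ht.2.le
    have hΦ : Tendsto Φ (𝓝[Ω] t) (𝓝 (Φ t)) :=
      (h.continuousOn _ (frontier_subset_closure hmem)).tendsto.mono_left
        (nhdsWithin_mono _ subset_closure)
    have hc : ∀ {f : ℂ → ℝ}, Continuous f → Tendsto f (𝓝[Ω] (t : ℂ)) (𝓝 (f t)) := fun hf =>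
      hf.continuousAt.tendsto.mono_left nhdsWithin_le_nhds
    have hx : Tendsto (dx Φ) (𝓝[Ω] t) (𝓝 (L 1)) := tendsto_clm_apply hL _
    have hy : Tendsto (dy Φ) (𝓝[Ω] t) (𝓝 (L Complex.I)) := tendsto_clm_apply hL _
    have hψx := hc (continuous_dx (hψ.of_le (by norm_num)))
    have hψy := hc (continuous_dy (hψ.of_le (by norm_num)))
    have hψ0 := hc hψ.continuous
    have hd := hc ((contDiff_density (n := 0)).continuous)
    refine ⟨_, _, ((hΦ.mul hψx).sub (hψ0.mul hx)).add ((hd.mul hψ0).const_mul c),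
      (hΦ.mul hψy).sub (hψ0.mul hy), ?_⟩
    simp [(hder t).deriv, hneu t, hLI]

/-- The weak form of the problem, for test functions supported away from the corner and from the
killing side, with vanishing normal derivative on the reflecting side. -/
theorem integral_testDensity_of_tsupport (h : IsReflectingSolution b Ω γ Φ c) (hb : 0 < b)
    {ψ : ℂ → ℝ} (hψ : ContDiff ℝ 2 ψ) {R : ℝ} (hR : ∀ w ∈ tsupport ψ, -R ≤ w.re)
    (hcorner : γ 0 ∉ tsupport ψ) (htop : ∀ w ∈ tsupport ψ, w.im ≠ Real.pi * b)
    (hneu : ∀ x : ℝ, dy ψ x = 0) : ∫ w in Ω, testDensity Φ c ψ w = 0 := by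
  have hΩ := h.wedge.isOpen
  have hΦ2 : ContDiffOn ℝ 2 Φ Ω := h.harmonic.contDiffOn
  have hΦ1 : ContDiffOn ℝ 1 Φ Ω := hΦ2.of_le (by norm_num)
  have hxx := contDiffOn_dx (m := 1) hΩ hΦ2 (by norm_num)
  have hyy := contDiffOn_dy (m := 1) hΩ hΦ2 (by norm_num)
  have hψ1 : ContDiff ℝ 1 ψ := hψ.of_le (by norm_num)
  have hF : ContDiffOn ℝ 1 (fun w => Φ w * dx ψ w - ψ w * dx Φ w + c * (density w * ψ w)) Ω :=
    ((hΦ1.mul (contDiff_dx hψ).contDiffOn).sub (hψ1.contDiffOn.mul hxx)).add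
      (contDiffOn_const.mul (contDiff_density.contDiffOn.mul hψ1.contDiffOn))
  have hG : ContDiffOn ℝ 1 (fun w => Φ w * dy ψ w - ψ w * dy Φ w) Ω :=
    (hΦ1.mul (contDiff_dy hψ).contDiffOn).sub (hψ1.contDiffOn.mul hyy)
  have hK := h.wedge.isCompact_closure_inter (isClosed_tsupport ψ) hR
  have hdiv : ∀ w ∈ Ω, dx (fun w => Φ w * dx ψ w - ψ w * dx Φ w + c * (density w * ψ w)) w +
      dy (fun w => Φ w * dy ψ w - ψ w * dy Φ w) w = testDensity Φ c ψ w := by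
    intro w hw
    have d1 := (hΦ1.contDiffAt (hΩ.mem_nhds hw)).differentiableAt (by norm_num)
    have d2 := (hxx.contDiffAt (hΩ.mem_nhds hw)).differentiableAt (by norm_num)
    have d3 := (hyy.contDiffAt (hΩ.mem_nhds hw)).differentiableAt (by norm_num)
    have d4 := hψ1.differentiable (by norm_num) w
    have d5 := (contDiff_dx hψ).differentiable (by norm_num) w
    have d6 := (contDiff_dy hψ).differentiable (by norm_num) w
    have d7 := (contDiff_density (n := 1)).differentiable (by norm_num) w
    have e1 : dx (fun w => Φ w * dx ψ w - ψ w * dx Φ w + c * (density w * ψ w)) w =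
        dx (fun w => Φ w * dx ψ w) w - dx (fun w => ψ w * dx Φ w) w +
          c * dx (fun w => density w * ψ w) w := by
      have d8 : DifferentiableAt ℝ (fun w => Φ w * dx ψ w) w := d1.mul d5
      have d9 : DifferentiableAt ℝ (fun w => ψ w * dx Φ w) w := d4.mul d2
      have d10 : DifferentiableAt ℝ (fun w => density w * ψ w) w := d7.mul d4
      rw [dx_add (d8.fun_sub d9) (d10.const_mul c), dx_sub d8 d9, dx_const_mul d10]
    have e2 : dy (fun w => Φ w * dy ψ w - ψ w * dy Φ w) w =
        dy (fun w => Φ w * dy ψ w) w - dy (fun w => ψ w * dy Φ w) w := by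
      have d8 : DifferentiableAt ℝ (fun w => Φ w * dy ψ w) w := d1.mul d6
      have d9 : DifferentiableAt ℝ (fun w => ψ w * dy Φ w) w := d4.mul d3
      exact dy_sub d8 d9
    -- The mixed products of first derivatives cancel, and harmonicity removes `ψ ΔΦ`.
    have hlap := lap_eq_zero_of_harmonicAt (h.harmonic w hw)
    rw [e1, e2, dx_mul d1 d5, dx_mul d4 d2, dx_mul d7 d4, dy_mul d1 d6, dy_mul d4 d3, dx_density,
      testDensity, lap]
    rw [lap] at hlap
    linear_combination (-ψ w) * hlap
  -- The divergence contains no derivative of `Φ` any more, so continuity of `Φ` up to the boundary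
  -- is enough to bound it.
  obtain ⟨D, hD⟩ := hK.exists_bound_of_continuousOn
    (continuousOn_testDensity (c := c) (h.continuousOn.mono inter_subset_left) hψ)
  have hD' : ∀ w ∈ Ω, |dx (fun w => Φ w * dx ψ w - ψ w * dx Φ w + c * (density w * ψ w)) w +
      dy (fun w => Φ w * dy ψ w - ψ w * dy Φ w) w| ≤ |D| := by
    intro w hw
    rw [hdiv w hw]
    by_cases hws : w ∈ tsupport ψ
    · exact (hD w ⟨subset_closure hw, hws⟩).trans (le_abs_self D)
    · rw [testDensity_eq_zero hws]; simp
  have hns : ∀ w ∈ Ω, w ∉ closure Ω ∩ tsupport ψ → w ∉ tsupport ψ := fun w hw hwK hws =>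
    hwK ⟨subset_closure hw, hws⟩
  rw [← (setIntegral_div_eq_zero hΩ hK hF hG ?_ ?_ hD' ?_).2]
  · exact setIntegral_congr_fun hΩ.measurableSet fun w hw => (hdiv w hw).symm
  · intro w hw hwK
    obtain ⟨h1, h2, h3⟩ := fderiv_eq_zero_of_notMem_tsupport (hns w hw hwK)
    simp [h1, h2]
  · intro w hw hwK
    obtain ⟨h1, h2, h3⟩ := fderiv_eq_zero_of_notMem_tsupport (hns w hw hwK)
    simp [h1, h3]
  · intro p hp
    by_cases hpf : p ∈ frontier Ω
    · have hpf' := hpf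
      rw [h.wedge.frontier_eq] at hpf'
      rcases hpf' with (⟨t, ht, rfl⟩ | ⟨h1, h2⟩) | ⟨h1, h2⟩
      · rcases ht.1.eq_or_lt with rfl | h0
        · exact absurd hp.2 hcorner
        · rcases ht.2.eq_or_lt with rfl | h1
          -- The other endpoint of the arc lies on the killing side, which the support of `ψ`
          -- avoids.
          · exact absurd h.wedge.arc.end_mem (htop _ hp.2)
          · exact h.zeroFluxAt_arc hψ ⟨h0, h1⟩
      · have hpe : p = (p.re : ℂ) := Complex.ext (by simp) (by simp [h1])
        have hlt : p.re < (γ 0).re := by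
          refine lt_of_le_of_ne h2 fun he => hcorner ?_
          have : γ 0 = p := Complex.ext he.symm (by rw [h.wedge.arc.start_mem, h1])
          rw [this]; exact hp.2
        rw [hpe]
        exact h.zeroFluxAt_axis hb hψ hneu hlt
      · exact absurd h1 (htop p hp.2)
    · exact zeroFluxAt_of_mem hΩ hF hG hpf

end IsReflectingSolution

/-! ### Multiplying test functions by cutoffs -/

/-- The open rectangle with centre `(x, y)` and half-sides `ρ` and `δ`. -/
def box (x y ρ δ : ℝ) : Set ℂ := {w | |w.re - x| < ρ ∧ |w.im - y| < δ}

theorem measurableSet_box (x y ρ δ : ℝ) : MeasurableSet (box x y ρ δ) := by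
  have h1 : IsOpen {w : ℂ | |w.re - x| < ρ} := isOpen_lt (by fun_prop) continuous_const
  have h2 : IsOpen {w : ℂ | |w.im - y| < δ} := isOpen_lt (by fun_prop) continuous_const
  exact (h1.inter h2).measurableSet

theorem volume_box_le (x y : ℝ) {ρ δ : ℝ} (hδ : 0 < δ) :
    volume (box x y ρ δ) ≤ ENNReal.ofReal (4 * ρ * δ) := by
  refine volume_graph_neighborhood_le 1 (measurableSet_box x y ρ δ) (fun _ => y) (c := x) hδ ?_ ?_
  · intro w hw
    simpa [frame_apply] using hw.1
  · intro w hw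
    simpa [frame_apply] using hw.2

theorem dx_mul_eq {ψ k : ℂ → ℝ} (hψ : Differentiable ℝ ψ) (hk : Differentiable ℝ k) :
    dx (fun z => ψ z * k z) = fun z => dx ψ z * k z + ψ z * dx k z :=
  funext fun w => dx_mul (hψ w) (hk w)

theorem dy_mul_eq {ψ k : ℂ → ℝ} (hψ : Differentiable ℝ ψ) (hk : Differentiable ℝ k) :
    dy (fun z => ψ z * k z) = fun z => dy ψ z * k z + ψ z * dy k z :=
  funext fun w => dy_mul (hψ w) (hk w)

theorem lap_mul {ψ k : ℂ → ℝ} (hψ : ContDiff ℝ 2 ψ) (hk : ContDiff ℝ 2 k) (w : ℂ) :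
    lap (fun z => ψ z * k z) w =
      lap ψ w * k w + 2 * (dx ψ w * dx k w + dy ψ w * dy k w) + ψ w * lap k w := by
  have h1 := hψ.differentiable (by norm_num)
  have h2 := hk.differentiable (by norm_num)
  have h3 := (contDiff_dx hψ).differentiable (by norm_num)
  have h4 := (contDiff_dx hk).differentiable (by norm_num)
  have h5 := (contDiff_dy hψ).differentiable (by norm_num)
  have h6 := (contDiff_dy hk).differentiable (by norm_num)
  rw [lap, dx_mul_eq h1 h2, dy_mul_eq h1 h2, dx_add ((h3 w).fun_mul (h2 w)) ((h1 w).fun_mul (h4 w)),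
    dy_add ((h5 w).fun_mul (h2 w)) ((h1 w).fun_mul (h6 w)), dx_mul (h3 w) (h2 w),
    dx_mul (h1 w) (h4 w), dy_mul (h5 w) (h2 w), dy_mul (h1 w) (h6 w), lap, lap]
  ring

/-- The terms of `testDensity Φ c (ψ k)` that contain derivatives of the cutoff function `k`. -/
noncomputable def cutoffError (Φ : ℂ → ℝ) (c : ℝ) (ψ k : ℂ → ℝ) (w : ℂ) : ℝ :=
  Φ w * (2 * (dx ψ w * dx k w + dy ψ w * dy k w) + ψ w * lap k w) +
    c * (density w * (ψ w * dx k w))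

theorem testDensity_mul {Φ ψ k : ℂ → ℝ} (hψ : ContDiff ℝ 2 ψ) (hk : ContDiff ℝ 2 k) (c : ℝ) (w : ℂ) :
    testDensity Φ c (fun z => ψ z * k z) w = k w * testDensity Φ c ψ w + cutoffError Φ c ψ k w := by
  rw [testDensity, lap_mul hψ hk,
    dx_mul (hψ.differentiable (by norm_num) w) (hk.differentiable (by norm_num) w), testDensity,
    cutoffError]
  ring

theorem cutoffError_eq_zero {Φ ψ k : ℂ → ℝ} {c : ℝ} {w : ℂ} (hw : w ∉ tsupport ψ) :
    cutoffError Φ c ψ k w = 0 := by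
  obtain ⟨h1, h2, h3⟩ := fderiv_eq_zero_of_notMem_tsupport hw
  simp [cutoffError, h1, h2, h3]

theorem IsWedgeRegion.integrableOn_testDensity {α β : ℝ} {Ω : Set ℂ} {γ : ℝ → ℂ} {Φ : ℂ → ℝ}
    (h : IsWedgeRegion α β Ω γ) (hΦ : ContinuousOn Φ (closure Ω)) (c : ℝ)
    {ψ : ℂ → ℝ} (hψ : ContDiff ℝ 2 ψ) {R : ℝ} (hR : ∀ w ∈ tsupport ψ, -R ≤ w.re) :
    IntegrableOn (testDensity Φ c ψ) Ω := by
  have hK := h.isCompact_closure_inter (isClosed_tsupport ψ) hR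
  have h1 := (continuousOn_testDensity (c := c) (hΦ.mono inter_subset_left) hψ).integrableOn_compact
    (μ := volume) hK
  refine (h1.mono_set (inter_subset_inter_left _ subset_closure)).of_forall_sdiff_eq_zero
    h.isOpen.measurableSet fun w hw => ?_
  exact testDensity_eq_zero fun h' => hw.2 ⟨hw.1, h'⟩

/-- By `testDensity_mul`, the vanishing integral for `ψ k` is the integral of `k` times the density
for `ψ`, plus the cutoff error. The first part converges by domination, and the error is made
arbitrarily small by `herr`. -/
theorem IsWedgeRegion.integral_testDensity_eq_zero_of_cutoff {α β : ℝ} {Ω : Set ℂ} {γ : ℝ → ℂ}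
    {Φ : ℂ → ℝ} (h : IsWedgeRegion α β Ω γ) (hΦ : ContinuousOn Φ (closure Ω)) {c : ℝ}
    {ψ : ℂ → ℝ} (hψ : ContDiff ℝ 2 ψ) {R : ℝ} (hR : ∀ w ∈ tsupport ψ, -R ≤ w.re)
    {k : ℕ → ℂ → ℝ} (hk : ∀ n, ContDiff ℝ 2 (k n)) (hk1 : ∀ n w, |k n w| ≤ 1)
    (hklim : ∀ w ∈ Ω, ∀ᶠ n in atTop, k n w = 1)
    (hzero : ∀ᶠ n in atTop, ∫ w in Ω, testDensity Φ c (fun z => ψ z * k n z) w = 0)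
    {M : ℝ} (hM : 0 < M)
    (herr : ∀ η > 0, ∀ᶠ n in atTop, |∫ w in Ω, cutoffError Φ c ψ (k n) w| ≤ η * M) :
    ∫ w in Ω, testDensity Φ c ψ w = 0 := by
  have hint := h.integrableOn_testDensity hΦ c hψ hR
  have hmeas := h.isOpen.measurableSet
  have hlim1 : Tendsto (fun n => ∫ w in Ω, k n w * testDensity Φ c ψ w) atTop
      (𝓝 (∫ w in Ω, testDensity Φ c ψ w)) := by
    refine tendsto_integral_of_dominated_convergence (fun w => ‖testDensity Φ c ψ w‖)
      (fun n => ((hk n).continuous.aestronglyMeasurable).mul hint.aestronglyMeasurable) hint.norm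
      (fun n => Eventually.of_forall fun w => ?_) ?_
    · rw [norm_mul]
      exact mul_le_of_le_one_left (norm_nonneg _) (hk1 n w)
    · filter_upwards [ae_restrict_mem hmeas] with w hw
      refine tendsto_const_nhds.congr' ?_
      filter_upwards [hklim w hw] with n hn
      rw [hn, one_mul]
  have hlim2 : Tendsto (fun n => ∫ w in Ω, k n w * testDensity Φ c ψ w) atTop (𝓝 0) := by
    rw [Metric.tendsto_nhds]
    intro ε hε
    filter_upwards [hzero, herr (ε / (2 * M)) (by positivity)] with n h0 he
    have hsup : ∀ w ∈ tsupport (fun z => ψ z * k n z), -R ≤ w.re := fun w hw =>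
      hR w (tsupport_mul_subset_left hw)
    have hi1 := h.integrableOn_testDensity hΦ c (hψ.mul (hk n)) hsup
    have hi2 : IntegrableOn (fun w => k n w * testDensity Φ c ψ w) Ω := by
      refine Integrable.mono hint
        (((hk n).continuous.aestronglyMeasurable).mul hint.aestronglyMeasurable) ?_
      refine Eventually.of_forall fun w => ?_
      rw [norm_mul]
      exact mul_le_of_le_one_left (norm_nonneg _) (hk1 n w)
    have e : ∫ w in Ω, cutoffError Φ c ψ (k n) w =
        -∫ w in Ω, k n w * testDensity Φ c ψ w := by
      have : cutoffError Φ c ψ (k n) =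
          fun w => testDensity Φ c (fun z => ψ z * k n z) w - k n w * testDensity Φ c ψ w := by
        ext w; rw [testDensity_mul hψ (hk n)]; ring
      rw [this, integral_sub hi1 hi2, h0, zero_sub]
    rw [e, abs_neg] at he
    rw [Real.dist_eq, sub_zero]
    refine he.trans_lt ?_
    field_simp
    linarith
  exact tendsto_nhds_unique hlim1 hlim2

theorem exists_common_bound {K : Set ℂ} (hK : IsCompact K) {f g h k : ℂ → ℝ}
    (hf : ContinuousOn f K) (hg : ContinuousOn g K) (hh : ContinuousOn h K)
    (hk : ContinuousOn k K) :
    ∃ C > 0, ∀ w ∈ K, |f w| ≤ C ∧ |g w| ≤ C ∧ |h w| ≤ C ∧ |k w| ≤ C := by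
  obtain ⟨C1, h1⟩ := hK.exists_bound_of_continuousOn hf
  obtain ⟨C2, h2⟩ := hK.exists_bound_of_continuousOn hg
  obtain ⟨C3, h3⟩ := hK.exists_bound_of_continuousOn hh
  obtain ⟨C4, h4⟩ := hK.exists_bound_of_continuousOn hk
  refine ⟨|C1| + |C2| + |C3| + |C4| + 1, by positivity, fun w hw => ⟨?_, ?_, ?_, ?_⟩⟩
  · have := h1 w hw; rw [Real.norm_eq_abs] at this
    linarith [le_abs_self C1, abs_nonneg C2, abs_nonneg C3, abs_nonneg C4]
  · have := h2 w hw; rw [Real.norm_eq_abs] at this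
    linarith [le_abs_self C2, abs_nonneg C1, abs_nonneg C3, abs_nonneg C4]
  · have := h3 w hw; rw [Real.norm_eq_abs] at this
    linarith [le_abs_self C3, abs_nonneg C2, abs_nonneg C1, abs_nonneg C4]
  · have := h4 w hw; rw [Real.norm_eq_abs] at this
    linarith [le_abs_self C4, abs_nonneg C2, abs_nonneg C3, abs_nonneg C1]

/-- The bound `Q` on the `x`-derivative is kept apart from `B` because it is zero for the cutoff at
the killing side. -/
theorem abs_cutoffError_le {Φ ψ k : ℂ → ℝ} {c : ℝ} {w : ℂ} {η A B D E P Q : ℝ}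
    (hη : |Φ w| ≤ η) (hA : |dx ψ w| ≤ A) (hA' : |dy ψ w| ≤ A) (hP : |ψ w| ≤ P)
    (hB : |dx k w| ≤ B) (hB' : |dy k w| ≤ B) (hD : |lap k w| ≤ D) (hE : |density w| ≤ E)
    (hQ : |dx k w| ≤ Q) :
    |cutoffError Φ c ψ k w| ≤ η * (4 * (A * B) + P * D) + |c| * (E * (P * Q)) := by
  have hA0 := (abs_nonneg _).trans hA
  have hP0 := (abs_nonneg _).trans hP
  have hη0 := (abs_nonneg _).trans hη
  have hE0 := (abs_nonneg _).trans hE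
  refine (abs_add_le _ _).trans (add_le_add ?_ ?_)
  · rw [abs_mul]
    refine mul_le_mul hη ?_ (abs_nonneg _) hη0
    refine (abs_add_le _ _).trans (add_le_add ?_ ?_)
    · rw [abs_mul, abs_two]
      have := abs_add_le (dx ψ w * dx k w) (dy ψ w * dy k w)
      rw [abs_mul, abs_mul] at this
      have h1 := mul_le_mul hA hB (abs_nonneg _) hA0
      have h2 := mul_le_mul hA' hB' (abs_nonneg _) hA0
      linarith
    · rw [abs_mul]
      exact mul_le_mul hP hD (abs_nonneg _) hP0
  · rw [abs_mul, abs_mul, abs_mul]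
    exact mul_le_mul_of_nonneg_left (mul_le_mul hE (mul_le_mul hP hQ (abs_nonneg _) hP0)
      (by positivity) hE0) (abs_nonneg _)

section ProductForm

variable {f f' f'' g g' g'' : ℝ → ℝ}

theorem dx_mul_re_im (hf : ∀ x, HasDerivAt f (f' x) x) (hg : ∀ y, HasDerivAt g (g' y) y) :
    dx (fun w => f w.re * g w.im) = fun w => f' w.re * g w.im := by
  ext w
  rw [dx_mul (hasFDerivAt_comp_re (hf w.re)).differentiableAt
    (hasFDerivAt_comp_im (hg w.im)).differentiableAt, dx_comp_re (hf w.re), dx_comp_im (hg w.im)]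
  ring

theorem dy_mul_re_im (hf : ∀ x, HasDerivAt f (f' x) x) (hg : ∀ y, HasDerivAt g (g' y) y) :
    dy (fun w => f w.re * g w.im) = fun w => f w.re * g' w.im := by
  ext w
  rw [dy_mul (hasFDerivAt_comp_re (hf w.re)).differentiableAt
    (hasFDerivAt_comp_im (hg w.im)).differentiableAt, dy_comp_re (hf w.re), dy_comp_im (hg w.im)]
  ring

theorem lap_mul_re_im (hf : ∀ x, HasDerivAt f (f' x) x) (hf' : ∀ x, HasDerivAt f' (f'' x) x)
    (hg : ∀ y, HasDerivAt g (g' y) y) (hg' : ∀ y, HasDerivAt g' (g'' y) y) (w : ℂ) :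
    lap (fun w => f w.re * g w.im) w = f'' w.re * g w.im + f w.re * g'' w.im := by
  rw [lap, dx_mul_re_im hf hg, dx_mul_re_im hf' hg, dy_mul_re_im hf hg, dy_mul_re_im hf hg']

theorem contDiff_mul_re_im {n : WithTop ℕ∞} (hf : ContDiff ℝ n f) (hg : ContDiff ℝ n g) :
    ContDiff ℝ n (fun w : ℂ => f w.re * g w.im) :=
  (hf.comp Complex.reCLM.contDiff).mul (hg.comp Complex.imCLM.contDiff)

end ProductForm

theorem hasDerivAt_notch (u : ℝ) : HasDerivAt notch (deriv notch u) u :=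
  (contDiff_notch.differentiable (by norm_num) u).hasDerivAt

theorem hasDerivAt_deriv_notch (u : ℝ) :
    HasDerivAt (deriv notch) (deriv (deriv notch) u) u := by
  have h : ContDiff ℝ 1 (deriv notch) := (contDiff_succ_iff_deriv.1 contDiff_two_notch).2.2
  exact (h.differentiable (by norm_num) u).hasDerivAt

theorem deriv_deriv_notch_of_one_lt {u : ℝ} (hu : 1 < |u|) : deriv (deriv notch) u = 0 := by
  have : deriv notch =ᶠ[𝓝 u] fun _ => 0 := by
    filter_upwards [continuous_abs.continuousAt.eventually (lt_mem_nhds hu)] with z hz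
    exact deriv_notch_of_one_lt hz
  simp [this.deriv_eq]

theorem exists_abs_deriv_deriv_notch_le :
    ∃ C > 0, ∀ u, |deriv notch u| ≤ C ∧ |deriv (deriv notch) u| ≤ C := by
  obtain ⟨C₁, h0, h1⟩ := exists_abs_deriv_notch_le
  have h : ContDiff ℝ 1 (deriv notch) := (contDiff_succ_iff_deriv.1 contDiff_two_notch).2.2
  obtain ⟨C, hC⟩ := isCompact_Icc.exists_bound_of_continuousOn (s := Icc (-1 : ℝ) 1)
    (h.continuous_deriv le_rfl).continuousOn
  refine ⟨C₁ + |C|, by positivity, fun u => ⟨(h1 u).trans (by simp), ?_⟩⟩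
  by_cases hu : 1 < |u|
  · rw [deriv_deriv_notch_of_one_lt hu, abs_zero]; positivity
  · have := hC u (abs_le.1 (not_lt.1 hu))
    rw [Real.norm_eq_abs] at this
    linarith [le_abs_self C]

theorem notch_mem_Icc (u : ℝ) : notch u ∈ Icc (0 : ℝ) 1 :=
  ⟨Real.smoothTransition.nonneg _, Real.smoothTransition.le_one _⟩

/-! ### The corner between the arc and the reflecting side -/

/-- A cutoff function vanishing near the real point `x₀`, with transition at distance `1 / N`. -/
noncomputable def cornerCutoff (x₀ N : ℝ) (w : ℂ) : ℝ :=
  1 + (notch (N * (w.re - x₀)) - 1) * (1 - notch (N * w.im))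

section CornerCutoff

variable (x₀ N : ℝ)

theorem contDiff_cornerCutoff : ContDiff ℝ 2 (cornerCutoff x₀ N) := by
  have h := contDiff_two_notch
  refine contDiff_const.add (contDiff_mul_re_im (f := fun x => notch (N * (x - x₀)) - 1)
    (g := fun y => 1 - notch (N * y)) ?_ ?_)
  · exact (h.comp (by fun_prop)).sub contDiff_const
  · exact contDiff_const.sub (h.comp (by fun_prop))

theorem cornerCutoff_derivatives :
    (dx (cornerCutoff x₀ N) = fun w =>
      (N * deriv notch (N * (w.re - x₀))) * (1 - notch (N * w.im))) ∧
    (dy (cornerCutoff x₀ N) = fun w =>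
      (notch (N * (w.re - x₀)) - 1) * (-(N * deriv notch (N * w.im)))) ∧
    ∀ w, lap (cornerCutoff x₀ N) w =
      (N * (N * deriv (deriv notch) (N * (w.re - x₀)))) * (1 - notch (N * w.im)) +
        (notch (N * (w.re - x₀)) - 1) * (-(N * (N * deriv (deriv notch) (N * w.im)))) := by
  have a1 : ∀ x, HasDerivAt (fun x => N * (x - x₀)) N x := fun x => by
    simpa using ((hasDerivAt_id x).sub_const x₀).const_mul N
  have a2 : ∀ y, HasDerivAt (fun y => N * y) N y := fun y => by
    simpa using (hasDerivAt_id y).const_mul N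
  have f1 : ∀ x, HasDerivAt (fun x => notch (N * (x - x₀)) - 1)
      (N * deriv notch (N * (x - x₀))) x := fun x => by
    simpa [mul_comm] using ((hasDerivAt_notch _).comp x (a1 x)).sub_const 1
  have f2 : ∀ x, HasDerivAt (fun x => N * deriv notch (N * (x - x₀)))
      (N * (N * deriv (deriv notch) (N * (x - x₀)))) x := fun x => by
    have := ((hasDerivAt_deriv_notch _).comp x (a1 x)).const_mul N
    rwa [mul_comm (deriv (deriv notch) _) N] at this
  have g1 : ∀ y, HasDerivAt (fun y => 1 - notch (N * y)) (-(N * deriv notch (N * y))) y := fun y => by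
    have := ((hasDerivAt_notch _).comp y (a2 y)).const_sub 1
    rwa [mul_comm (deriv notch _) N] at this
  have g2 : ∀ y, HasDerivAt (fun y => -(N * deriv notch (N * y)))
      (-(N * (N * deriv (deriv notch) (N * y)))) y := fun y => by
    have := (((hasDerivAt_deriv_notch _).comp y (a2 y)).const_mul N).neg
    rwa [mul_comm (deriv (deriv notch) _) N] at this
  have e1 : dx (cornerCutoff x₀ N) =
      dx (fun w : ℂ => (notch (N * (w.re - x₀)) - 1) * (1 - notch (N * w.im))) := by
    ext w; unfold cornerCutoff dx; rw [fderiv_const_add]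
  have e2 : dy (cornerCutoff x₀ N) =
      dy (fun w : ℂ => (notch (N * (w.re - x₀)) - 1) * (1 - notch (N * w.im))) := by
    ext w; unfold cornerCutoff dy; rw [fderiv_const_add]
  refine ⟨?_, ?_, fun w => ?_⟩
  · rw [e1, dx_mul_re_im f1 g1]
  · rw [e2, dy_mul_re_im f1 g1]
  · rw [lap, e1, e2]
    exact lap_mul_re_im f1 f2 g1 g2 w

end CornerCutoff

theorem mul_le_of_le_of_le_one_of_nonneg {a x B : ℝ} (ha : a ≤ B) (hx : x ≤ 1) (hx0 : 0 ≤ x)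
    (hB : 0 ≤ B) : a * x ≤ B :=
  (mul_le_mul ha hx hx0 hB).trans_eq (mul_one B)

namespace IsReflectingSolution

variable {b : ℝ} {Ω : Set ℂ} {γ : ℝ → ℂ} {Φ : ℂ → ℝ} {c : ℝ}

/-- Derivatives of the cutoff are at most of order `N ^ 2`, on a square of area of order `1 / N ^
2`. The error is thus controlled by the size of `Φ` near the corner, where `Φ` is continuous and
vanishes. The term with `c` contains only a first derivative and is `O(1 / N)`. -/
theorem exists_error_bound_corner (h : IsReflectingSolution b Ω γ Φ c) {ψ : ℂ → ℝ}
    (hψ : ContDiff ℝ 2 ψ) {R : ℝ} (hR : ∀ w ∈ tsupport ψ, -R ≤ w.re) :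
    ∃ M > 0, ∀ η > 0, ∀ᶠ n : ℕ in atTop,
      |∫ w in Ω, cutoffError Φ c ψ (cornerCutoff (γ 0).re (n + 1)) w| ≤ η * M := by
  have hK := h.wedge.isCompact_closure_inter (isClosed_tsupport ψ) hR
  obtain ⟨A, hA0, hA⟩ := exists_common_bound hK hψ.continuous.continuousOn
    (continuous_dx (hψ.of_le (by norm_num))).continuousOn
    (continuous_dy (hψ.of_le (by norm_num))).continuousOn
    (contDiff_density (n := 0)).continuous.continuousOn
  obtain ⟨C, hC0, hC⟩ := exists_abs_deriv_deriv_notch_le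
  set M₁ : ℝ := 6 * (A * C) + |c| * (A * (A * C)) with hM₁
  have hM₁0 : 0 < M₁ := by positivity
  refine ⟨16 * M₁, by positivity, fun η hη => ?_⟩
  have hmem : γ 0 ∈ closure Ω := frontier_subset_closure (h.arc_mem_frontier (by simp))
  have hΦ : ∀ᶠ w in 𝓝[closure Ω] (γ 0), |Φ w| < η := by
    have := (h.continuousOn _ hmem).tendsto.abs
    rw [h.zero_arc 0 (by simp), abs_zero] at this
    exact this.eventually (gt_mem_nhds hη)
  rw [eventually_nhdsWithin_iff] at hΦ
  obtain ⟨ρ, hρ, hΦρ⟩ := Metric.eventually_nhds_iff.1 hΦ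
  have hN : Tendsto (fun n : ℕ => (n : ℝ) + 1) atTop atTop :=
    tendsto_atTop_add_const_right _ _ tendsto_natCast_atTop_atTop
  filter_upwards [hN.eventually_ge_atTop (1 / η), hN.eventually_gt_atTop (4 / ρ)] with n h1 h2
  set N : ℝ := (n : ℝ) + 1 with hNdef
  have hN0 : 0 < N := by positivity
  have hN1 : 1 ≤ N := by rw [hNdef]; linarith [(Nat.cast_nonneg n : (0 : ℝ) ≤ n)]
  have hNη : 1 ≤ N * η := by rwa [div_le_iff₀ hη] at h1
  have hNρ : 4 / N < ρ := by
    rw [div_lt_iff₀ hρ] at h2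
    rw [div_lt_iff₀ hN0]; linarith
  obtain ⟨ex, ey, el⟩ := cornerCutoff_derivatives (γ 0).re N
  have hβ : ∀ u, |1 - notch u| ≤ 1 := fun u => by
    have := notch_mem_Icc u
    rw [abs_le]; constructor <;> linarith [this.1, this.2]
  have hβ' : ∀ u, |notch u - 1| ≤ 1 := fun u => by rw [abs_sub_comm]; exact hβ u
  have hvol := volume_box_le (γ 0).re 0 (ρ := 2 / N) (δ := 2 / N) (by positivity)
  have hle : |∫ w in Ω, cutoffError Φ c ψ (cornerCutoff (γ 0).re N) w| ≤
      (η * N ^ 2 * M₁) * (4 * (2 / N) * (2 / N)) := by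
    refine abs_setIntegral_le_of_support h.wedge.isOpen.measurableSet
      (measurableSet_box (γ 0).re 0 (2 / N) (2 / N)) (by positivity)
      (hvol.trans_lt ENNReal.ofReal_lt_top).ne
      (ENNReal.toReal_le_of_le_ofReal (by positivity) hvol) ?_ ?_
    · intro w hw hwbox
      have hor : 1 < |N * (w.re - (γ 0).re)| ∨ 1 < |N * w.im| := by
        by_contra hcon
        push Not at hcon
        refine hwbox ⟨?_, ?_⟩
        · have := hcon.1
          rw [abs_mul, abs_of_pos hN0] at this
          rw [lt_div_iff₀ hN0]; linarith
        · have := hcon.2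
          rw [abs_mul, abs_of_pos hN0] at this
          rw [sub_zero, lt_div_iff₀ hN0]; linarith
      have : dx (cornerCutoff (γ 0).re N) w = 0 ∧ dy (cornerCutoff (γ 0).re N) w = 0 ∧
          lap (cornerCutoff (γ 0).re N) w = 0 := by
        rw [ex, ey, el]
        rcases hor with h' | h'
        · simp [deriv_notch_of_one_lt h', deriv_deriv_notch_of_one_lt h', notch_of_one_le h'.le]
        · simp [deriv_notch_of_one_lt h', deriv_deriv_notch_of_one_lt h', notch_of_one_le h'.le]
      simp [cutoffError, this.1, this.2.1, this.2.2]
    · intro w hw hwbox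
      by_cases hws : w ∈ tsupport ψ
      · have hwK : w ∈ closure Ω ∩ tsupport ψ := ⟨subset_closure hw, hws⟩
        obtain ⟨b1, b2, b3, b4⟩ := hA w hwK
        have hdist : dist w (γ 0) < ρ := by
          rw [dist_eq_norm]
          refine (Complex.norm_le_abs_re_add_abs_im _).trans_lt ?_
          have i1 := hwbox.1
          have i2 := hwbox.2
          rw [Complex.sub_re, Complex.sub_im, h.wedge.arc.start_mem]
          -- The norm is at most the sum of the two half-sides of the square.
          have : 4 / N = 2 / N + 2 / N := by ring
          linarith
        have hΦw := (hΦρ hdist (subset_closure hw)).le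
        have k1 : |dx (cornerCutoff (γ 0).re N) w| ≤ N * C := by
          rw [ex, abs_mul, abs_mul, abs_of_pos hN0]
          exact mul_le_of_le_of_le_one_of_nonneg (mul_le_mul_of_nonneg_left (hC _).1 hN0.le) (hβ _)
            (abs_nonneg _) (by positivity)
        have k2 : |dy (cornerCutoff (γ 0).re N) w| ≤ N * C := by
          rw [ey, abs_mul, abs_neg, abs_mul, abs_of_pos hN0, mul_comm]
          exact mul_le_of_le_of_le_one_of_nonneg (mul_le_mul_of_nonneg_left (hC _).1 hN0.le) (hβ' _)
            (abs_nonneg _) (by positivity)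
        have k3 : |lap (cornerCutoff (γ 0).re N) w| ≤ N * (N * C) + N * (N * C) := by
          rw [el]
          refine (abs_add_le _ _).trans (add_le_add ?_ ?_)
          · rw [abs_mul, abs_mul, abs_mul, abs_of_pos hN0]
            exact mul_le_of_le_of_le_one_of_nonneg (by gcongr; exact (hC _).2) (hβ _)
              (abs_nonneg _) (by positivity)
          · rw [abs_mul, abs_neg, abs_mul, abs_mul, abs_of_pos hN0, mul_comm]
            exact mul_le_of_le_of_le_one_of_nonneg (by gcongr; exact (hC _).2) (hβ' _)
              (abs_nonneg _) (by positivity)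
        refine (abs_cutoffError_le hΦw b2 b3 b1 k1 k2 k3 b4 k1).trans ?_
        -- First-order terms grow only like `N`; the choices `1 ≤ N` and `1 ≤ N * η` absorb them
        -- into `η * N ^ 2`.
        have t1 : η * (A * C) * N ≤ η * (A * C) * N ^ 2 := by
          refine mul_le_mul_of_nonneg_left ?_ (by positivity)
          nlinarith
        have t2 : (|c| * (A * (A * C))) * N ≤ (|c| * (A * (A * C))) * (η * N ^ 2) := by
          refine mul_le_mul_of_nonneg_left ?_ (by positivity)
          nlinarith
        rw [hM₁]
        nlinarith
      · rw [cutoffError_eq_zero hws, abs_zero]; positivity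
  refine hle.trans (le_of_eq ?_)
  field_simp
  ring

/-- The cutoff is `1 - (1 - p) (1 - q)` with notches `p` in `x` and `q` in `y`. It vanishes near the
corner and equals one once `y ≥ 1 / N`. Its `y`-derivative is zero on the axis, because the notch is
constant near `0`, so the Neumann condition on the test function survives. -/
theorem integral_testDensity_of_top (h : IsReflectingSolution b Ω γ Φ c) (hb : 0 < b)
    {ψ : ℂ → ℝ} (hψ : ContDiff ℝ 2 ψ) {R : ℝ} (hR : ∀ w ∈ tsupport ψ, -R ≤ w.re)
    (htop : ∀ w ∈ tsupport ψ, w.im ≠ Real.pi * b)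
    (hneu : ∀ x : ℝ, dy ψ x = 0) : ∫ w in Ω, testDensity Φ c ψ w = 0 := by
  obtain ⟨M, hM, herr⟩ := h.exists_error_bound_corner hψ hR
  have hβ : ∀ u, notch u ∈ Icc (0 : ℝ) 1 := notch_mem_Icc
  refine h.wedge.integral_testDensity_eq_zero_of_cutoff h.continuousOn hψ hR
    (k := fun n => cornerCutoff (γ 0).re (n + 1)) (fun n => contDiff_cornerCutoff _ _)
    (fun n w => ?_) (fun w hw => ?_) (Eventually.of_forall fun n => ?_) hM herr
  · obtain ⟨a1, a2⟩ := hβ ((n + 1) * (w.re - (γ 0).re))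
    obtain ⟨a3, a4⟩ := hβ ((n + 1) * w.im)
    rw [cornerCutoff, abs_le]
    constructor <;> nlinarith
  · have him := (h.wedge.inside w hw).1
    have hN : Tendsto (fun n : ℕ => (n : ℝ) + 1) atTop atTop :=
      tendsto_atTop_add_const_right _ _ tendsto_natCast_atTop_atTop
    filter_upwards [hN.eventually_ge_atTop (1 / w.im)] with n hn
    rw [div_le_iff₀ him] at hn
    rw [cornerCutoff, notch_of_one_le (u := ((n : ℝ) + 1) * w.im) (hn.trans (le_abs_self _))]
    ring
  · have hk := contDiff_cornerCutoff (γ 0).re ((n : ℝ) + 1)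
    refine h.integral_testDensity_of_tsupport hb (hψ.mul hk)
      (fun w hw => hR w (tsupport_mul_subset_left hw)) ?_
      (fun w hw => htop w (tsupport_mul_subset_left hw)) fun x => ?_
    · rw [notMem_tsupport_iff_eventuallyEq]
      have c1 : ContinuousAt (fun w : ℂ => (((n : ℝ) + 1) * (w.re - (γ 0).re)) ^ 2) (γ 0) := by
        fun_prop
      have c2 : ContinuousAt (fun w : ℂ => (((n : ℝ) + 1) * w.im) ^ 2) (γ 0) := by fun_prop
      have c3 : (((n : ℝ) + 1) * ((γ 0).re - (γ 0).re)) ^ 2 < 1 / 2 := by simp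
      have c4 : (((n : ℝ) + 1) * (γ 0).im) ^ 2 < 1 / 2 := by simp [h.wedge.arc.start_mem]
      filter_upwards [c1.eventually (gt_mem_nhds c3), c2.eventually (gt_mem_nhds c4)] with w h1 h2
      simp [cornerCutoff, notch_of_sq_le h1.le, notch_of_sq_le h2.le]
    · rw [dy_mul (hψ.differentiable (by norm_num) _) (hk.differentiable (by norm_num) _), hneu,
        (cornerCutoff_derivatives _ _).2.1]
      simp [deriv_notch_of_sq_lt (u := 0) (by norm_num)]

end IsReflectingSolution

/-! ### The killing side -/

/-- A cutoff function vanishing near the line `im = y₀`, with transition at distance `1 / N`. -/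
noncomputable def sideCutoff (y₀ N : ℝ) (w : ℂ) : ℝ := notch (N * (w.im - y₀))

theorem contDiff_sideCutoff (y₀ N : ℝ) : ContDiff ℝ 2 (sideCutoff y₀ N) := by
  have h : ContDiff ℝ 2 (fun y : ℝ => notch (N * (y - y₀))) :=
    contDiff_two_notch.comp (by fun_prop)
  exact h.comp Complex.imCLM.contDiff

theorem sideCutoff_derivatives (y₀ N : ℝ) :
    (dx (sideCutoff y₀ N) = fun _ => 0) ∧
    (dy (sideCutoff y₀ N) = fun w => N * deriv notch (N * (w.im - y₀))) ∧
    ∀ w, lap (sideCutoff y₀ N) w = N * (N * deriv (deriv notch) (N * (w.im - y₀))) := by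
  have a1 : ∀ x, HasDerivAt (fun x => N * (x - y₀)) N x := fun x => by
    simpa using ((hasDerivAt_id x).sub_const y₀).const_mul N
  have g1 : ∀ x, HasDerivAt (fun x => notch (N * (x - y₀)))
      (N * deriv notch (N * (x - y₀))) x := fun x => by
    have := (hasDerivAt_notch _).comp x (a1 x)
    rwa [mul_comm (deriv notch _) N] at this
  have g2 : ∀ x, HasDerivAt (fun x => N * deriv notch (N * (x - y₀)))
      (N * (N * deriv (deriv notch) (N * (x - y₀)))) x := fun x => by
    have := ((hasDerivAt_deriv_notch _).comp x (a1 x)).const_mul N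
    rwa [mul_comm (deriv (deriv notch) _) N] at this
  have e1 : dx (sideCutoff y₀ N) = fun _ => 0 := funext fun w => dx_comp_im (g1 w.im)
  have e2 : dy (sideCutoff y₀ N) = fun w => N * deriv notch (N * (w.im - y₀)) :=
    funext fun w => dy_comp_im (g1 w.im)
  refine ⟨e1, e2, fun w => ?_⟩
  rw [lap, e1, e2]
  have : dy (fun w : ℂ => N * deriv notch (N * (w.im - y₀))) w = _ := dy_comp_im (g2 w.im)
  rw [this]
  simp [dx]

/-- The mean value inequality from the killing side; it supplies the factor `1 / N` that compensates
one derivative of the cutoff. -/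
theorem abs_le_of_vertical_segment {ψ : ℂ → ℝ} (hψ : ContDiff ℝ 1 ψ) {A y₀ : ℝ} {w : ℂ}
    (hw : w.im ≤ y₀) (h0 : ψ (w.re + y₀ * Complex.I) = 0)
    (hA : ∀ y ∈ Icc w.im y₀, |dy ψ (w.re + y * Complex.I)| ≤ A) : |ψ w| ≤ A * (y₀ - w.im) := by
  have hline : ∀ y : ℝ, HasDerivAt (fun y : ℝ => (w.re : ℂ) + y * Complex.I) Complex.I y := fun y => by
    simpa using ((Complex.ofRealCLM.hasDerivAt (x := y)).mul_const Complex.I).const_add (w.re : ℂ)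
  have hd : ∀ y ∈ Icc w.im y₀, HasDerivWithinAt (fun y : ℝ => ψ (w.re + y * Complex.I))
      (dy ψ (w.re + y * Complex.I)) (Icc w.im y₀) y := fun y _ =>
    ((hψ.differentiable (by norm_num) _).hasFDerivAt.comp_hasDerivAt y (hline y)).hasDerivWithinAt
  have := Convex.norm_image_sub_le_of_norm_hasDerivWithin_le hd hA (convex_Icc _ _)
    (right_mem_Icc.2 hw) (left_mem_Icc.2 hw)
  rw [h0, sub_zero, Complex.re_add_im, Real.norm_eq_abs, Real.norm_eq_abs, abs_sub_comm,
    abs_of_nonneg (sub_nonneg.2 hw)] at this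
  exact this

namespace IsReflectingSolution

variable {b : ℝ} {Ω : Set ℂ} {γ : ℝ → ℂ} {Φ : ℂ → ℝ} {c : ℝ}

/-- The strip of transition has area `O(1 / N)`. In it `ψ = O(1 / N)` offsets the `N ^ 2` of the
second derivative of the cutoff, so the whole factor of `Φ` is `O(N)`; and `Φ` is uniformly small
there. The term with `c` is absent, since the cutoff does not depend on `x`. -/
theorem exists_error_bound_top (h : IsReflectingSolution b Ω γ Φ c) {ψ : ℂ → ℝ}
    (hψ : ContDiff ℝ 2 ψ) {R : ℝ} (hR : ∀ w ∈ tsupport ψ, -R ≤ w.re)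
    (htop : ∀ x : ℝ, ψ (x + (Real.pi * b : ℝ) * Complex.I) = 0) :
    ∃ M > 0, ∀ η > 0, ∀ᶠ n : ℕ in atTop,
      |∫ w in Ω, cutoffError Φ c ψ (sideCutoff (Real.pi * b) (n + 1)) w| ≤ η * M := by
  have hψ1 : ContDiff ℝ 1 ψ := hψ.of_le (by norm_num)
  have hK := h.wedge.isCompact_closure_inter (isClosed_tsupport ψ) hR
  obtain ⟨X, hX⟩ := h.wedge.closure_subset
  set ρ₀ : ℝ := |X| + |R| + 1 with hρ₀
  have hρ₀0 : 0 < ρ₀ := by positivity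
  have hre : ∀ w ∈ closure Ω ∩ tsupport ψ, |w.re| < ρ₀ := fun w hw => by
    have h1 := (hX w hw.1).1
    have h2 := hR w hw.2
    rw [abs_lt]
    constructor
    · linarith [le_abs_self R, abs_nonneg X]
    · linarith [le_abs_self X, abs_nonneg R]
  -- A full rectangle is used, because the vertical segment from a point of `Ω` to the killing side
  -- may leave the closure of `Ω`.
  set Q : Set ℂ := Icc (-ρ₀) ρ₀ ×ℂ Icc 0 (Real.pi * b) with hQ
  have hQc : IsCompact Q := isCompact_Icc.reProdIm isCompact_Icc
  obtain ⟨A, hA0, hA⟩ := exists_common_bound hQc (continuous_dx hψ1).continuousOn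
    (continuous_dy hψ1).continuousOn (contDiff_density (n := 0)).continuous.continuousOn
    (contDiff_density (n := 0)).continuous.continuousOn
  obtain ⟨C, hC0, hC⟩ := exists_abs_deriv_deriv_notch_le
  refine ⟨48 * (A * C * ρ₀), by positivity, fun η hη => ?_⟩
  have hcont : Continuous fun w : ℂ => w.im - Real.pi * b := by fun_prop
  obtain ⟨δ₀, hδ₀, hsmall⟩ := exists_forall_abs_lt_of_tendsto (Ω := Ω) (Q := Φ)
    (v := fun w => w.im - Real.pi * b) hK hcont.continuousOn (fun q hq hq0 => by
      have hqim : q.im = Real.pi * b := sub_eq_zero.1 hq0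
      have hqf : q ∈ frontier Ω := by
        rw [h.wedge.isOpen.frontier_eq]
        exact ⟨hq.1, fun hqΩ => (h.wedge.inside q hqΩ).2.ne hqim⟩
      have := (h.continuousOn q hq.1).tendsto
      rw [h.zero_top q hqf hqim] at this
      exact this.mono_left (nhdsWithin_mono _ subset_closure)) hη
  have hN : Tendsto (fun n : ℕ => (n : ℝ) + 1) atTop atTop :=
    tendsto_atTop_add_const_right _ _ tendsto_natCast_atTop_atTop
  filter_upwards [hN.eventually_gt_atTop (2 / δ₀)] with n h2
  set N : ℝ := (n : ℝ) + 1 with hNdef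
  have hN0 : 0 < N := by positivity
  have hNδ : 2 / N < δ₀ := by
    rw [div_lt_iff₀ hδ₀] at h2
    rw [div_lt_iff₀ hN0]; linarith
  obtain ⟨ex, ey, el⟩ := sideCutoff_derivatives (Real.pi * b) N
  have hvol := volume_box_le 0 (Real.pi * b) (ρ := ρ₀) (δ := 2 / N) (by positivity)
  have hle : |∫ w in Ω, cutoffError Φ c ψ (sideCutoff (Real.pi * b) N) w| ≤
      (η * (6 * (A * C) * N)) * (4 * ρ₀ * (2 / N)) := by
    refine abs_setIntegral_le_of_support h.wedge.isOpen.measurableSet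
      (measurableSet_box 0 (Real.pi * b) ρ₀ (2 / N)) (by positivity)
      (hvol.trans_lt ENNReal.ofReal_lt_top).ne
      (ENNReal.toReal_le_of_le_ofReal (by positivity) hvol) ?_ ?_
    · intro w hw hwbox
      by_cases hws : w ∈ tsupport ψ
      · have hwK : w ∈ closure Ω ∩ tsupport ψ := ⟨subset_closure hw, hws⟩
        have h' : 1 < |N * (w.im - Real.pi * b)| := by
          by_contra hcon
          rw [not_lt, abs_mul, abs_of_pos hN0] at hcon
          refine hwbox ⟨by simpa using hre w hwK, ?_⟩
          rw [lt_div_iff₀ hN0]; linarith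
        simp [cutoffError, ex, ey, el, deriv_notch_of_one_lt h', deriv_deriv_notch_of_one_lt h']
      · exact cutoffError_eq_zero hws
    · intro w hw hwbox
      by_cases hws : w ∈ tsupport ψ
      · have hwK : w ∈ closure Ω ∩ tsupport ψ := ⟨subset_closure hw, hws⟩
        have hin := h.wedge.inside w hw
        have hrew := abs_lt.1 (hre w hwK)
        obtain ⟨b2, b3, b4, -⟩ := hA w ⟨⟨hrew.1.le, hrew.2.le⟩, ⟨hin.1.le, hin.2.le⟩⟩
        have hΦw := (hsmall w hwK hw (hwbox.2.trans hNδ)).le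
        have b1 : |ψ w| ≤ A * (2 / N) := by
          refine (abs_le_of_vertical_segment hψ1 hin.2.le (htop w.re) (A := A) fun y hy => ?_).trans ?_
          · refine (hA _ ⟨?_, ?_⟩).2.1
            · simpa using And.intro hrew.1.le hrew.2.le
            · simpa using And.intro (hin.1.le.trans hy.1) hy.2
          · refine mul_le_mul_of_nonneg_left ?_ hA0.le
            have := hwbox.2
            rw [abs_sub_comm] at this
            exact (le_abs_self _).trans this.le
        have k1 : |dx (sideCutoff (Real.pi * b) N) w| ≤ N * C := by
          rw [ex, abs_zero]; positivity
        have k1' : |dx (sideCutoff (Real.pi * b) N) w| ≤ 0 := by rw [ex, abs_zero]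
        have k2 : |dy (sideCutoff (Real.pi * b) N) w| ≤ N * C := by
          rw [ey, abs_mul, abs_of_pos hN0]
          exact mul_le_mul_of_nonneg_left (hC _).1 hN0.le
        have k3 : |lap (sideCutoff (Real.pi * b) N) w| ≤ N * (N * C) := by
          rw [el, abs_mul, abs_mul, abs_of_pos hN0]
          gcongr
          exact (hC _).2
        refine (abs_cutoffError_le hΦw b2 b3 b1 k1 k2 k3 b4 k1').trans (le_of_eq ?_)
        field_simp
        ring
      · rw [cutoffError_eq_zero hws, abs_zero]; positivity
  refine hle.trans (le_of_eq ?_)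
  field_simp
  ring

/-- The weak form of the problem, for test functions vanishing on the killing side and with vanishing
normal derivative on the reflecting side. -/
theorem integral_testDensity (h : IsReflectingSolution b Ω γ Φ c) (hb : 0 < b)
    {ψ : ℂ → ℝ} (hψ : ContDiff ℝ 2 ψ) {R : ℝ} (hR : ∀ w ∈ tsupport ψ, -R ≤ w.re)
    (htop : ∀ x : ℝ, ψ (x + (Real.pi * b : ℝ) * Complex.I) = 0)
    (hneu : ∀ x : ℝ, dy ψ x = 0) : ∫ w in Ω, testDensity Φ c ψ w = 0 := by
  obtain ⟨M, hM, herr⟩ := h.exists_error_bound_top hψ hR htop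
  have hN : Tendsto (fun n : ℕ => (n : ℝ) + 1) atTop atTop :=
    tendsto_atTop_add_const_right _ _ tendsto_natCast_atTop_atTop
  have hpos : 0 < Real.pi * b := mul_pos Real.pi_pos hb
  refine h.wedge.integral_testDensity_eq_zero_of_cutoff h.continuousOn hψ hR
    (k := fun n => sideCutoff (Real.pi * b) (n + 1)) (fun n => contDiff_sideCutoff _ _)
    (fun n w => abs_notch_le _) (fun w hw => ?_) ?_ hM herr
  · have him := (h.wedge.inside w hw).2
    have him' : 0 < Real.pi * b - w.im := sub_pos.2 him
    filter_upwards [hN.eventually_ge_atTop (1 / (Real.pi * b - w.im))] with n hn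
    rw [div_le_iff₀ him'] at hn
    rw [sideCutoff, notch_of_one_le]
    rw [← abs_neg]
    exact (le_of_le_of_eq hn (by ring)).trans (le_abs_self _)
  -- For such `n` the reflecting side lies beyond the transition, so the cutoff has zero derivative
  -- on it and the Neumann condition is preserved.
  · filter_upwards [hN.eventually_gt_atTop (1 / (Real.pi * b))] with n hn
    rw [div_lt_iff₀ hpos] at hn
    have hk := contDiff_sideCutoff (Real.pi * b) ((n : ℝ) + 1)
    refine h.integral_testDensity_of_top hb (hψ.mul hk)
      (fun w hw => hR w (tsupport_mul_subset_left hw)) (fun w hw him => ?_) fun x => ?_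
    · refine absurd hw ?_
      rw [notMem_tsupport_iff_eventuallyEq]
      have c1 : ContinuousAt (fun w : ℂ => (((n : ℝ) + 1) * (w.im - Real.pi * b)) ^ 2) w := by
        fun_prop
      have c3 : (((n : ℝ) + 1) * (w.im - Real.pi * b)) ^ 2 < 1 / 2 := by simp [him]
      filter_upwards [c1.eventually (gt_mem_nhds c3)] with z h1
      simp [sideCutoff, notch_of_sq_le h1.le]
    · rw [dy_mul (hψ.differentiable (by norm_num) _) (hk.differentiable (by norm_num) _), hneu,
        (sideCutoff_derivatives _ _).2.1]
      have : 1 < |((n : ℝ) + 1) * ((x : ℂ).im - Real.pi * b)| := by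
        rw [← abs_neg]
        refine (lt_of_lt_of_eq hn ?_).trans_le (le_abs_self _)
        rw [Complex.ofReal_im]; ring
      simp only [deriv_notch_of_one_lt this]
      ring

end IsReflectingSolution

/-! ### Powers, the area measure and integrals over rectangles -/

theorem re_power (s : ℝ) (w : ℂ) : (power s w).re = Real.exp (s * w.re) * Real.cos (s * w.im) := by
  simp [power, Complex.exp_re]

theorem norm_power (s : ℝ) (w : ℂ) : ‖power s w‖ = Real.exp (s * w.re) := by
  simp [power, Complex.norm_exp]

theorem continuous_power (s : ℝ) : Continuous (power s) := by
  unfold power; fun_prop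

theorem norm_coord_sq (w : ℂ) : ‖coord w‖ ^ 2 = density w := by
  rw [coord, Complex.norm_exp, density, ← Real.exp_nat_mul]; norm_num

section Area

variable {E : Type*} [NormedAddCommGroup E] [NormedSpace ℝ E] {Ω : Set ℂ}

theorem measurable_areaDensity : Measurable fun w : ℂ => ENNReal.ofReal (‖coord w‖ ^ 2) := by
  unfold coord; fun_prop

theorem toReal_areaDensity (w : ℂ) : (ENNReal.ofReal (‖coord w‖ ^ 2)).toReal = density w := by
  rw [ENNReal.toReal_ofReal (by positivity), norm_coord_sq]

theorem integrableOn_area_iff (hΩ : MeasurableSet Ω) {f : ℂ → E} :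
    IntegrableOn f Ω area ↔ IntegrableOn (fun w => density w • f w) Ω := by
  rw [IntegrableOn, area, restrict_withDensity hΩ,
    integrable_withDensity_iff_integrable_smul' measurable_areaDensity
      (Eventually.of_forall fun _ => ENNReal.ofReal_lt_top)]
  simp only [toReal_areaDensity, IntegrableOn]

theorem setIntegral_area (hΩ : MeasurableSet Ω) (f : ℂ → E) :
    ∫ w in Ω, f w ∂area = ∫ w in Ω, density w • f w := by
  rw [area, setIntegral_withDensity_eq_setIntegral_toReal_smul measurable_areaDensity
    (Eventually.of_forall fun _ => ENNReal.ofReal_lt_top) _ hΩ]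
  simp only [toReal_areaDensity]

end Area

theorem reProdIm_eq_preimage (s t : Set ℝ) :
    s ×ℂ t = Complex.measurableEquivRealProd ⁻¹' (s ×ˢ t) := rfl

theorem integrableOn_reProdIm_mul {s t : Set ℝ} {f g : ℝ → ℝ} (hf : IntegrableOn f s)
    (hg : IntegrableOn g t) : IntegrableOn (fun w : ℂ => f w.re * g w.im) (s ×ℂ t) := by
  have h : IntegrableOn (fun z : ℝ × ℝ => f z.1 * g z.2) (s ×ˢ t) := by
    rw [IntegrableOn, Measure.volume_eq_prod, ← Measure.prod_restrict]
    exact Integrable.mul_prod hf hg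
  rw [reProdIm_eq_preimage]
  exact (Complex.volume_preserving_equiv_real_prod.integrableOn_comp_preimage
    Complex.measurableEquivRealProd.measurableEmbedding).2 h

theorem setIntegral_reProdIm_mul (s t : Set ℝ) (f g : ℝ → ℝ) :
    ∫ w in s ×ℂ t, f w.re * g w.im = (∫ x in s, f x) * ∫ y in t, g y := by
  rw [reProdIm_eq_preimage, ← setIntegral_prod_mul, ← Measure.volume_eq_prod]
  exact Complex.volume_preserving_equiv_real_prod.setIntegral_preimage_emb
    Complex.measurableEquivRealProd.measurableEmbedding (fun z : ℝ × ℝ => f z.1 * g z.2) _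

/-! ### The region and the potential near the origin -/

namespace IsWedgeRegion

variable {α β : ℝ} {Ω : Set ℂ} {γ : ℝ → ℂ}

/-- Left of the compact arc, the open half-strip contains no frontier point. It is connected, and it
meets `Ω` because points of the side `im = α` lie in the closure; hence it is contained in `Ω`. -/
theorem exists_halfStrip_subset (h : IsWedgeRegion α β Ω γ) (hαβ : α < β) :
    ∃ x₁, ∀ w : ℂ, w.re < x₁ → α < w.im → w.im < β → w ∈ Ω := by
  have hC : IsCompact (γ '' Icc 0 1) := isCompact_Icc.image_of_continuousOn h.arc.continuousOn
  obtain ⟨x₁, hx₁⟩ := (hC.image Complex.continuous_re).bddBelow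
  have hγre : ∀ t ∈ Icc (0 : ℝ) 1, x₁ ≤ (γ t).re := fun t ht =>
    hx₁ ⟨γ t, ⟨t, ht, rfl⟩, rfl⟩
  refine ⟨x₁, ?_⟩
  set S : Set ℂ := Iio x₁ ×ℂ Ioo α β with hS
  have hconv : Convex ℝ S := (convex_halfSpace_re_lt x₁).inter
    ((convex_halfSpace_im_gt α).inter (convex_halfSpace_im_lt β))
  have hfr : ∀ w ∈ S, w ∉ frontier Ω := by
    rintro w ⟨h1, h2⟩ hf
    rw [h.frontier_eq] at hf
    rcases hf with (⟨t, ht, rfl⟩ | hf) | hf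
    · exact absurd (hγre t ht) (not_le.2 h1)
    · exact h2.1.ne' hf.1
    · exact h2.2.ne hf.1
  have hne : (S ∩ Ω).Nonempty := by
    have hp : (⟨x₁ - 1, α⟩ : ℂ) ∈ closure Ω := by
      refine frontier_subset_closure ?_
      rw [h.frontier_eq]
      refine Or.inl (Or.inr ⟨rfl, ?_⟩)
      have := hγre 0 (by simp)
      change x₁ - 1 ≤ _
      linarith
    have hU : IsOpen (Iio x₁ ×ℂ Iio β) := isOpen_Iio.reProdIm isOpen_Iio
    obtain ⟨w, hw1, hw2⟩ := mem_closure_iff.1 hp _ hU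
      ⟨by simp, by simpa using hαβ⟩
    exact ⟨w, ⟨hw1.1, ⟨(h.inside w hw2).1, hw1.2⟩⟩, hw2⟩
  have hsub : S ⊆ Ω := by
    refine hconv.isPreconnected.subset_of_closure_inter_subset h.isOpen hne ?_
    rintro w ⟨h1, h2⟩
    by_contra hw
    exact hfr w h2 (by rw [h.isOpen.frontier_eq]; exact ⟨h1, hw⟩)
  exact fun w h1 h2 h3 => hsub ⟨h1, h2, h3⟩

/-- The integrand has modulus `e^{(s+2)x}`, integrable on a half-strip bounded on the right. -/
theorem integrableOn_density_mul_power (h : IsWedgeRegion α β Ω γ) {s : ℝ} (hs : 0 < s) :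
    IntegrableOn (fun w => density w • power s w) Ω := by
  obtain ⟨X, hX⟩ := h.closure_subset
  have h1 : IntegrableOn (fun w : ℂ => Real.exp ((s + 2) * w.re) * (fun _ => (1 : ℝ)) w.im)
      (Iic X ×ℂ Icc α β) :=
    integrableOn_reProdIm_mul (integrableOn_exp_mul_Iic (by positivity) X)
      (integrableOn_const (by simp))
  have h2 := h1.mono_set (s := Ω) fun w hw =>
    ⟨(hX w (subset_closure hw)).1, (hX w (subset_closure hw)).2⟩
  have hc : Continuous (fun w => density w • power s w) :=
    (contDiff_density (n := 0)).continuous.smul (continuous_power s)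
  refine Integrable.mono h2 hc.aestronglyMeasurable (Eventually.of_forall fun w => ?_)
  rw [norm_smul, norm_power, density, Real.norm_eq_abs, Real.norm_eq_abs, mul_one, Real.abs_exp,
    Real.abs_exp, ← Real.exp_add]
  exact le_of_eq (by ring_nf)

theorem integrableOn_power (h : IsWedgeRegion α β Ω γ) {s : ℝ} (hs : 0 < s) :
    IntegrableOn (power s) Ω area :=
  (integrableOn_area_iff h.isOpen.measurableSet).2 (h.integrableOn_density_mul_power hs)

end IsWedgeRegion

/-- The asymptotics multiplied by `e^{sx}`, which makes them uniform in the argument. -/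
theorem BehavesNearOrigin.exists_bound {s : ℝ} {Φ : ℂ → ℝ} {Ω : Set ℂ}
    (h : BehavesNearOrigin s Φ Ω) {ε : ℝ} (hε : 0 < ε) :
    ∃ x₁, ∀ w ∈ Ω, w.re ≤ x₁ →
      |Φ w * Real.exp (s * w.re) + Real.cos (s * w.im)| ≤ ε := by
  have h1 := h.def hε
  rw [eventually_inf_principal, eventually_comap] at h1
  obtain ⟨x₁, hx₁⟩ := eventually_atBot.1 h1
  refine ⟨x₁, fun w hw hwx => ?_⟩
  have h2 := hx₁ w.re hwx w rfl hw
  rw [norm_norm, norm_power, re_power, Real.norm_eq_abs] at h2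
  have he : Real.exp (-s * w.re) * Real.exp (s * w.re) = 1 := by
    rw [← Real.exp_add]; simp
  have hcos : Real.cos (-s * w.im) = Real.cos (s * w.im) := by rw [neg_mul, Real.cos_neg]
  have : Φ w * Real.exp (s * w.re) + Real.cos (s * w.im) =
      (Φ w - -(Real.exp (-s * w.re) * Real.cos (-s * w.im))) * Real.exp (s * w.re) := by
    rw [hcos]
    linear_combination (-Real.cos (s * w.im)) * he
  rw [this, abs_mul, Real.abs_exp]
  calc _ ≤ ε * Real.exp (-s * w.re) * Real.exp (s * w.re) :=
        mul_le_mul_of_nonneg_right h2 (Real.exp_pos _).le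
    _ = ε := by rw [mul_assoc, he, mul_one]

/-! ### Harmonic powers cut off near the origin -/

open Real (smoothTransition)

theorem contDiff_two_smoothTransition : ContDiff ℝ 2 smoothTransition :=
  Real.smoothTransition.contDiff (n := 2)

theorem contDiff_deriv_smoothTransition : ContDiff ℝ 1 (deriv smoothTransition) :=
  (contDiff_succ_iff_deriv.1 contDiff_two_smoothTransition).2.2

theorem hasDerivAt_smoothTransition (u : ℝ) :
    HasDerivAt smoothTransition (deriv smoothTransition u) u :=
  (contDiff_two_smoothTransition.differentiable (by norm_num) u).hasDerivAt

theorem hasDerivAt_deriv_smoothTransition (u : ℝ) :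
    HasDerivAt (deriv smoothTransition) (deriv (deriv smoothTransition) u) u :=
  (contDiff_deriv_smoothTransition.differentiable (by norm_num) u).hasDerivAt

theorem deriv_smoothTransition_of_notMem {u : ℝ} (hu : u ∉ Icc (0 : ℝ) 1) :
    deriv smoothTransition u = 0 ∧ deriv (deriv smoothTransition) u = 0 := by
  have key : ∀ u : ℝ, u ∉ Icc (0 : ℝ) 1 → deriv smoothTransition u = 0 := by
    intro u hu
    by_cases h : u < 0
    · have : smoothTransition =ᶠ[𝓝 u] fun _ => 0 := by
        filter_upwards [gt_mem_nhds h] with z hz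
        exact Real.smoothTransition.zero_of_nonpos hz.le
      simp [this.deriv_eq]
    · have h1 : 1 < u := by
        by_contra h'
        exact hu ⟨not_lt.1 h, not_lt.1 h'⟩
      have : smoothTransition =ᶠ[𝓝 u] fun _ => 1 := by
        filter_upwards [lt_mem_nhds h1] with z hz
        exact Real.smoothTransition.one_of_one_le hz.le
      simp [this.deriv_eq]
  refine ⟨key u hu, ?_⟩
  have : deriv smoothTransition =ᶠ[𝓝 u] fun _ => 0 := by
    filter_upwards [isClosed_Icc.isOpen_compl.mem_nhds hu] with z hz
    exact key z hz
  simp [this.deriv_eq]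

theorem exists_abs_deriv_smoothTransition_le :
    ∃ C > 0, ∀ u, |deriv smoothTransition u| ≤ C ∧ |deriv (deriv smoothTransition) u| ≤ C := by
  obtain ⟨C₁, h1⟩ := isCompact_Icc.exists_bound_of_continuousOn (s := Icc (0 : ℝ) 1)
    contDiff_deriv_smoothTransition.continuous.continuousOn
  obtain ⟨C₂, h2⟩ := isCompact_Icc.exists_bound_of_continuousOn (s := Icc (0 : ℝ) 1)
    (contDiff_deriv_smoothTransition.continuous_deriv le_rfl).continuousOn
  refine ⟨|C₁| + |C₂| + 1, by positivity, fun u => ?_⟩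
  by_cases hu : u ∈ Icc (0 : ℝ) 1
  · have i1 := h1 u hu
    have i2 := h2 u hu
    rw [Real.norm_eq_abs] at i1 i2
    constructor
    · linarith [le_abs_self C₁, abs_nonneg C₂]
    · linarith [le_abs_self C₂, abs_nonneg C₁]
  · rw [(deriv_smoothTransition_of_notMem hu).1, (deriv_smoothTransition_of_notMem hu).2, abs_zero]
    constructor <;> positivity

/-- The harmonic function `Re z ^ m`, cut off near the origin. -/
noncomputable def powerTest (m R : ℝ) (w : ℂ) : ℝ :=
  (Real.exp (m * w.re) * smoothTransition (w.re + R)) * Real.cos (m * w.im)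

/-- The second order terms produced by the cutoff in `powerTest`. -/
noncomputable def cutoffLap (m u : ℝ) : ℝ :=
  2 * m * deriv smoothTransition u + deriv (deriv smoothTransition) u

theorem cutoffLap_of_notMem {m u : ℝ} (hu : u ∉ Icc (0 : ℝ) 1) : cutoffLap m u = 0 := by
  simp [cutoffLap, deriv_smoothTransition_of_notMem hu]

theorem continuous_cutoffLap (m : ℝ) : Continuous (cutoffLap m) :=
  (continuous_const.mul contDiff_deriv_smoothTransition.continuous).add
    (contDiff_deriv_smoothTransition.continuous_deriv le_rfl)

theorem exists_abs_cutoffLap_le (m : ℝ) : ∃ C > 0, ∀ u, |cutoffLap m u| ≤ C := by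
  obtain ⟨C, hC0, hC⟩ := exists_abs_deriv_smoothTransition_le
  refine ⟨2 * |m| * C + C, by positivity, fun u => (abs_add_le _ _).trans (add_le_add ?_ (hC u).2)⟩
  rw [abs_mul, abs_mul, abs_two]
  exact mul_le_mul_of_nonneg_left (hC u).1 (by positivity)

section PowerTest

variable (m R : ℝ)

theorem contDiff_powerTest : ContDiff ℝ 2 (powerTest m R) := by
  refine contDiff_mul_re_im (f := fun x => Real.exp (m * x) * smoothTransition (x + R))
    (g := fun y => Real.cos (m * y)) ?_ ?_
  · exact (Real.contDiff_exp.comp (by fun_prop)).mul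
      (contDiff_two_smoothTransition.comp (by fun_prop))
  · exact Real.contDiff_cos.comp (by fun_prop)

theorem re_of_mem_tsupport_powerTest : ∀ w ∈ tsupport (powerTest m R), -R ≤ w.re := by
  have : tsupport (powerTest m R) ⊆ {w | -R ≤ w.re} := by
    refine closure_minimal (fun w hw => ?_) (isClosed_le continuous_const Complex.continuous_re)
    by_contra h
    refine hw ?_
    have h' : w.re < -R := not_le.1 h
    simp [powerTest, Real.smoothTransition.zero_of_nonpos (x := w.re + R) (by linarith)]
  exact this

/-- `Re z ^ m` is harmonic, so its Laplacian after cutting off contains only derivatives of the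
cutoff. The factor `m + 2` comes from the operator `2 + ∂_x` acting on `e^{mx}`. -/
theorem testDensity_powerTest (Φ : ℂ → ℝ) (c : ℝ) (w : ℂ) :
    testDensity Φ c (powerTest m R) w =
      Φ w * (power m w).re * cutoffLap m (w.re + R) +
        c * (density w * (power m w).re *
          ((m + 2) * smoothTransition (w.re + R) + deriv smoothTransition (w.re + R))) := by
  have hexp : ∀ x, HasDerivAt (fun x => Real.exp (m * x)) (Real.exp (m * x) * m) x := fun x => by
    simpa using ((hasDerivAt_id x).const_mul m).exp
  have hη : ∀ x, HasDerivAt (fun x => smoothTransition (x + R)) (deriv smoothTransition (x + R)) x :=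
    fun x => (hasDerivAt_smoothTransition (x + R)).comp_add_const x R
  have hη' : ∀ x, HasDerivAt (fun x => deriv smoothTransition (x + R))
      (deriv (deriv smoothTransition) (x + R)) x :=
    fun x => (hasDerivAt_deriv_smoothTransition (x + R)).comp_add_const x R
  have f1 := fun x => (hexp x).mul (hη x)
  have f2 := fun x => (((hexp x).mul_const m).mul (hη x)).add ((hexp x).mul (hη' x))
  have g1 : ∀ y, HasDerivAt (fun y => Real.cos (m * y)) (-Real.sin (m * y) * m) y := fun y => by
    simpa using ((hasDerivAt_id y).const_mul m).cos
  have g2 : ∀ y, HasDerivAt (fun y => -Real.sin (m * y) * m) (-(Real.cos (m * y) * m) * m) y :=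
    fun y => by
      have : HasDerivAt (fun y => Real.sin (m * y)) (Real.cos (m * y) * m) y := by
        simpa using ((hasDerivAt_id y).const_mul m).sin
      exact this.neg.mul_const m
  have e1 : dx (powerTest m R) w = _ := congrFun (dx_mul_re_im f1 g1) w
  have e2 : lap (powerTest m R) w = _ := lap_mul_re_im f1 f2 g1 g2 w
  rw [testDensity, e1, e2, re_power, powerTest, cutoffLap]
  simp only [Pi.mul_apply]
  ring

theorem dy_powerTest_ofReal (x : ℝ) : dy (powerTest m R) x = 0 := by
  have hf : ∀ x, HasDerivAt (fun x => Real.exp (m * x) * smoothTransition (x + R)) _ x := fun x =>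
    (((hasDerivAt_id x).const_mul m).exp).mul
      ((hasDerivAt_smoothTransition (x + R)).comp_add_const x R)
  have g1 : ∀ y, HasDerivAt (fun y => Real.cos (m * y)) (-Real.sin (m * y) * m) y := fun y => by
    simpa using ((hasDerivAt_id y).const_mul m).cos
  have e : dy (powerTest m R) x = _ := congrFun (dy_mul_re_im hf g1) (x : ℂ)
  rw [e]; simp

end PowerTest

/-- The argument is `(2n+1) π / 2`. This is what singles out the exponents: `Re z ^ m` vanishes on
the killing side. -/
theorem cos_odd_mul {b : ℝ} (hb : 0 < b) (n : ℕ) :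
    Real.cos ((2 * n + 1) / (2 * b) * (Real.pi * b)) = 0 := by
  rw [Real.cos_eq_zero_iff]
  refine ⟨n, ?_⟩
  push_cast
  field_simp

theorem powerTest_top {b : ℝ} (hb : 0 < b) (n : ℕ) (R x : ℝ) :
    powerTest ((2 * n + 1) / (2 * b)) R (x + (Real.pi * b : ℝ) * Complex.I) = 0 := by
  have : ((x : ℂ) + (Real.pi * b : ℝ) * Complex.I).im = Real.pi * b := by simp
  rw [powerTest, this, cos_odd_mul hb, mul_zero]

/-! ### The homothety constant and the moments -/

namespace IsReflectingSolution

variable {b : ℝ} {Ω : Set ℂ} {γ : ℝ → ℂ} {Φ : ℂ → ℝ} {c : ℝ}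

theorem integral_testDensity_powerTest (h : IsReflectingSolution b Ω γ Φ c) (hb : 0 < b) (n : ℕ)
    (R : ℝ) : ∫ w in Ω, testDensity Φ c (powerTest ((2 * n + 1) / (2 * b)) R) w = 0 :=
  h.integral_testDensity hb (contDiff_powerTest _ R) (re_of_mem_tsupport_powerTest _ R)
    (powerTest_top hb n R) (dy_powerTest_ofReal _ R)

/-- The arc does move, because the flux out of the origin does not vanish. -/
theorem const_ne_zero (h : IsReflectingSolution b Ω γ Φ c) (hb : 0 < b) : c ≠ 0 := by
  -- With `c = 0` and `n = 0` the weak form reads `∫ Φ Re z^s cutoffLap = 0`. Far to the left `Φ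
  -- e^{sx}` is close to `-cos (s y)`, so the integral is close to `-2 s κ`, which is not zero.
  rintro rfl
  have hπb : 0 < Real.pi * b := mul_pos Real.pi_pos hb
  set s : ℝ := 1 / (2 * b) with hs
  have hs0 : 0 < s := by positivity
  have hse : ((2 * (0 : ℕ) + 1) / (2 * b) : ℝ) = s := by simp [hs]
  obtain ⟨x₁, hx₁⟩ := h.wedge.exists_halfStrip_subset hπb
  obtain ⟨C, hC0, hC⟩ := exists_abs_cutoffLap_le s
  set κ : ℝ := ∫ y in Ioo 0 (Real.pi * b), Real.cos (s * y) ^ 2 with hκ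
  have hκpos : 0 < κ := by
    have hcos : Continuous fun y : ℝ => Real.cos (s * y) ^ 2 := by fun_prop
    have e : κ = ∫ y in (0 : ℝ)..(Real.pi * b), Real.cos (s * y) ^ 2 := by
      rw [hκ, intervalIntegral.integral_of_le hπb.le, integral_Ioc_eq_integral_Ioo]
    rw [e]
    refine intervalIntegral.intervalIntegral_pos_of_pos_on
      (hcos.intervalIntegrable _ _) (fun y hy => ?_) hπb
    refine pow_pos (Real.cos_pos_of_mem_Ioo ⟨?_, ?_⟩) 2
    · have := mul_pos hs0 hy.1
      linarith [Real.pi_pos]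
    · have : s * y < s * (Real.pi * b) := mul_lt_mul_of_pos_left hy.2 hs0
      have e : s * (Real.pi * b) = Real.pi / 2 := by rw [hs]; field_simp
      linarith
  -- Chosen so that the total error is `s * κ`, half of the main term.
  set ε : ℝ := s * κ / (C * (Real.pi * b)) with hε
  have hε0 : 0 < ε := by positivity
  obtain ⟨x₂, hx₂⟩ := h.origin.exists_bound hε0
  -- The transition interval then ends at `1 - R = min x₁ x₂ - 1`, left of both thresholds.
  set R : ℝ := 2 - min x₁ x₂ with hR
  have hR1 : 1 - R < x₁ := by rw [hR]; linarith [min_le_left x₁ x₂]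
  have hR2 : 1 - R < x₂ := by rw [hR]; linarith [min_le_right x₁ x₂]
  set S : Set ℂ := Icc (-R) (1 - R) ×ℂ Ioo 0 (Real.pi * b) with hS
  have hSΩ : S ⊆ Ω := fun w hw => hx₁ w (hw.1.2.trans_lt hR1) hw.2.1 hw.2.2
  have hSm : MeasurableSet S := by
    rw [hS, reProdIm_eq_preimage]
    exact Complex.measurableEquivRealProd.measurable (measurableSet_Icc.prod measurableSet_Ioo)
  have hzero := h.integral_testDensity_powerTest hb 0 R
  have hint := h.wedge.integrableOn_testDensity h.continuousOn 0
    (contDiff_powerTest ((2 * (0 : ℕ) + 1) / (2 * b)) R) (re_of_mem_tsupport_powerTest _ R)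
  rw [hse] at hzero hint
  have hT : ∀ w, testDensity Φ 0 (powerTest s R) w =
      Φ w * (power s w).re * cutoffLap s (w.re + R) := fun w => by
    rw [testDensity_powerTest]; ring
  have hTS : ∫ w in S, testDensity Φ 0 (powerTest s R) w = 0 := by
    refine Eq.trans (Eq.symm ?_) hzero
    refine setIntegral_eq_of_subset_of_forall_sdiff_eq_zero h.wedge.isOpen.measurableSet hSΩ
      fun w hw => ?_
    rw [hT, cutoffLap_of_notMem, mul_zero]
    intro hu
    exact hw.2 ⟨⟨by linarith [hu.1], by linarith [hu.2]⟩, h.wedge.inside w hw.1⟩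
  have hi1 : IntegrableOn (fun x => cutoffLap s (x + R)) (Icc (-R) (1 - R)) :=
    ((continuous_cutoffLap s).comp (by fun_prop)).integrableOn_Icc
  have hi2 : IntegrableOn (fun y => Real.cos (s * y) ^ 2) (Ioo 0 (Real.pi * b)) :=
    (Continuous.integrableOn_Icc (by fun_prop)).mono_set Ioo_subset_Icc_self
  have hi3 := integrableOn_reProdIm_mul hi1 hi2
  have hval : ∫ w in S, cutoffLap s (w.re + R) * Real.cos (s * w.im) ^ 2 = 2 * s * κ := by
    rw [hS, setIntegral_reProdIm_mul _ _ (fun x => cutoffLap s (x + R))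
      (fun y => Real.cos (s * y) ^ 2), ← hκ]
    congr 1
    rw [integral_Icc_eq_integral_Ioc, ← intervalIntegral.integral_of_le (by linarith)]
    have hprim : ∀ x ∈ uIcc (-R) (1 - R), HasDerivAt
        (fun x => 2 * s * smoothTransition (x + R) + deriv smoothTransition (x + R))
        (cutoffLap s (x + R)) x := fun x _ =>
      (((hasDerivAt_smoothTransition (x + R)).comp_add_const x R).const_mul (2 * s)).add
        ((hasDerivAt_deriv_smoothTransition (x + R)).comp_add_const x R)
    rw [intervalIntegral.integral_eq_sub_of_hasDerivAt hprim
      (((continuous_cutoffLap s).comp (by fun_prop)).intervalIntegrable _ _)]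
    -- The derivative of the cutoff vanishes at both ends, so only its increment, equal to one,
    -- contributes to the integral.
    have z0 : deriv smoothTransition 0 = 0 := by
      have : IsLocalMin smoothTransition 0 := Eventually.of_forall fun z => by
        rw [Real.smoothTransition.zero]; exact Real.smoothTransition.nonneg z
      exact this.deriv_eq_zero
    have z1 : deriv smoothTransition 1 = 0 := by
      have : IsLocalMax smoothTransition 1 := Eventually.of_forall fun z => by
        rw [Real.smoothTransition.one]; exact Real.smoothTransition.le_one z
      exact this.deriv_eq_zero
    simp [z0, z1, Real.smoothTransition.zero, Real.smoothTransition.one]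
  have hsum : ∫ w in S, (testDensity Φ 0 (powerTest s R) w +
      cutoffLap s (w.re + R) * Real.cos (s * w.im) ^ 2) = 2 * s * κ := by
    rw [integral_add (hint.mono_set hSΩ) hi3, hTS, hval, zero_add]
  have hSvol : volume.real S = Real.pi * b := by
    have := setIntegral_reProdIm_mul (Icc (-R) (1 - R)) (Ioo 0 (Real.pi * b)) (fun _ => 1)
      (fun _ => 1)
    simp only [setIntegral_const, smul_eq_mul, mul_one] at this
    rw [hS, this, Real.volume_real_Icc_of_le (by linarith), Real.volume_real_Ioo_of_le hπb.le]
    ring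
  have hSfin : volume S ≠ ⊤ := by
    intro htop
    rw [Measure.real, htop, ENNReal.toReal_top] at hSvol
    exact hπb.ne hSvol
  have hle := norm_setIntegral_le_of_norm_le_const (μ := volume) (s := S) (C := ε * C)
    (f := fun w => testDensity Φ 0 (powerTest s R) w +
      cutoffLap s (w.re + R) * Real.cos (s * w.im) ^ 2) hSfin.lt_top (fun w hw => by
      have e : testDensity Φ 0 (powerTest s R) w +
          cutoffLap s (w.re + R) * Real.cos (s * w.im) ^ 2 =
          (Φ w * Real.exp (s * w.re) + Real.cos (s * w.im)) * cutoffLap s (w.re + R) *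
            Real.cos (s * w.im) := by
        rw [hT, re_power]; ring
      rw [e, norm_mul, norm_mul]
      have b1 := hx₂ w (hSΩ hw) (hw.1.2.trans hR2.le)
      exact mul_le_of_le_of_le_one_of_nonneg
        (mul_le_mul b1 (hC _) (norm_nonneg _) hε0.le) (Real.abs_cos_le_one _) (norm_nonneg _)
        (by positivity))
  rw [hsum, hSvol, Real.norm_eq_abs, abs_of_pos (by positivity)] at hle
  have : ε * C * (Real.pi * b) = s * κ := by rw [hε]; field_simp
  rw [this] at hle
  have : 0 < s * κ := by positivity
  linarith

end IsReflectingSolution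

namespace IsReflectingSolution

variable {b : ℝ} {Ω : Set ℂ} {γ : ℝ → ℂ} {Φ : ℂ → ℝ} {c : ℝ}

/-- The integrand is supported where `x` is within one unit of `-R`, and there `Φ Re z^m` is
`O(e^{(m-s)x})`. The factor with `|m - s|` accounts for the variation of the exponential over this
unit interval. -/
theorem abs_integral_cutoff_le (h : IsReflectingSolution b Ω γ Φ c) (hb : 0 < b) (m : ℝ) :
    ∃ C, ∀ᶠ R : ℝ in atTop, |∫ w in Ω, Φ w * (power m w).re * cutoffLap m (w.re + R)| ≤
      C * Real.exp (|m - 1 / (2 * b)|) * Real.exp (-(m - 1 / (2 * b)) * R) := by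
  have hπb : 0 < Real.pi * b := mul_pos Real.pi_pos hb
  set s : ℝ := 1 / (2 * b) with hs
  obtain ⟨C, hC0, hC⟩ := exists_abs_cutoffLap_le m
  obtain ⟨x₂, hx₂⟩ := h.origin.exists_bound one_pos
  refine ⟨2 * C * (4 * 1 * (Real.pi * b)), ?_⟩
  filter_upwards [eventually_ge_atTop (1 - x₂)] with R hR
  have hvol := volume_box_le (1 / 2 - R) (Real.pi * b / 2) (ρ := 1) hπb
  refine (abs_setIntegral_le_of_support h.wedge.isOpen.measurableSet
    (measurableSet_box (1 / 2 - R) (Real.pi * b / 2) 1 (Real.pi * b))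
    (B := 2 * C * Real.exp |m - s| * Real.exp (-(m - s) * R)) (by positivity)
    (hvol.trans_lt ENNReal.ofReal_lt_top).ne
    (ENNReal.toReal_le_of_le_ofReal (by positivity) hvol) ?_ ?_).trans (le_of_eq (by ring))
  · intro w hw hwbox
    rw [cutoffLap_of_notMem, mul_zero]
    intro hu
    have hi := h.wedge.inside w hw
    refine hwbox ⟨?_, ?_⟩ <;> rw [abs_lt] <;> constructor <;> linarith [hu.1, hu.2, hi.1, hi.2]
  · intro w hw _
    by_cases hu : w.re + R ∈ Icc (0 : ℝ) 1
    · have b1 := hx₂ w hw (by linarith [hu.2])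
      have b2 : |Φ w * Real.exp (s * w.re)| ≤ 2 := by
        have := abs_sub (Φ w * Real.exp (s * w.re) + Real.cos (s * w.im)) (Real.cos (s * w.im))
        rw [add_sub_cancel_right] at this
        linarith [Real.abs_cos_le_one (s * w.im)]
      have b3 : Real.exp ((m - s) * w.re) ≤ Real.exp |m - s| * Real.exp (-(m - s) * R) := by
        rw [← Real.exp_add, Real.exp_le_exp]
        have h1 : (m - s) * (w.re + R) ≤ |m - s| := by
          refine (le_abs_self _).trans ?_
          rw [abs_mul, abs_of_nonneg hu.1]
          exact mul_le_of_le_one_right (abs_nonneg _) hu.2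
        linarith
      have e : Φ w * (power m w).re * cutoffLap m (w.re + R) =
          (Φ w * Real.exp (s * w.re)) * cutoffLap m (w.re + R) * Real.exp ((m - s) * w.re) *
            Real.cos (m * w.im) := by
        have : Real.exp (m * w.re) = Real.exp (s * w.re) * Real.exp ((m - s) * w.re) := by
          rw [← Real.exp_add]; ring_nf
        rw [re_power, this]; ring
      rw [e, abs_mul]
      refine mul_le_of_le_of_le_one_of_nonneg ?_ (Real.abs_cos_le_one _) (abs_nonneg _)
        (by positivity)
      rw [abs_mul, abs_mul, Real.abs_exp, mul_assoc (2 * C)]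
      exact mul_le_mul (mul_le_mul b2 (hC _) (abs_nonneg _) zero_le_two) b3 (Real.exp_pos _).le
        (by positivity)
    · rw [cutoffLap_of_notMem hu, mul_zero, abs_zero]; positivity

/-- Since `n ≥ 1` makes `m` larger than `1 / (2b)`, the term with `Φ` in the weak form decays as the
cutoff moves to the origin. The other term tends to `c (m + 2)` times the desired integral, and `c`
and `m + 2` are nonzero. -/
theorem integral_density_mul_re_power (h : IsReflectingSolution b Ω γ Φ c) (hb : 0 < b) {n : ℕ}
    (hn : 1 ≤ n) : ∫ w in Ω, density w * (power ((2 * n + 1) / (2 * b)) w).re = 0 := by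
  set m : ℝ := (2 * n + 1) / (2 * b) with hm
  set s : ℝ := 1 / (2 * b) with hs
  have hn' : (1 : ℝ) ≤ n := by exact_mod_cast hn
  have hm0 : 0 < m := by positivity
  have hms : 0 < m - s := by
    rw [hm, hs, ← sub_div]
    exact div_pos (by linarith) (by positivity)
  obtain ⟨C₁, hC₁0, hC₁⟩ := exists_abs_deriv_smoothTransition_le
  obtain ⟨C, hC⟩ := h.abs_integral_cutoff_le hb m
  have hmeas := h.wedge.isOpen.measurableSet
  have hH : IntegrableOn (fun w => density w * (power m w).re) Ω := by
    change Integrable _ (volume.restrict Ω)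
    simpa using (h.wedge.integrableOn_density_mul_power hm0).re
  have hHc : Continuous fun w => density w * (power m w).re :=
    (contDiff_density (n := 0)).continuous.mul (Complex.continuous_re.comp (continuous_power m))
  set G : ℝ → ℂ → ℝ := fun R w => c * (density w * (power m w).re *
    ((m + 2) * smoothTransition (w.re + R) + deriv smoothTransition (w.re + R))) with hG
  have hGc : ∀ R, Continuous (G R) := fun R => by
    have h1 : Continuous fun w : ℂ => smoothTransition (w.re + R) :=
      Real.smoothTransition.continuous.comp (by fun_prop)
    have h2 : Continuous fun w : ℂ => deriv smoothTransition (w.re + R) :=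
      contDiff_deriv_smoothTransition.continuous.comp (by fun_prop)
    exact continuous_const.mul (hHc.mul ((continuous_const.mul h1).add h2))
  have hGb : ∀ R w, ‖G R w‖ ≤ |c| * (|density w * (power m w).re| * ((m + 2) + C₁)) := by
    intro R w
    rw [hG, Real.norm_eq_abs, abs_mul, abs_mul]
    gcongr
    refine (abs_add_le _ _).trans (add_le_add ?_ (hC₁ _).1)
    rw [abs_mul, abs_of_pos (by positivity : 0 < m + 2),
      abs_of_nonneg (Real.smoothTransition.nonneg _)]
    exact mul_le_of_le_one_right (by positivity) (Real.smoothTransition.le_one _)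
  have hGbi : IntegrableOn (fun w => |c| * (|density w * (power m w).re| * ((m + 2) + C₁))) Ω :=
    (hH.abs.mul_const _).const_mul _
  have hGi : ∀ R, IntegrableOn (G R) Ω := fun R =>
    Integrable.mono' hGbi (hGc R).aestronglyMeasurable (Eventually.of_forall (hGb R))
  have hlim1 : Tendsto (fun k : ℕ => ∫ w in Ω, G k w) atTop
      (𝓝 (∫ w in Ω, c * (density w * (power m w).re * (m + 2)))) := by
    refine tendsto_integral_of_dominated_convergence _ (fun k => (hGc k).aestronglyMeasurable) hGbi
      (fun k => Eventually.of_forall (hGb k)) (Eventually.of_forall fun w => ?_)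
    refine tendsto_const_nhds.congr' ?_
    filter_upwards [tendsto_natCast_atTop_atTop.eventually_gt_atTop (1 - w.re)] with k hk
    have h1 : 1 < w.re + k := by linarith
    simp only [hG]
    rw [Real.smoothTransition.one_of_one_le h1.le,
      (deriv_smoothTransition_of_notMem (fun hu => absurd hu.2 (not_le.2 h1))).1]
    ring
  have hlim2 : Tendsto (fun k : ℕ => ∫ w in Ω, G k w) atTop (𝓝 0) := by
    have hexp : Tendsto (fun k : ℕ => C * Real.exp |m - s| * Real.exp (-(m - s) * k)) atTop
        (𝓝 0) := by
      rw [← mul_zero (C * Real.exp |m - s|)]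
      refine Tendsto.const_mul _ (Real.tendsto_exp_atBot.comp ?_)
      exact Tendsto.const_mul_atTop_of_neg (by linarith) tendsto_natCast_atTop_atTop
    refine squeeze_zero_norm' ?_ hexp
    filter_upwards [tendsto_natCast_atTop_atTop.eventually hC] with k hk
    refine le_trans (le_of_eq ?_) hk
    have hzero := h.integral_testDensity_powerTest hb n (k : ℝ)
    rw [← hm] at hzero
    have hint := h.wedge.integrableOn_testDensity h.continuousOn c (contDiff_powerTest m k)
      (re_of_mem_tsupport_powerTest _ _)
    have e : (fun w => Φ w * (power m w).re * cutoffLap m (w.re + k)) =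
        fun w => testDensity Φ c (powerTest m k) w - G k w := by
      ext w; rw [testDensity_powerTest]; simp [hG]
    rw [e, integral_sub hint (hGi k), hzero, zero_sub, abs_neg, Real.norm_eq_abs]
  have hfin := tendsto_nhds_unique hlim1 hlim2
  rw [integral_const_mul, integral_mul_const] at hfin
  have hc := h.const_ne_zero hb
  rcases mul_eq_zero.1 hfin with h1 | h1
  · exact absurd h1 hc
  · exact (mul_eq_zero.1 h1).resolve_right (by positivity)

end IsReflectingSolution

theorem SolvesKillingReflecting.integral_re_power {b : ℝ} (hb : 0 < b) {Ω : Set ℂ}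
    (h : SolvesKillingReflecting b Ω) {n : ℕ} (hn : 1 ≤ n) :
    IntegrableOn (fun w => (power ((2 * n + 1) / (2 * b)) w).re) Ω area ∧
      ∫ w in Ω, (power ((2 * n + 1) / (2 * b)) w).re ∂area = 0 := by
  obtain ⟨γ, Φ, c, h⟩ := h.exists_data
  have hm0 : (0 : ℝ) < (2 * n + 1) / (2 * b) := by positivity
  refine ⟨(h.wedge.integrableOn_power hm0).re, ?_⟩
  rw [setIntegral_area h.wedge.isOpen.measurableSet]
  exact h.integral_density_mul_re_power hb hn

/-! ### Arcs symmetric under conjugation -/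

open ComplexConjugate

namespace IsCrossArc

variable {α β : ℝ} {γ : ℝ → ℂ}

theorem inside_of_im (h : IsCrossArc α β γ) {t : ℝ} (ht : t ∈ Icc (0 : ℝ) 1)
    (h1 : (γ t).im ≠ α) (h2 : (γ t).im ≠ β) : t ∈ Ioo (0 : ℝ) 1 := by
  refine ⟨lt_of_le_of_ne ht.1 ?_, lt_of_le_of_ne ht.2 ?_⟩
  · rintro rfl; exact h1 h.start_mem
  · rintro rfl; exact h2 h.end_mem

/-- An injective continuous arc on a compact interval is an embedding, so a path in its image has a
continuous parameter. Projection to `[0, 1]` extends this parameter to the line. -/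
theorem exists_continuous_lift (h : IsCrossArc α β γ) {δ : ℝ → ℂ} (hδ : ContinuousOn δ (Icc 0 1))
    (hmem : ∀ t ∈ Icc (0 : ℝ) 1, δ t ∈ γ '' Icc 0 1) :
    ∃ σ : ℝ → ℝ, Continuous σ ∧ (∀ t, σ t ∈ Icc (0 : ℝ) 1) ∧
      ∀ t ∈ Icc (0 : ℝ) 1, γ (σ t) = δ t := by
  have hemb : IsClosedEmbedding (fun t : Icc (0 : ℝ) 1 => γ t) :=
    h.continuousOn.domRestrict.isClosedEmbedding fun s t hst => Subtype.ext (h.injOn s.2 t.2 hst)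
  choose! τ hτ hτδ using hmem
  let σ₀ : Icc (0 : ℝ) 1 → Icc (0 : ℝ) 1 := fun t => ⟨τ t, hτ t t.2⟩
  have hσ₀ : Continuous σ₀ := by
    rw [hemb.isEmbedding.continuous_iff]
    have : (fun t : Icc (0 : ℝ) 1 => γ t) ∘ σ₀ = fun t : Icc (0 : ℝ) 1 => δ t :=
      funext fun t => hτδ t t.2
    rw [this]
    exact hδ.domRestrict
  refine ⟨fun t => σ₀ (projIcc 0 1 zero_le_one t),
    continuous_subtype_val.comp (hσ₀.comp continuous_projIcc), fun t => (σ₀ _).2, fun t ht => ?_⟩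
  change γ (σ₀ (projIcc 0 1 zero_le_one t)) = δ t
  rw [projIcc_of_mem zero_le_one ht]
  exact hτδ t ht

end IsCrossArc

theorem conj_mem_closure {Ω : Set ℂ} (hsym : ∀ w ∈ Ω, conj w ∈ Ω) {w : ℂ} (hw : w ∈ closure Ω) :
    conj w ∈ closure Ω :=
  map_mem_closure Complex.continuous_conj hw hsym

theorem conj_mem_frontier {Ω : Set ℂ} (hΩ : IsOpen Ω) (hsym : ∀ w ∈ Ω, conj w ∈ Ω) {w : ℂ}
    (hw : w ∈ frontier Ω) : conj w ∈ frontier Ω := by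
  rw [hΩ.frontier_eq] at hw ⊢
  refine ⟨conj_mem_closure hsym hw.1, fun h => hw.2 ?_⟩
  simpa using hsym _ h

namespace IsWedgeRegion

variable {β : ℝ} {Ω : Set ℂ} {γ : ℝ → ℂ}

theorem arc_mem_frontier {α : ℝ} (h : IsWedgeRegion α β Ω γ) {t : ℝ} (ht : t ∈ Icc (0 : ℝ) 1) :
    γ t ∈ frontier Ω := by
  rw [h.frontier_eq]
  exact Or.inl (Or.inl ⟨t, ht, rfl⟩)

/-- The conjugate of each endpoint is a frontier point on the opposite side, hence no farther from
the origin than the endpoint there. The two inequalities together give equality. -/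
theorem conj_endpoint (h : IsWedgeRegion (-β) β Ω γ) (hβ : 0 < β)
    (hsym : ∀ w ∈ Ω, conj w ∈ Ω) : conj (γ 0) = γ 1 := by
  have hs := h.arc.start_mem
  have he := h.arc.end_mem
  have h0 := conj_mem_frontier h.isOpen hsym (h.arc_mem_frontier (t := 0) (by simp))
  have h1 := conj_mem_frontier h.isOpen hsym (h.arc_mem_frontier (t := 1) (by simp))
  have hle : (γ 0).re ≤ (γ 1).re := by
    rw [h.frontier_eq] at h0
    rcases h0 with (⟨t, ht, hte⟩ | ⟨hi, -⟩) | ⟨-, hr⟩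
    · have him : (γ t).im = β := by rw [hte, Complex.conj_im, hs, neg_neg]
      rcases ht.2.eq_or_lt with rfl | ht1
      · rw [hte, Complex.conj_re]
      · rcases ht.1.eq_or_lt with rfl | ht0
        · rw [hs] at him; linarith
        · exact absurd him (h.arc.inside t ⟨ht0, ht1⟩).2.ne
    · rw [Complex.conj_im, hs] at hi; linarith
    · simpa using hr
  have hge : (γ 1).re ≤ (γ 0).re := by
    rw [h.frontier_eq] at h1
    rcases h1 with (⟨t, ht, hte⟩ | ⟨-, hr⟩) | ⟨hi, -⟩
    · have him : (γ t).im = -β := by rw [hte, Complex.conj_im, he]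
      rcases ht.1.eq_or_lt with rfl | ht0
      · rw [hte, Complex.conj_re]
      · rcases ht.2.eq_or_lt with rfl | ht1
        · rw [he] at him; linarith
        · exact absurd him (h.arc.inside t ⟨ht0, ht1⟩).1.ne'
    · simpa using hr
    · rw [Complex.conj_im, he] at hi; linarith
  apply Complex.ext
  · rw [Complex.conj_re]; exact le_antisymm hle hge
  · rw [Complex.conj_im, hs, he, neg_neg]

/-- Conjugation preserves the arc and so acts on its parameter by a continuous injective `σ`, which
is strictly monotone. Since `σ 0 = 1`, it is decreasing. -/
theorem exists_conj_param (h : IsWedgeRegion (-β) β Ω γ) (hβ : 0 < β)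
    (hsym : ∀ w ∈ Ω, conj w ∈ Ω) :
    ∃ σ : ℝ → ℝ, Continuous σ ∧ (∀ t, σ t ∈ Icc (0 : ℝ) 1) ∧
      (∀ t ∈ Icc (0 : ℝ) 1, γ (σ t) = conj (γ t)) ∧ StrictAntiOn σ (Icc 0 1) := by
  have hend := h.conj_endpoint hβ hsym
  have hmem : ∀ t ∈ Icc (0 : ℝ) 1, conj (γ t) ∈ γ '' Icc 0 1 := by
    intro t ht
    rcases ht.1.eq_or_lt with rfl | ht0
    · exact ⟨1, by simp, hend.symm⟩
    · rcases ht.2.eq_or_lt with rfl | ht1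
      · exact ⟨0, by simp, by rw [← hend, Complex.conj_conj]⟩
      · have hi := h.arc.inside t ⟨ht0, ht1⟩
        have hf := conj_mem_frontier h.isOpen hsym (h.arc_mem_frontier ht)
        rw [h.frontier_eq] at hf
        rcases hf with (hf | ⟨h1, -⟩) | ⟨h1, -⟩
        · exact hf
        · rw [Complex.conj_im] at h1; linarith [hi.2]
        · rw [Complex.conj_im] at h1; linarith [hi.1]
  obtain ⟨σ, hσc, hσm, hσ⟩ := h.arc.exists_continuous_lift
    (Complex.continuous_conj.comp_continuousOn h.arc.continuousOn) hmem
  have h0m : (0 : ℝ) ∈ Icc (0 : ℝ) 1 := by simp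
  have h1m : (1 : ℝ) ∈ Icc (0 : ℝ) 1 := by simp
  have hσ0 : σ 0 = 1 := h.arc.injOn (hσm 0) h1m ((hσ 0 h0m).trans hend)
  have hinj : InjOn σ (Icc 0 1) := by
    intro s hs t ht hst
    refine h.arc.injOn hs ht ?_
    have := hσ s hs
    rw [hst] at this
    exact (starRingEnd ℂ).injective ((this.symm.trans (hσ t ht)))
  refine ⟨σ, hσc, hσm, hσ, ?_⟩
  rcases hσc.continuousOn.strictMonoOn_of_injOn_Icc' zero_le_one hinj with hm | ha
  · exfalso
    have := hm h0m h1m zero_lt_one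
    rw [hσ0] at this
    exact absurd (hσm 1).2 (not_le.2 this)
  · exact ha

/-- A symmetric arc meets the axis of symmetry once, passing from the lower to the upper half. -/
theorem exists_crossing (h : IsWedgeRegion (-β) β Ω γ) (hβ : 0 < β)
    (hsym : ∀ w ∈ Ω, conj w ∈ Ω) :
    ∃ t₀ ∈ Ioo (0 : ℝ) 1, (γ t₀).im = 0 ∧ (∀ t ∈ Ioc t₀ 1, 0 < (γ t).im) ∧
      ∀ t ∈ Ico 0 t₀, (γ t).im < 0 := by
  obtain ⟨σ, hσc, hσm, hσ, hanti⟩ := h.exists_conj_param hβ hsym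
  have him : ContinuousOn (fun t => (γ t).im) (Icc 0 1) :=
    Complex.continuous_im.comp_continuousOn h.arc.continuousOn
  have hs := h.arc.start_mem
  have he := h.arc.end_mem
  obtain ⟨t₀, ht₀, hz⟩ := intermediate_value_Icc zero_le_one him
    (show (0 : ℝ) ∈ Icc (γ 0).im (γ 1).im by rw [hs, he]; constructor <;> linarith)
  simp only at hz
  -- Real points of the arc correspond to fixed points of `σ`, and a strictly decreasing map has at
  -- most one.
  have hfix : ∀ t ∈ Icc (0 : ℝ) 1, (γ t).im = 0 → σ t = t := fun t ht h0 =>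
    h.arc.injOn (hσm t) ht ((hσ t ht).trans (Complex.conj_eq_iff_im.2 h0))
  have ht₀' : t₀ ∈ Ioo (0 : ℝ) 1 :=
    h.arc.inside_of_im ht₀ (by rw [hz]; linarith) (by rw [hz]; linarith)
  have huniq : ∀ t ∈ Icc (0 : ℝ) 1, (γ t).im = 0 → t = t₀ := by
    intro t ht h0
    have e1 := hfix t ht h0
    have e2 := hfix t₀ ht₀ hz
    rcases lt_trichotomy t t₀ with hlt | heq | hgt
    · have := hanti ht ht₀ hlt; linarith
    · exact heq
    · have := hanti ht₀ ht hgt; linarith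
  have hpos : ∀ t ∈ Ioc t₀ 1, 0 < (γ t).im := by
    intro t ht
    by_contra hneg
    obtain ⟨u, hu, hu0⟩ := intermediate_value_Icc ht.2
      (him.mono (Icc_subset_Icc (ht₀'.1.trans ht.1).le le_rfl))
      (show (0 : ℝ) ∈ Icc (γ t).im (γ 1).im from ⟨not_lt.1 hneg, by rw [he]; exact hβ.le⟩)
    have := huniq u ⟨(ht₀'.1.trans ht.1).le.trans hu.1, hu.2⟩ hu0
    linarith [ht.1, hu.1]
  refine ⟨t₀, ht₀', hz, hpos, fun t ht => ?_⟩
  have htI : t ∈ Icc (0 : ℝ) 1 := ⟨ht.1, ht.2.le.trans ht₀.2⟩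
  have h1 := hanti htI ht₀ ht.2
  rw [hfix t₀ ht₀ hz] at h1
  have h2 := hpos (σ t) ⟨h1, (hσm t).2⟩
  rw [hσ t htI, Complex.conj_im] at h2
  linarith

/-- The tangent lines of a symmetric arc at symmetric points are symmetric. -/
theorem exists_conj_deriv (h : IsWedgeRegion (-β) β Ω γ) (hβ : 0 < β)
    (hsym : ∀ w ∈ Ω, conj w ∈ Ω) {t : ℝ} (ht : t ∈ Ioo (0 : ℝ) 1) :
    ∃ u ∈ Ioo (0 : ℝ) 1, γ u = conj (γ t) ∧ ∃ r : ℝ, conj (deriv γ t) = r • deriv γ u := by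
  obtain ⟨σ, hσc, hσm, hσ, hanti⟩ := h.exists_conj_param hβ hsym
  have htI := Ioo_subset_Icc_self ht
  have hi := h.arc.inside t ht
  have hu : σ t ∈ Ioo (0 : ℝ) 1 := by
    refine h.arc.inside_of_im (hσm t) ?_ ?_ <;> rw [hσ t htI, Complex.conj_im]
    · linarith [hi.2]
    · linarith [hi.1]
  have hda : ∀ s ∈ Ioo (0 : ℝ) 1, ContDiffAt ℝ 1 γ s := fun s hs =>
    h.arc.contDiffOn.contDiffAt (Ioo_mem_nhds hs.1 hs.2)
  have hd : ∀ s ∈ Ioo (0 : ℝ) 1, HasDerivAt γ (deriv γ s) s := fun s hs =>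
    ((hda s hs).differentiableAt (by norm_num)).hasDerivAt
  set u := σ t with hudef
  refine ⟨u, hu, hσ t htI, ?_⟩
  set d := deriv γ u with hddef
  have hd0 : d ≠ 0 := h.arc.deriv_ne_zero u hu
  -- Projecting to the tangent line makes the arc locally invertible. This exhibits `σ` as a
  -- composition of differentiable maps, and the chain rule applies to `γ ∘ σ`.
  set l : ℂ →L[ℝ] ℝ := innerSL ℝ d with hl
  have hf : ContDiffAt ℝ 1 (fun s => l (γ s)) u := l.contDiff.contDiffAt.comp u (hda u hu)
  have hf' : deriv (fun s => l (γ s)) u ≠ 0 := by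
    have : HasDerivAt (fun s => l (γ s)) (l d) u := l.hasFDerivAt.comp_hasDerivAt u (hd u hu)
    rw [this.deriv, hl, innerSL_apply_apply]
    exact inner_self_ne_zero.2 hd0
  obtain ⟨s, hs, -, -, hs2⟩ := exists_local_inverse hf hf'
  have hev : σ =ᶠ[𝓝 t] fun τ => s (l (conj (γ τ))) := by
    filter_upwards [hσc.continuousAt.eventually hs2, Icc_mem_nhds ht.1 ht.2] with τ h1 h2
    rw [← hσ τ h2, h1]
  have hcd : HasDerivAt (fun τ => conj (γ τ)) (conj (deriv γ t)) t :=
    Complex.conjCLE.hasFDerivAt.comp_hasDerivAt t (hd t ht)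
  have hσd : DifferentiableAt ℝ σ t := by
    refine DifferentiableAt.congr_of_eventuallyEq ?_ hev
    have h1 : DifferentiableAt ℝ (fun τ => l (conj (γ τ))) t :=
      l.differentiableAt.comp t hcd.differentiableAt
    refine DifferentiableAt.comp t ?_ h1
    have : l (conj (γ t)) = l (γ u) := by rw [hudef, hσ t htI]
    rw [this]
    exact hs.differentiableAt (by norm_num)
  have h2 : HasDerivAt (fun τ => γ (σ τ)) (deriv σ t • d) t :=
    (hd u hu).scomp t hσd.hasDerivAt
  have h3 : (fun τ => γ (σ τ)) =ᶠ[𝓝 t] fun τ => conj (γ τ) := by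
    filter_upwards [Icc_mem_nhds ht.1 ht.2] with τ hτ using hσ τ hτ
  exact ⟨deriv σ t, (hcd.congr_of_eventuallyEq h3).unique h2⟩

end IsWedgeRegion

/-! ### The upper half of a symmetric region -/

theorem isOpen_upperHalf {Ω : Set ℂ} (hΩ : IsOpen Ω) : IsOpen (upperHalf Ω) :=
  hΩ.inter (isOpen_lt continuous_const Complex.continuous_im)

/-- Join two points by a path in `Ω` and fold it by `y ↦ |y|`, which stays in `Ω` by symmetry. The
folded path may touch the axis; raising it slightly between its ends makes it strictly positive, and
compactness keeps it inside the open set. -/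
theorem isPreconnected_upperHalf {Ω : Set ℂ} (hΩ : IsOpen Ω) (hc : IsConnected Ω)
    (hsym : ∀ w ∈ Ω, conj w ∈ Ω) : IsPreconnected (upperHalf Ω) := by
  have hpc : IsPathConnected Ω := hΩ.isConnected_iff_isPathConnected.1 hc
  set fold : ℂ → ℂ := fun w => ⟨w.re, |w.im|⟩ with hfold
  have hfc : Continuous fold := by
    have : fold = fun w => (w.re : ℂ) + (|w.im| : ℝ) * Complex.I := by
      ext w; apply Complex.ext <;> simp [hfold]
    rw [this]; fun_prop
  have hfΩ : ∀ w ∈ Ω, fold w ∈ Ω := by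
    intro w hw
    rcases le_total 0 w.im with h | h
    · have : fold w = w := Complex.ext rfl (abs_of_nonneg h)
      rwa [this]
    · have : fold w = conj w := Complex.ext rfl (by simp [hfold, abs_of_nonpos h])
      rw [this]; exact hsym w hw
  refine isPreconnected_of_forall_pair fun a ha z hz => ?_
  obtain ⟨p, hp⟩ := hpc.joinedIn a ha.1 z hz.1
  have hK : IsCompact (range fun τ => fold (p τ)) := isCompact_range (hfc.comp p.continuous)
  obtain ⟨ε, hε, hεΩ⟩ := hK.exists_thickening_subset_open hΩ
    (range_subset_iff.2 fun τ => hfΩ _ (hp τ))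
  set q : unitInterval → ℂ := fun τ =>
    fold (p τ) + ((ε / 2 * (τ * (1 - τ)) : ℝ) : ℂ) * Complex.I with hq
  have hqc : Continuous q := by
    have h1 : Continuous fun τ : unitInterval => fold (p τ) := hfc.comp p.continuous
    fun_prop
  have hqim : ∀ τ, (q τ).im = |(p τ).im| + ε / 2 * (τ * (1 - τ)) := fun τ => by
    simp [hq, hfold]
  have hfix : ∀ w : ℂ, 0 < w.im → fold w = w := fun w hw => Complex.ext rfl (abs_of_pos hw)
  refine ⟨range q, ?_, ⟨0, ?_⟩, ⟨1, ?_⟩, isPreconnected_range hqc⟩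
  · rintro _ ⟨τ, rfl⟩
    have h0 := τ.2.1
    have h1 := τ.2.2
    constructor
    · refine hεΩ (Metric.mem_thickening_iff.2 ⟨fold (p τ), ⟨τ, rfl⟩, ?_⟩)
      have hle : (τ : ℝ) * (1 - τ) ≤ 1 := by nlinarith
      have hge : 0 ≤ (τ : ℝ) * (1 - τ) := mul_nonneg h0 (by linarith)
      rw [dist_eq_norm, hq, add_sub_cancel_left, norm_mul, Complex.norm_I, mul_one,
        Complex.norm_real, Real.norm_eq_abs, abs_of_nonneg (by positivity)]
      nlinarith
    · rw [hqim]
      rcases h0.eq_or_lt with h | h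
      · have : τ = 0 := Subtype.ext h.symm
        rw [this, p.source]
        simpa using ha.2.ne'
      · rcases h1.eq_or_lt with h' | h'
        · have : τ = 1 := Subtype.ext h'
          rw [this, p.target]
          simpa using hz.2.ne'
        · have : 0 < (τ : ℝ) * (1 - τ) := mul_pos h (by linarith)
          positivity
  · simp [hq, hfix a ha.2]
  · simp [hq, hfix z hz.2]

theorem mem_closure_upperHalf_of_im_pos {Ω : Set ℂ} {w : ℂ} (hw : w ∈ closure Ω) (h : 0 < w.im) :
    w ∈ closure (upperHalf Ω) := by
  have ho : IsOpen {w : ℂ | 0 < w.im} := isOpen_lt continuous_const Complex.continuous_im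
  rw [mem_closure_iff] at hw ⊢
  intro U hU hwU
  obtain ⟨z, hz1, hz2⟩ := hw _ (hU.inter ho) ⟨hwU, h⟩
  exact ⟨z, hz1.1, hz2, hz1.2⟩

theorem mem_closure_upperHalf_of_real {Ω : Set ℂ} (hΩ : IsOpen Ω) {x : ℝ} (hx : (x : ℂ) ∈ Ω) :
    (x : ℂ) ∈ closure (upperHalf Ω) := by
  have hc : Tendsto (fun t : ℝ => (x : ℂ) + t * Complex.I) (𝓝[>] 0) (𝓝 x) := by
    have : Continuous fun t : ℝ => (x : ℂ) + t * Complex.I := by fun_prop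
    have h0 := this.tendsto 0
    simp only [Complex.ofReal_zero, zero_mul, add_zero] at h0
    exact h0.mono_left nhdsWithin_le_nhds
  refine mem_closure_of_tendsto hc ?_
  filter_upwards [hc.eventually (hΩ.mem_nhds hx), self_mem_nhdsWithin] with t h1 h2
  exact ⟨h1, by simpa using h2⟩

namespace IsWedgeRegion

variable {β : ℝ} {Ω : Set ℂ} {γ : ℝ → ℂ} {t₀ : ℝ}

/-- The real points of a symmetric region. -/
theorem ofReal_mem_iff (h : IsWedgeRegion (-β) β Ω γ) (hβ : 0 < β)
    (ht₀ : t₀ ∈ Ioo (0 : ℝ) 1) (h0 : (γ t₀).im = 0) (hpos : ∀ t ∈ Ioc t₀ 1, 0 < (γ t).im)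
    (hneg : ∀ t ∈ Ico 0 t₀, (γ t).im < 0) (x : ℝ) :
    (x < (γ t₀).re → (x : ℂ) ∈ Ω) ∧ ((γ t₀).re < x → (x : ℂ) ∉ closure Ω) := by
  have hfr : ∀ w ∈ frontier Ω, w.im = 0 → w = γ t₀ := by
    intro w hw him
    rw [h.frontier_eq] at hw
    rcases hw with (⟨t, ht, rfl⟩ | ⟨h1, -⟩) | ⟨h1, -⟩
    · rcases lt_trichotomy t t₀ with hlt | rfl | hgt
      · exact absurd him (hneg t ⟨ht.1, hlt⟩).ne
      · rfl
      · exact absurd him (hpos t ⟨hgt, ht.2⟩).ne'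
    · rw [him] at h1; linarith
    · rw [him] at h1; linarith
  -- The crossing point is the only real frontier point, so a segment or ray of the axis avoiding it
  -- lies in `Ω` as soon as it meets `Ω`.
  have key : ∀ S : Set ℂ, Convex ℝ S → (∀ w ∈ S, w.im = 0 ∧ w.re ≠ (γ t₀).re) →
      (S ∩ Ω).Nonempty → S ⊆ Ω := by
    intro S hS hS0 hne
    refine hS.isPreconnected.subset_of_closure_inter_subset h.isOpen hne ?_
    rintro w ⟨h1, h2⟩
    by_contra hw
    have := hfr w (by rw [h.isOpen.frontier_eq]; exact ⟨h1, hw⟩) (hS0 w h2).1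
    exact (hS0 w h2).2 (by rw [this])
  obtain ⟨x₁, hx₁⟩ := h.exists_halfStrip_subset (by linarith)
  obtain ⟨X, hX⟩ := h.closure_subset
  have hline : Convex ℝ {w : ℂ | w.im = 0} := convex_hyperplane Complex.imLm.isLinear 0
  constructor
  · intro hx
    refine key ({w | w.im = 0} ∩ {w | w.re < (γ t₀).re})
      (hline.inter (convex_halfSpace_re_lt _)) (fun w hw => ⟨hw.1, hw.2.ne⟩) ?_ ⟨by simp, by simpa⟩
    refine ⟨((min x₁ (γ t₀).re - 1 : ℝ) : ℂ), ⟨by simp, ?_⟩, hx₁ _ ?_ ?_ ?_⟩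
    · simp only [mem_ofPred_eq, Complex.ofReal_re]
      linarith [min_le_right x₁ (γ t₀).re]
    · rw [Complex.ofReal_re]
      linarith [min_le_left x₁ (γ t₀).re]
    · rw [Complex.ofReal_im]; linarith
    · rw [Complex.ofReal_im]; exact hβ
  · intro hx hmem
    have hxΩ : (x : ℂ) ∈ Ω := by
      by_contra hn
      have := hfr x (by rw [h.isOpen.frontier_eq]; exact ⟨hmem, hn⟩) (by simp)
      rw [← this] at hx
      simp at hx
    -- Otherwise the whole ray beyond the crossing point would belong to `Ω`, against boundedness.
    have hsub := key ({w | w.im = 0} ∩ {w | (γ t₀).re < w.re})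
      (hline.inter (convex_halfSpace_re_gt _)) (fun w hw => ⟨hw.1, hw.2.ne'⟩)
      ⟨x, ⟨by simp, by simpa⟩, hxΩ⟩
    have hbig : ((max X x + 1 : ℝ) : ℂ) ∈ Ω := by
      refine hsub ⟨by simp, ?_⟩
      simp only [mem_ofPred_eq, Complex.ofReal_re]
      linarith [le_max_right X x]
    have := (hX _ (subset_closure hbig)).1
    rw [Complex.ofReal_re] at this
    linarith [le_max_left X x]

theorem closure_upperHalf_subset : closure (upperHalf Ω) ⊆ closure Ω :=
  closure_mono fun _ hw => hw.1

/-- The new arc is the part of the old one after the crossing, rescaled to `[0, 1]`. For the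
frontier, points of positive height are frontier points of the original region, and those of height
zero are located by `ofReal_mem_iff`. -/
theorem upperHalf_wedge (h : IsWedgeRegion (-β) β Ω γ) (hβ : 0 < β)
    (hsym : ∀ w ∈ Ω, conj w ∈ Ω)
    (ht₀ : t₀ ∈ Ioo (0 : ℝ) 1) (h0 : (γ t₀).im = 0) (hpos : ∀ t ∈ Ioc t₀ 1, 0 < (γ t).im)
    (hneg : ∀ t ∈ Ico 0 t₀, (γ t).im < 0) :
    IsWedgeRegion 0 β (upperHalf Ω) (fun τ => γ (t₀ + (1 - t₀) * τ)) := by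
  have hreal := h.ofReal_mem_iff hβ ht₀ h0 hpos hneg
  have hl : 0 < 1 - t₀ := by linarith [ht₀.2]
  have hmapI : ∀ τ ∈ Icc (0 : ℝ) 1, t₀ + (1 - t₀) * τ ∈ Icc t₀ 1 := fun τ hτ =>
    ⟨by nlinarith [hτ.1], by nlinarith [hτ.2]⟩
  have hmapI' : ∀ τ ∈ Icc (0 : ℝ) 1, t₀ + (1 - t₀) * τ ∈ Icc (0 : ℝ) 1 := fun τ hτ =>
    ⟨ht₀.1.le.trans (hmapI τ hτ).1, (hmapI τ hτ).2⟩
  have hmapO : ∀ τ ∈ Ioo (0 : ℝ) 1, t₀ + (1 - t₀) * τ ∈ Ioo t₀ 1 := fun τ hτ =>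
    ⟨by nlinarith [hτ.1], by nlinarith [hτ.2]⟩
  have hmapO' : ∀ τ ∈ Ioo (0 : ℝ) 1, t₀ + (1 - t₀) * τ ∈ Ioo (0 : ℝ) 1 := fun τ hτ =>
    ⟨ht₀.1.trans (hmapO τ hτ).1, (hmapO τ hτ).2⟩
  have hnotΩ : ∀ t ∈ Icc (0 : ℝ) 1, γ t ∉ Ω := fun t ht hm => by
    have := h.arc_mem_frontier ht
    rw [h.isOpen.frontier_eq] at this
    exact this.2 hm
  have haff : ∀ τ : ℝ, HasDerivAt (fun τ => t₀ + (1 - t₀) * τ) (1 - t₀) τ := fun τ => by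
    simpa using ((hasDerivAt_id τ).const_mul (1 - t₀)).const_add t₀
  refine ⟨⟨?_, ?_, ?_, ?_, ?_, ?_, ?_⟩, isOpen_upperHalf h.isOpen,
    ⟨?_, isPreconnected_upperHalf h.isOpen h.isConnected hsym⟩,
    fun w hw => ⟨hw.2, (h.inside w hw.1).2⟩, ?_, ?_⟩
  · exact h.arc.continuousOn.comp (by fun_prop) hmapI'
  · intro a ha z hz haz
    have := h.arc.injOn (hmapI' a ha) (hmapI' z hz) haz
    exact mul_left_cancel₀ hl.ne' (add_left_cancel this)
  · exact h.arc.contDiffOn.comp (by fun_prop) hmapO'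
  · intro τ hτ
    have hd : HasDerivAt γ (deriv γ (t₀ + (1 - t₀) * τ)) (t₀ + (1 - t₀) * τ) :=
      ((h.arc.contDiffOn.contDiffAt (Ioo_mem_nhds (hmapO' τ hτ).1
        (hmapO' τ hτ).2)).differentiableAt (by norm_num)).hasDerivAt
    have hcomp : HasDerivAt (fun τ => γ (t₀ + (1 - t₀) * τ))
        ((1 - t₀) • deriv γ (t₀ + (1 - t₀) * τ)) τ := hd.scomp τ (haff τ)
    rw [hcomp.deriv]
    exact smul_ne_zero hl.ne' (h.arc.deriv_ne_zero _ (hmapO' τ hτ))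
  · simpa using h0
  · simpa using h.arc.end_mem
  · intro τ hτ
    have := hmapO τ hτ
    exact ⟨hpos _ ⟨this.1, this.2.le⟩, (h.arc.inside _ (hmapO' τ hτ)).2⟩
  · obtain ⟨x₁, hx₁⟩ := h.exists_halfStrip_subset (by linarith)
    refine ⟨⟨x₁ - 1, β / 2⟩, hx₁ _ (sub_one_lt x₁) ?_ ?_, ?_⟩
    · change -β < β / 2; linarith
    · change β / 2 < β; linarith
    · change 0 < β / 2; linarith
  · obtain ⟨M, hM⟩ := h.bounded
    exact ⟨M, fun w hw => hM w hw.1⟩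
  · rw [(isOpen_upperHalf h.isOpen).frontier_eq]
    ext w
    simp only [mul_zero, add_zero, mul_one, add_sub_cancel]
    constructor
    · rintro ⟨hwc, hwU⟩
      have hwcΩ := closure_upperHalf_subset hwc
      have him : 0 ≤ w.im :=
        closure_minimal (fun z (hz : z ∈ upperHalf Ω) => hz.2.le)
          (isClosed_le continuous_const Complex.continuous_im) hwc
      rcases him.eq_or_lt with h1 | h1
      · have hwe : w = (w.re : ℂ) := Complex.ext (by simp) (by simp [← h1])
        refine Or.inl (Or.inr ⟨h1.symm, ?_⟩)
        by_contra hlt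
        refine (hreal w.re).2 (not_le.1 hlt) ?_
        rwa [← hwe]
      · have hwf : w ∈ frontier Ω := by
          rw [h.isOpen.frontier_eq]
          exact ⟨hwcΩ, fun hw => hwU ⟨hw, h1⟩⟩
        rw [h.frontier_eq] at hwf
        rcases hwf with (⟨t, ht, rfl⟩ | ⟨h2, -⟩) | h2
        · have htt : t₀ ≤ t := by
            by_contra hlt
            exact absurd h1 (hneg t ⟨ht.1, not_le.1 hlt⟩).le.not_gt
          refine Or.inl (Or.inl ⟨(t - t₀) / (1 - t₀), ⟨?_, ?_⟩, ?_⟩)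
          · exact div_nonneg (by linarith) hl.le
          · rw [div_le_one hl]; linarith [ht.2]
          · change γ (t₀ + (1 - t₀) * ((t - t₀) / (1 - t₀))) = γ t
            congr 1
            field_simp
            ring
        · rw [h2] at h1; linarith
        · exact Or.inr h2
    -- Approaching from the left along the axis through points of `Ω` includes the crossing point
    -- itself, which is not in `Ω`.
    · have haxis : ∀ w : ℂ, w.im = 0 → w.re ≤ (γ t₀).re → w ∈ closure (upperHalf Ω) := by
        intro w h1 h2
        have hlim : Tendsto (fun t : ℝ => ((w.re - t : ℝ) : ℂ)) (𝓝[>] 0) (𝓝 w) := by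
          have hc : Continuous fun t : ℝ => ((w.re - t : ℝ) : ℂ) := by fun_prop
          have hc0 := hc.tendsto 0
          have hwe : ((w.re - 0 : ℝ) : ℂ) = w := Complex.ext (by simp) (by simp [h1])
          rw [hwe] at hc0
          exact hc0.mono_left nhdsWithin_le_nhds
        have hcc : w ∈ closure (closure (upperHalf Ω)) := by
          refine mem_closure_of_tendsto hlim ?_
          filter_upwards [self_mem_nhdsWithin] with t ht
          have ht' : 0 < t := ht
          exact mem_closure_upperHalf_of_real h.isOpen ((hreal _).1 (by linarith))
        rwa [closure_closure] at hcc
      rintro ((⟨τ, hτ, rfl⟩ | ⟨h1, h2⟩) | ⟨h1, h2⟩)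
      · refine ⟨?_, fun hU => hnotΩ _ (hmapI' τ hτ) hU.1⟩
        have hm := hmapI τ hτ
        simp only
        rcases hm.1.eq_or_lt with he | hlt
        · rw [← he]
          exact haxis _ h0 le_rfl
        · exact mem_closure_upperHalf_of_im_pos
            (frontier_subset_closure (h.arc_mem_frontier (hmapI' τ hτ))) (hpos _ ⟨hlt, hm.2⟩)
      · exact ⟨haxis w h1 h2, fun hU => absurd h1 hU.2.ne'⟩
      · have hwf : w ∈ frontier Ω := by
          rw [h.frontier_eq]
          exact Or.inr ⟨h1, h2⟩
        refine ⟨mem_closure_upperHalf_of_im_pos (frontier_subset_closure hwf) (by rw [h1]; exact hβ),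
          fun hU => ?_⟩
        exact absurd h1 (h.inside w hU.1).2.ne

end IsWedgeRegion

/-! ### The even part of the potential -/

/-- Conjugation changes the sign of `i`, which enters the second derivative twice, so the Laplacian
is unaffected. -/
theorem harmonicAt_comp_conj {Φ : ℂ → ℝ} {w : ℂ}
    (h : InnerProductSpace.HarmonicAt Φ (conj w)) :
    InnerProductSpace.HarmonicAt (fun z => Φ (conj z)) w := by
  have hlap : ∀ z, Laplacian.laplacian (fun z => Φ (conj z)) z =
      Laplacian.laplacian Φ (conj z) := by
    intro z
    have hi : iteratedFDeriv ℝ 2 (fun z => Φ (conj z)) z =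
        (iteratedFDeriv ℝ 2 Φ (conj z)).compContinuousLinearMap
          fun _ => (Complex.conjCLE : ℂ →L[ℝ] ℂ) := by
      have := Complex.conjCLE.iteratedFDerivWithin_comp_right Φ uniqueDiffOn_univ
        (mem_univ (Complex.conjCLE z)) 2
      rw [preimage_univ, iteratedFDerivWithin_univ, iteratedFDerivWithin_univ] at this
      exact this
    rw [InnerProductSpace.laplacian_eq_iteratedFDeriv_complexPlane,
      InnerProductSpace.laplacian_eq_iteratedFDeriv_complexPlane]
    simp only [hi, ContinuousMultilinearMap.compContinuousLinearMap_apply,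
      iteratedFDeriv_two_apply, Matrix.cons_val_zero, Matrix.cons_val_one]
    simp
  refine ⟨h.1.comp w Complex.conjCLE.contDiff.contDiffAt, ?_⟩
  filter_upwards [Complex.continuous_conj.continuousAt.eventually h.2] with z hz
  rw [hlap]
  exact hz

theorem fderiv_comp_conj (Φ : ℂ → ℝ) (w : ℂ) :
    fderiv ℝ (fun z => Φ (conj z)) w =
      (fderiv ℝ Φ (conj w)).comp (Complex.conjCLE : ℂ →L[ℝ] ℂ) :=
  Complex.conjCLE.comp_right_fderiv

/-- The part of `Φ` that is even with respect to complex conjugation. -/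
noncomputable def evenPart (Φ : ℂ → ℝ) (w : ℂ) : ℝ := (2⁻¹ : ℝ) * (Φ w + Φ (conj w))

theorem harmonicAt_evenPart {Φ : ℂ → ℝ} {w : ℂ} (h : InnerProductSpace.HarmonicAt Φ w)
    (h' : InnerProductSpace.HarmonicAt Φ (conj w)) :
    InnerProductSpace.HarmonicAt (evenPart Φ) w :=
  (h.add (harmonicAt_comp_conj h')).const_smul (c := (2⁻¹ : ℝ))

theorem fderiv_evenPart {Φ : ℂ → ℝ} {w : ℂ} (h : DifferentiableAt ℝ Φ w)
    (h' : DifferentiableAt ℝ Φ (conj w)) :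
    fderiv ℝ (evenPart Φ) w = (2⁻¹ : ℝ) • (fderiv ℝ Φ w +
      (fderiv ℝ Φ (conj w)).comp (Complex.conjCLE : ℂ →L[ℝ] ℂ)) := by
  have h2 : DifferentiableAt ℝ (fun z => Φ (conj z)) w :=
    h'.comp w Complex.conjCLE.differentiableAt
  have : evenPart Φ = fun z => (2⁻¹ : ℝ) * (Φ z + Φ (conj z)) := rfl
  rw [this, fderiv_const_mul (h.fun_add h2), fderiv_fun_add h h2, fderiv_comp_conj]

theorem tendsto_conj_nhdsWithin {Ω : Set ℂ} (hsym : ∀ w ∈ Ω, conj w ∈ Ω) (p : ℂ) :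
    Tendsto (fun w : ℂ => conj w) (𝓝[Ω] p) (𝓝[Ω] (conj p)) :=
  Complex.continuous_conj.continuousAt.continuousWithinAt.tendsto_nhdsWithin hsym

theorem tendsto_fderiv_evenPart {Φ : ℂ → ℝ} {Ω : Set ℂ} (hsym : ∀ w ∈ Ω, conj w ∈ Ω)
    (hΦ : ∀ w ∈ Ω, DifferentiableAt ℝ Φ w) {p : ℂ} {L L' : ℂ →L[ℝ] ℝ}
    (h : Tendsto (fderiv ℝ Φ) (𝓝[Ω] p) (𝓝 L)) (h' : Tendsto (fderiv ℝ Φ) (𝓝[Ω] conj p) (𝓝 L')) :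
    Tendsto (fderiv ℝ (evenPart Φ)) (𝓝[Ω] p)
      (𝓝 ((2⁻¹ : ℝ) • (L + L'.comp (Complex.conjCLE : ℂ →L[ℝ] ℂ)))) := by
  have h1 : Tendsto (fun w => (fderiv ℝ Φ (conj w)).comp (Complex.conjCLE : ℂ →L[ℝ] ℂ)) (𝓝[Ω] p)
      (𝓝 (L'.comp (Complex.conjCLE : ℂ →L[ℝ] ℂ))) :=
    (((ContinuousLinearMap.compL ℝ ℂ ℂ ℝ).flip
      (Complex.conjCLE : ℂ →L[ℝ] ℂ)).continuous.tendsto L').comp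
      (h'.comp (tendsto_conj_nhdsWithin hsym p))
  refine ((h.add h1).const_smul (2⁻¹ : ℝ)).congr' ?_
  filter_upwards [self_mem_nhdsWithin] with w hw
  exact (fderiv_evenPart (hΦ w hw) (hΦ _ (hsym w hw))).symm

theorem power_conj (s : ℝ) (w : ℂ) : power s (conj w) = conj (power s w) := by
  rw [power, power, ← Complex.exp_conj, map_mul, Complex.conj_ofReal]

/-- Conjugation preserves the distance to the origin, and the model term `Re z ^ (-s)` is even. -/
theorem BehavesNearOrigin.evenPart {s : ℝ} {Φ : ℂ → ℝ} {Ω : Set ℂ}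
    (h : BehavesNearOrigin s Φ Ω) (hsym : ∀ w ∈ Ω, conj w ∈ Ω) :
    BehavesNearOrigin s (evenPart Φ) Ω := by
  have ht : Tendsto (fun w : ℂ => conj w) (comap Complex.re atBot ⊓ 𝓟 Ω)
      (comap Complex.re atBot ⊓ 𝓟 Ω) := by
    refine tendsto_inf.2 ⟨(tendsto_comap_iff.2 ?_).mono_left inf_le_left,
      (tendsto_principal_principal.2 hsym).mono_left inf_le_right⟩
    have : Complex.re ∘ (fun w : ℂ => conj w) = Complex.re := funext fun w => Complex.conj_re w
    rw [this]
    exact tendsto_comap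
  have h2 := h.comp_tendsto ht
  have h3 : (fun w => ‖power (-s) w‖) ∘ (fun w : ℂ => conj w) = fun w => ‖power (-s) w‖ :=
    funext fun w => by simp [power_conj]
  rw [h3] at h2
  refine ((IsLittleO.add h h2).const_mul_left (2⁻¹ : ℝ)).congr_left fun w => ?_
  simp only [Function.comp_apply, power_conj, Complex.conj_re, HeleShaw.evenPart]
  ring

theorem HasBoundaryDeriv.mono {Φ : ℂ → ℝ} {Ω Ω' : Set ℂ} {p v : ℂ} {d : ℝ}
    (h : HasBoundaryDeriv Φ Ω p v d) (hs : Ω' ⊆ Ω) : HasBoundaryDeriv Φ Ω' p v d := by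
  obtain ⟨L, hL, hd⟩ := h
  exact ⟨L, hL.mono_left (nhdsWithin_mono _ hs), hd⟩

/-- At a real point of `Ω` the potential is smooth, and averaging cancels the derivative along `i`
against that along its conjugate. -/
theorem boundaryDeriv_evenPart_axis {Φ : ℂ → ℝ} {Ω : Set ℂ}
    (hsym : ∀ w ∈ Ω, conj w ∈ Ω) (hΦ : InnerProductSpace.HarmonicOnNhd Φ Ω) {x : ℝ}
    (hx : (x : ℂ) ∈ Ω) : HasBoundaryDeriv (evenPart Φ) Ω x Complex.I 0 := by
  have hc : Tendsto (fderiv ℝ Φ) (𝓝[Ω] (x : ℂ)) (𝓝 (fderiv ℝ Φ x)) :=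
    (((hΦ x hx).1.fderiv_right (m := 1) (by norm_num)).continuousAt.tendsto).mono_left
      nhdsWithin_le_nhds
  refine ⟨_, tendsto_fderiv_evenPart hsym
    (fun w hw => (hΦ w hw).1.differentiableAt (by norm_num)) hc
    (L' := fderiv ℝ Φ x) (by rwa [Complex.conj_ofReal]), ?_⟩
  have : Complex.I / coord x = (Real.exp (-x)) • Complex.I := by
    rw [coord, div_eq_mul_inv, ← Complex.exp_neg, mul_comm, Complex.real_smul]
    push_cast
    rfl
  rw [this, map_smul]
  simp

/-- At conjugate points the tangents are conjugate up to a real factor `r`. The condition in the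
form of `boundaryDeriv_apply_normal_iff` is linear in the tangent, so `r` drops out and the
condition passes to the average with the same `c`. -/
theorem IsWedgeRegion.boundaryDeriv_evenPart {β c : ℝ} {Ω : Set ℂ} {γ : ℝ → ℂ} {Φ : ℂ → ℝ}
    (h : IsWedgeRegion (-β) β Ω γ) (hβ : 0 < β) (hsym : ∀ w ∈ Ω, conj w ∈ Ω)
    (hΦ : ∀ w ∈ Ω, DifferentiableAt ℝ Φ w)
    (hc : ∀ t ∈ Ioo (0 : ℝ) 1,
      HasBoundaryDeriv Φ Ω (γ t) (unitNormal γ t) (c * inner ℝ (coord (γ t)) (unitNormal γ t)))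
    {t : ℝ} (ht : t ∈ Ioo (0 : ℝ) 1) :
    HasBoundaryDeriv (evenPart Φ) Ω (γ t) (unitNormal γ t)
      (c * inner ℝ (coord (γ t)) (unitNormal γ t)) := by
  have hd : ∀ s ∈ Ioo (0 : ℝ) 1, DifferentiableAt ℝ γ s := fun s hs =>
    (h.arc.contDiffOn.contDiffAt (Ioo_mem_nhds hs.1 hs.2)).differentiableAt (by norm_num)
  obtain ⟨u, hu, hγu, r, hr⟩ := h.exists_conj_deriv hβ hsym ht
  obtain ⟨L, hL, hLd⟩ := hc t ht
  obtain ⟨L', hL', hLd'⟩ := hc u hu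
  rw [boundaryDeriv_apply_normal_iff (hd t ht) (h.arc.deriv_ne_zero t ht)] at hLd
  rw [boundaryDeriv_apply_normal_iff (hd u hu) (h.arc.deriv_ne_zero u hu)] at hLd'
  rw [hγu] at hL' hLd'
  refine ⟨_, tendsto_fderiv_evenPart hsym hΦ hL hL', ?_⟩
  rw [boundaryDeriv_apply_normal_iff (hd t ht) (h.arc.deriv_ne_zero t ht)]
  have e1 : conj (Complex.I * deriv γ t) = (-r) • (Complex.I * deriv γ u) := by
    rw [map_mul, hr, Complex.conj_I, neg_smul, mul_smul_comm, neg_mul]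
    simp
  have e2 : -(deriv γ t).im = r * (deriv γ u).im := by
    have := congrArg Complex.im hr
    simpa using this
  have e3 : L' (conj (Complex.I * deriv γ t)) = (-r) * L' (Complex.I * deriv γ u) := by
    rw [e1, map_smul, smul_eq_mul]
  rw [_root_.smul_apply, _root_.add_apply, ContinuousLinearMap.comp_apply, hLd]
  change (2⁻¹ : ℝ) • (_ + L' (conj (Complex.I * deriv γ t))) = _
  rw [e3, hLd', smul_eq_mul, Complex.conj_re]
  linear_combination (-(2⁻¹ : ℝ) * c * Real.exp (2 * (γ t).re)) * e2

theorem unitNormal_affine {γ : ℝ → ℂ} {a l t : ℝ} (hl : 0 < l) :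
    unitNormal (fun τ => γ (a + l * τ)) t = unitNormal γ (a + l * t) := by
  have : deriv (fun τ => coord (γ (a + l * τ))) t =
      l • deriv (fun τ => coord (γ τ)) (a + l * t) := by
    have h1 := deriv_comp_mul_left (𝕜 := ℝ) l (fun s => coord (γ (a + s))) t
    rw [h1, deriv_comp_const_add (fun s => coord (γ s)) a (l * t)]
  have hl' : (l : ℂ) ≠ 0 := by exact_mod_cast hl.ne'
  rw [unitNormal, unitNormal, this, norm_smul, Real.norm_eq_abs, abs_of_pos hl, Complex.real_smul,
    Complex.ofReal_mul, mul_div_mul_left _ _ hl']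

/-- The potential is not assumed symmetric, so `Φ` is replaced by its even part. This keeps all the
conditions, with the same `c`, and gains the reflecting condition on the axis. -/
theorem SolvesKilling.solvesKillingReflecting_upperHalf {b : ℝ} (hb : 0 < b) {Ω : Set ℂ}
    (h : SolvesKilling b Ω) : SolvesKillingReflecting b (upperHalf Ω) := by
  obtain ⟨γ, Φ, hw, hsym, hharm, hcont, hzero, horig, c, hc⟩ := h
  have hβ : 0 < Real.pi * b := by positivity
  obtain ⟨t₀, ht₀, h0, hpos, hneg⟩ := hw.exists_crossing hβ hsym
  have hl : 0 < 1 - t₀ := by linarith [ht₀.2]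
  have hsub : upperHalf Ω ⊆ Ω := fun _ hw => hw.1
  have hmap : ∀ τ ∈ Icc (0 : ℝ) 1, t₀ + (1 - t₀) * τ ∈ Icc (0 : ℝ) 1 := fun τ hτ =>
    ⟨by nlinarith [hτ.1, ht₀.1], by nlinarith [hτ.2]⟩
  have hmap' : ∀ τ ∈ Ioo (0 : ℝ) 1, t₀ + (1 - t₀) * τ ∈ Ioo (0 : ℝ) 1 := fun τ hτ =>
    ⟨by nlinarith [hτ.1, ht₀.1], by nlinarith [hτ.2]⟩
  have heven : ∀ w ∈ frontier Ω, evenPart Φ w = 0 := fun w hwf => by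
    rw [evenPart, hzero w hwf, hzero _ (conj_mem_frontier hw.isOpen hsym hwf)]
    simp
  have hwedge := hw.upperHalf_wedge hβ hsym ht₀ h0 hpos hneg
  refine ⟨fun τ => γ (t₀ + (1 - t₀) * τ), evenPart Φ, hwedge, ?_, ?_, ?_, ?_, ?_, ?_, c, ?_⟩
  · exact fun w hwU => harmonicAt_evenPart (hharm w hwU.1) (hharm _ (hsym w hwU.1))
  · have h1 : ContinuousOn (evenPart Φ) (closure Ω) :=
      continuousOn_const.mul (hcont.add (hcont.comp Complex.continuous_conj.continuousOn
        fun w hw => conj_mem_closure hsym hw))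
    exact h1.mono (closure_mono hsub)
  · exact fun τ hτ => heven _ (hw.arc_mem_frontier (hmap τ hτ))
  · intro w hwf him
    refine heven w ?_
    rw [hw.isOpen.frontier_eq]
    refine ⟨closure_mono hsub (frontier_subset_closure hwf), fun hm => ?_⟩
    exact absurd him (hw.inside w hm).2.ne
  · intro x hx
    have hxΩ := (hw.ofReal_mem_iff hβ ht₀ h0 hpos hneg x).1 (by simpa using hx)
    exact (boundaryDeriv_evenPart_axis hsym hharm hxΩ).mono hsub
  · exact (horig.evenPart hsym).mono (inf_le_inf_left _ (principal_mono.2 hsub))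
  · intro τ hτ
    rw [unitNormal_affine hl]
    exact (hw.boundaryDeriv_evenPart hβ hsym
      (fun w hw => (hharm w hw).1.differentiableAt (by norm_num)) hc (hmap' τ hτ)).mono hsub

/-! ### Integrals over symmetric regions and the conclusion -/

theorem volume_real_axis : volume {w : ℂ | w.im = 0} = 0 := by
  refine Measure.addHaar_submodule volume (LinearMap.ker Complex.imLm) fun h => ?_
  have : Complex.I ∈ LinearMap.ker Complex.imLm := h ▸ Submodule.mem_top
  simp at this

/-- The integral of a function commuting with complex conjugation over a symmetric region. -/
theorem setIntegral_of_conj_symmetric {Ω : Set ℂ} (hsym : ∀ w ∈ Ω, conj w ∈ Ω)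
    {F : ℂ → ℂ} (hF : IntegrableOn F Ω) (hconj : ∀ w, F (conj w) = conj (F w)) :
    ∫ w in Ω, F w = ((2 * ∫ w in upperHalf Ω, (F w).re : ℝ) : ℂ) := by
  have hpos : IsOpen {w : ℂ | 0 < w.im} := isOpen_lt continuous_const Complex.continuous_im
  -- Up to the null real axis, the rest of `Ω` is the mirror image of the upper half, whose integral
  -- is the complex conjugate.
  have hlow : (Ω \ {w : ℂ | 0 < w.im} : Set ℂ) =ᵐ[volume]
      ((fun w : ℂ => conj w) ⁻¹' upperHalf Ω : Set ℂ) := by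
    have : ∀ᵐ w : ℂ, w.im ≠ 0 := by
      rw [ae_iff]
      simpa using volume_real_axis
    filter_upwards [this] with w hw
    refine propext ⟨fun h => ⟨hsym w h.1, ?_⟩, fun h => ⟨by simpa using hsym _ h.1, ?_⟩⟩
    · rw [Complex.conj_im]
      have := lt_of_le_of_ne (not_lt.1 h.2) hw
      linarith
    · have := h.2
      rw [Complex.conj_im] at this
      exact fun h0 : 0 < w.im => by linarith
  have hrefl : ∫ w in (fun w : ℂ => conj w) ⁻¹' upperHalf Ω, F w =
      conj (∫ w in upperHalf Ω, F w) := by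
    rw [← integral_conj]
    refine Eq.trans ?_ ((LinearIsometryEquiv.measurePreserving
      Complex.conjLIE).setIntegral_preimage_emb
      Complex.conjLIE.toHomeomorph.measurableEmbedding (fun w => conj (F w)) (upperHalf Ω))
    refine integral_congr_ae (Eventually.of_forall fun w => ?_)
    change F w = conj (F (conj w))
    rw [hconj, Complex.conj_conj]
  have hre : (∫ w in upperHalf Ω, F w).re = ∫ w in upperHalf Ω, (F w).re :=
    (Complex.reCLM.integral_comp_comm (hF.mono_set fun _ h => h.1)).symm
  rw [← integral_inter_add_sdiff hpos.measurableSet hF, setIntegral_congr_set hlow, hrefl]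
  change (∫ w in upperHalf Ω, F w) + _ = _
  rw [Complex.add_conj, hre]

/-- Powers with real exponent commute with conjugation, so the complex integral is twice the real
moment of the upper half, which vanishes by the reflecting problem. -/
theorem SolvesKilling.integral_power {b : ℝ} (hb : 0 < b) {Ω : Set ℂ} (h : SolvesKilling b Ω)
    {n : ℕ} (hn : 1 ≤ n) :
    IntegrableOn (power ((2 * n + 1) / (2 * b))) Ω area ∧
      ∫ w in Ω, power ((2 * n + 1) / (2 * b)) w ∂area = 0 := by
  have hhalf := ((h.solvesKillingReflecting_upperHalf hb).integral_re_power hb hn).2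
  obtain ⟨γ, Φ, hw, hsym, -⟩ := h
  have hΩ := hw.isOpen
  have hint := hw.integrableOn_power (s := (2 * n + 1) / (2 * b)) (by positivity)
  refine ⟨hint, ?_⟩
  rw [setIntegral_area (isOpen_upperHalf hΩ).measurableSet] at hhalf
  rw [setIntegral_area hΩ.measurableSet, setIntegral_of_conj_symmetric hsym
    ((integrableOn_area_iff hΩ.measurableSet).1 hint)]
  · simp only [Complex.smul_re]
    rw [hhalf]
    simp
  · intro w
    simp only [power_conj, density, Complex.conj_re, Complex.real_smul, map_mul,
      Complex.conj_ofReal]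

end HeleShaw

theorem mainTheorem4 (b : ℝ) (hb : 0 < b) :
    (∀ Ω : Set ℂ, HeleShaw.SolvesKilling b Ω →
      (∀ n : ℕ, 1 ≤ n →
        IntegrableOn (HeleShaw.power ((2 * n + 1) / (2 * b))) Ω HeleShaw.area ∧
        ∫ w in Ω, HeleShaw.power ((2 * n + 1) / (2 * b)) w ∂HeleShaw.area = 0) ∧
      HeleShaw.SolvesKillingReflecting b (HeleShaw.upperHalf Ω)) ∧
    (∀ Ω : Set ℂ, HeleShaw.SolvesKillingReflecting b Ω →
      ∀ n : ℕ, 1 ≤ n →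
        IntegrableOn (fun w => (HeleShaw.power ((2 * n + 1) / (2 * b)) w).re) Ω HeleShaw.area ∧
        ∫ w in Ω, (HeleShaw.power ((2 * n + 1) / (2 * b)) w).re ∂HeleShaw.area = 0) :=
  ⟨fun _ h => ⟨fun _ hn => h.integral_power hb hn, h.solvesKillingReflecting_upperHalf hb⟩,
    fun _ h _ hn => h.integral_re_power hb hn⟩
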